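/- Let $1\le k\le n-1$, $J=\mathrm{I}_{n-k,k}=\operatorname{diag}(\epsilon_1,\dots,\epsilon_n)$ with $\epsilon_i=1$ for $i\le n-k$ and $\epsilon_i=-1$ for $i>n-k$, $(x,y)_k=x^TJy$, $G=\operatorname{diag}(\mathrm{I}_{n+1},J)$, $\rho=\operatorname{diag}(\mathrm{I}_{n+1},-\mathrm{I}_n)$, $\sigma(g)=\rho g\rho^{-1}$. For $\xi\in\mathbb{R}^{n\times(n+1)}$ put $P(\xi)=\begin{pmatrix}0&-\xi^TJ\\ \xi&0\end{pmatrix}$, and let $a_i=P((e_{ii},0))$, $1\le i\le n$. Let $\Omega\subset\mathbb{R}^n$ be a connected open set containing $0$, and let $(F,\gamma)$ be a smooth solution on $\Omega$ of the $\frac{\mathrm{O}(2n+1-k,k)}{\mathrm{O}(n+1)\times\mathrm{O}(n-k,k)}$-system: $F=(f_{ij})$ is $n\times n$ with $f_{ii}=0$, $\gamma$ is $\mathbb{R}^n$-valued, and $v=P((F,\gamma))$ satisfies $[a_i,v_{x_j}]-[a_j,v_{x_i}]-[[a_i,v],[a_j,v]]=0$ for $i\ne j$. Let $E_\lambda(x)$,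 $\lambda\in\mathbb{C}$, be the normalized extended frame: $E_\lambda^TGE_\lambda=G$, $E_\lambda^{-1}\mathrm{d}E_\lambda=\sum_i(a_i\lambda+[a_i,v])\,\mathrm{d}x_i$, $\overline{E_{\bar\lambda}}=E_\lambda$, $\sigma(E_{-\lambda})=E_\lambda$, $E_\lambda(0)=\mathrm{I}$. Let $\alpha\in\mathbb{R}^\times\cup i\mathbb{R}^\times$ and let $\ell$ be a real line, isotropic for $G$, with $\ell\subset\mathbb{R}^{n+1}\oplus\mathbb{R}^{n}$ if $\alpha$ is real and $\ell\subset\mathbb{R}^{n+1}\oplus i\mathbb{R}^{n}$ if $\alpha$ is imaginary. Put $L=\ell\otimes\mathbb{C}$ and assume $\rho L\ne L$. For such a line let $$p_{\alpha,L}(\lambda)=\tfrac{\lambda-\alpha}{\lambda+\alpha}\pi_L+\pi_{(L\oplus\rho L)^\perp}+\tfrac{\lambda+\alpha}{\lambda-\alpha}\pi_{\rho L},$$ where $\pi_L$, $\pi_{\rho L}$, $\pi_{(L\oplus\rho L)^\perp}$ are the projections onto $L$, $\rho L$, $(L\oplus\rho L)^\perp$ along $(\rho L)^\perp$, $L^\perp$,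 $L\oplus\rho L$ respectively ($\perp$ with respect to the complex bilinear form $G$). Set $\tilde L(x)=E_\alpha(x)^{-1}L$, $D=\{x\in\Omega:\rho\tilde L(x)\ne\tilde L(x)\}$ and $\tilde E_\lambda(x)=E_\lambda(x)\,p_{\alpha,\tilde L(x)}(\lambda)^{-1}$ for $x\in D$. Let $c\in\mathbb{R}^n$ be a constant vector with $(c,c)_k=0$. Then $D$ is an open neighbourhood of $0$ in $\Omega$, and: 1. For $x\in\Omega$, $E_0=\operatorname{diag}(g_1,g_2)$ with $g_1\in\mathrm{O}(n+1)$, $g_2\in\mathrm{O}(n-k,k)$, and $\frac{\partial E}{\partial\lambda}E^{-1}|_{\lambda=0}=\begin{pmatrix}0&Y\\-JY^T&0\end{pmatrix}$ with $Y$ real. For $x\in D$, likewise $\tilde E_0=\operatorname{diag}(\tilde g_1,\tilde g_2)$, and $\tilde E$ gives $\tilde Y$. 2. Put $f_c=Yc$, $g_1=(e_1,\dots,e_{n+1})$, $\tilde g_1=(\tilde e_1,\dots,\tilde e_{n+1})$, $u=Jg_2^{-1}c$, $\tilde u=J\tilde g_2^{-1}c$. On $\Omega$, $f_c$ is immersive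 exactly where all $u_i\ne0$; on this open set $f_c$ is isothermic$_k$ (the coordinates $x$ are line of curvature coordinates and the induced metric $\sum g_{ii}\,\mathrm{d}x_i^2$ satisfies $\sum_{i\le n-k}g_{ii}=\sum_{i>n-k}g_{ii}$), with unit normal $e_{n+1}$ and principal directions $e_1,\dots,e_n$. 3. For each $x\in D$, $\tilde L(x)$ is spanned by some $\begin{pmatrix}Q\\Z\end{pmatrix}$ with $Q=(q_1,\dots,q_{n+1})^T$ real, $Z$ real or purely imaginary according to the type of $\alpha$, and $Q^TQ=2=-(Z,Z)_k$. For every such choice of $Q(x),Z(x)$, the number $Z^Tu/\alpha$ is real and $$\tilde f_c:=f_c-\frac{Z^Tu}{\alpha}\sum_{j=1}^{n+1}q_je_j$$ satisfies $\tilde f_c=\tilde Yc$ on $D$. Moreover: (a) on $D$, $\tilde f_c$ is immersive exactly where all $\tilde u_i\ne0$, and on this open set it is isothermic$_k$ in the coordinates $x$; (b) there, $\tilde e_{n+1}$ is a unit normal and $\tilde e_1,\dots,\tilde e_n$ are principal directions of $\tilde f_c$; on all of $D$, $\tilde e_i=e_i-q_i\sum_{j}q_je_j$ for $1\le i\le n+1$;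 (c) $f_c\mapsto\tilde f_c$ is a Ribaucour transform on the open set where all $u_i,\tilde u_i,q_i$ and $Z^Tu$ are nonzero: for each such $x$ there is a sphere of positive radius tangent to the two hypersurfaces at $f_c(x)$ and $\tilde f_c(x)$, and there are smooth orthonormal frames of principal directions of the two, corresponding under the differential of $f_c(x)\mapsto\tilde f_c(x)$ up to scalar factors, such that corresponding principal lines through $f_c(x)$ and $\tilde f_c(x)$ meet at equal distance from these points. In fact, for all $x\in D$ and all $1\le i\le n+1$ with $q_i(x)\ne0$, $$\tilde f_c-\frac{Z^Tu}{\alpha q_i}\tilde e_i=f_c-\frac{Z^Tu}{\alpha q_i}e_i.$$ -/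

import Mathlib

open scoped Matrix ContDiff

noncomputable section

namespace Guichard

/-- Euclidean space `ℝⁿ`, both as parameter domain and as ambient space. -/
abbrev Pt (n : ℕ) := EuclideanSpace ℝ (Fin n)

/-- Index set of the block decomposition `(n + 1) + n`. -/
abbrev Idx (n : ℕ) := Fin (n + 1) ⊕ Fin n

/-- The `i`-th partial derivative. -/
def pd {n : ℕ} {W : Type*} [NormedAddCommGroup W] [NormedSpace ℝ W]
    (i : Fin n) (g : Pt n → W) (x : Pt n) : W :=
  fderiv ℝ g x (EuclideanSpace.single i 1)

/-- The `i`-th partial derivative of a matrix-valued map, entry by entry. -/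
def pdMat {n : ℕ} {l m W : Type*} [NormedAddCommGroup W] [NormedSpace ℝ W]
    (i : Fin n) (M : Pt n → Matrix l m W) (x : Pt n) : Matrix l m W :=
  Matrix.of fun a b => pd i (fun y => M y a b) x

/-- Complexification of a real matrix. -/
def cx {l m : Type*} (M : Matrix l m ℝ) : Matrix l m ℂ := M.map fun r => (r : ℂ)

/-! ### The symmetric space `O(2n+1-k, k) / (O(n+1) × O(n-k, k))` -/

/-- The signs `ε₁ = … = ε_{n-k} = 1`, `ε_{n-k+1} = … = ε_n = -1`. -/
def eps (n k : ℕ) (i : Fin n) : ℝ := if (i : ℕ) < n - k then 1 else -1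

/-- `J = I_{n-k,k}`. -/
def J (n k : ℕ) : Matrix (Fin n) (Fin n) ℝ := Matrix.diagonal (eps n k)

/-- Gram matrix of the form of signature `(2n+1-k, k)`. -/
def gram (n k : ℕ) : Matrix (Idx n) (Idx n) ℝ := Matrix.fromBlocks 1 0 0 (J n k)

/-- `ρ = I_{n+1,n}`; the involution `σ` is conjugation by `ρ`. -/
def rho (n : ℕ) : Matrix (Idx n) (Idx n) ℝ := Matrix.fromBlocks 1 0 0 (-1)

/-- The element of `𝔭` with lower left block `ξ`. -/
def pElt (n k : ℕ) (ξ : Matrix (Fin n) (Fin (n + 1)) ℝ) : Matrix (Idx n) (Idx n) ℝ :=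
  Matrix.fromBlocks 0 (-(ξᵀ * J n k)) ξ 0

/-- The basis `a₁, …, a_n` of the maximal abelian subalgebra: `ξ = (e_{ii}, 0)`. -/
def aElt (n k : ℕ) (i : Fin n) : Matrix (Idx n) (Idx n) ℝ :=
  pElt n k (Matrix.single i i.castSucc 1)

/-- `ξ = (F, γ)`, with `γ` as last column. -/
def xiMat {n : ℕ} (F : Matrix (Fin n) (Fin n) ℝ) (γ : Fin n → ℝ) :
    Matrix (Fin n) (Fin (n + 1)) ℝ :=
  Matrix.of fun i => Fin.snoc (α := fun _ => ℝ) (F i) (γ i)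

/-- The `𝔭`-valued map `v` belonging to `(F, γ)`. -/
def vMap (n k : ℕ) (F : Pt n → Matrix (Fin n) (Fin n) ℝ) (γ : Pt n → Fin n → ℝ) (x : Pt n) :
    Matrix (Idx n) (Idx n) ℝ :=
  pElt n k (xiMat (F x) (γ x))

/-- `(F, γ)` is a smooth solution on `Ω` of the system
`[a_i, v_{x_j}] - [a_j, v_{x_i}] - [[a_i, v], [a_j, v]] = 0`, `i ≠ j`, with `f_{ii} = 0`. -/
structure IsSolution (n k : ℕ) (Ω : Set (Pt n)) (F : Pt n → Matrix (Fin n) (Fin n) ℝ)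
    (γ : Pt n → Fin n → ℝ) : Prop where
  smooth_F : ∀ i j, ContDiffOn ℝ ∞ (fun x => F x i j) Ω
  smooth_γ : ∀ i, ContDiffOn ℝ ∞ (fun x => γ x i) Ω
  diag : ∀ x ∈ Ω, ∀ i, F x i i = 0
  eqn : ∀ x ∈ Ω, ∀ i j : Fin n, i ≠ j →
    ⁅aElt n k i, pdMat j (vMap n k F γ) x⁆ - ⁅aElt n k j, pdMat i (vMap n k F γ) x⁆
      - ⁅⁅aElt n k i, vMap n k F γ x⁆, ⁅aElt n k j, vMap n k F γ x⁆⁆ = 0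

/-- Coefficient of `dx_i` in the Lax pair `θ_l = ∑ (a_i l + [a_i, v]) dx_i`. -/
def lax (n k : ℕ) (F : Pt n → Matrix (Fin n) (Fin n) ℝ) (γ : Pt n → Fin n → ℝ)
    (i : Fin n) (x : Pt n) (l : ℂ) : Matrix (Idx n) (Idx n) ℂ :=
  l • cx (aElt n k i) + cx ⁅aElt n k i, vMap n k F γ x⁆

/-- Extended frame on `Ω`: a parallel frame of the Lax pair, with values in the complex group, that
satisfies the reality condition. -/
structure IsExtendedFrame (n k : ℕ) (Ω : Set (Pt n)) (F : Pt n → Matrix (Fin n) (Fin n) ℝ)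
    (γ : Pt n → Fin n → ℝ) (E : Pt n → ℂ → Matrix (Idx n) (Idx n) ℂ) : Prop where
  smooth : ∀ l a b, ContDiffOn ℝ ∞ (fun x => E x l a b) Ω
  group : ∀ x ∈ Ω, ∀ l, (E x l)ᵀ * cx (gram n k) * E x l = cx (gram n k)
  parallel : ∀ x ∈ Ω, ∀ l, ∀ i, pdMat i (fun y => E y l) x = E x l * lax n k F γ i x l
  real : ∀ x ∈ Ω, ∀ l, (E x (star l)).map star = E x l
  twisted : ∀ x ∈ Ω, ∀ l, cx (rho n) * E x (-l) * (cx (rho n))⁻¹ = E x l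

/-- Normalized extended frame: `E(0, l) = I`. -/
structure IsNormalizedFrame (n k : ℕ) (Ω : Set (Pt n)) (F : Pt n → Matrix (Fin n) (Fin n) ℝ)
    (γ : Pt n → Fin n → ℝ) (E : Pt n → ℂ → Matrix (Idx n) (Idx n) ℂ) : Prop
    extends IsExtendedFrame n k Ω F γ E where
  normalized : ∀ l, E 0 l = 1

/-! ### Data read off from a loop `G` at `l = 0` -/

/-- The upper left block `g₁` of `G(0)`. -/
def topBlock {n : ℕ} (G : ℂ → Matrix (Idx n) (Idx n) ℂ) : Matrix (Fin (n + 1)) (Fin (n + 1)) ℝ :=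
  (G 0).toBlocks₁₁.map Complex.re

/-- The lower right block `g₂` of `G(0)`. -/
def botBlock {n : ℕ} (G : ℂ → Matrix (Idx n) (Idx n) ℂ) : Matrix (Fin n) (Fin n) ℝ :=
  (G 0).toBlocks₂₂.map Complex.re

/-- `(∂G/∂l) G⁻¹` at `l = 0`. -/
def logDeriv {n : ℕ} (G : ℂ → Matrix (Idx n) (Idx n) ℂ) : Matrix (Idx n) (Idx n) ℂ :=
  (Matrix.of fun a b => deriv (fun l => G l a b) 0) * (G 0)⁻¹

/-- The upper right block `Y` of `(∂G/∂l) G⁻¹` at `l = 0`. -/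
def potential {n : ℕ} (G : ℂ → Matrix (Idx n) (Idx n) ℂ) : Matrix (Fin (n + 1)) (Fin n) ℝ :=
  (logDeriv G).toBlocks₁₂.map Complex.re

/-- `G(0) = diag(g₁, g₂)` with `g₁ ∈ O(n+1)` and `g₂ ∈ O(n-k, k)`. -/
def HasBlocks (n k : ℕ) (G : ℂ → Matrix (Idx n) (Idx n) ℂ) : Prop :=
  G 0 = Matrix.fromBlocks (cx (topBlock G)) 0 0 (cx (botBlock G)) ∧
  topBlock G ∈ Matrix.orthogonalGroup (Fin (n + 1)) ℝ ∧
  (botBlock G)ᵀ * J n k * botBlock G = J n k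

/-- `G` is differentiable at `0` and `(∂G/∂l) G⁻¹` at `0` has blocks `0, Y, -J Yᵀ, 0`, `Y` real. -/
def HasPotential (n k : ℕ) (G : ℂ → Matrix (Idx n) (Idx n) ℂ) : Prop :=
  (∀ a b, DifferentiableAt ℂ (fun l => G l a b) 0) ∧
  logDeriv G =
    Matrix.fromBlocks 0 (cx (potential G)) (-cx (J n k * (potential G)ᵀ)) 0

/-- The vector `e_i`: the `i`-th column of `g₁`. -/
def frameVec {n : ℕ} (G : ℂ → Matrix (Idx n) (Idx n) ℂ) (i : Fin (n + 1)) : Pt (n + 1) :=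
  WithLp.toLp 2 fun a => topBlock G a i

/-- The vector `u = J g₂⁻¹ c`. -/
def metricField (n k : ℕ) (G : ℂ → Matrix (Idx n) (Idx n) ℂ) (c : Fin n → ℝ) : Fin n → ℝ :=
  J n k *ᵥ ((botBlock G)⁻¹ *ᵥ c)

/-- The point `Y c`. -/
def surfacePt {n : ℕ} (G : ℂ → Matrix (Idx n) (Idx n) ℂ) (c : Fin n → ℝ) : Pt (n + 1) :=
  WithLp.toLp 2 (potential G *ᵥ c)

/-! ### Simple elements and dressing -/

/-- `α ∈ ℝ^× ∪ iℝ^×` and `L = ℓ ⊗ ℂ` for an isotropic real line `ℓ`, which lies in `ℝ^{2n+1-k,k}` if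
`α` is real and in `ℝ^{n+1} ⊕ i ℝ^{n-k,k}` if `α` is imaginary. -/
def IsAdmissible (n k : ℕ) (α : ℂ) (L : Submodule ℂ (Idx n → ℂ)) : Prop :=
  α ≠ 0 ∧ ∃ v : Idx n → ℂ, v ≠ 0 ∧ L = Submodule.span ℂ {v} ∧ v ⬝ᵥ (cx (gram n k) *ᵥ v) = 0 ∧
    ((α.im = 0 ∧ ∀ a, (v a).im = 0) ∨
     (α.re = 0 ∧ (∀ i, (v (Sum.inl i)).im = 0) ∧ ∀ j, (v (Sum.inr j)).re = 0))

/-- The subspace `ρ L`. -/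
def reflect {n : ℕ} (L : Submodule ℂ (Idx n → ℂ)) : Submodule ℂ (Idx n → ℂ) :=
  L.map (Matrix.toLin' (cx (rho n)))

/-- Orthogonal complement for the complex bilinear form of signature `(2n+1-k, k)`. -/
def perp (n k : ℕ) (L : Submodule ℂ (Idx n → ℂ)) : Submodule ℂ (Idx n → ℂ) :=
  LinearMap.BilinForm.orthogonal (Matrix.toBilin' (cx (gram n k))) L

open Classical in
/-- Matrix of the projection onto `A` along `B` (zero if these are not complementary). -/
def projAlong {n : ℕ} (A B : Submodule ℂ (Idx n → ℂ)) : Matrix (Idx n) (Idx n) ℂ :=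
  if h : IsCompl A B then LinearMap.toMatrix' (Submodule.projection A B h) else 0

/-- The simple element
`p_{α,L}(l) = (l-α)/(l+α) π_L + π_{(L ⊕ ρL)^⊥} + (l+α)/(l-α) π_{ρL}`. -/
def simpleElt (n k : ℕ) (α : ℂ) (L : Submodule ℂ (Idx n → ℂ)) (l : ℂ) :
    Matrix (Idx n) (Idx n) ℂ :=
  ((l - α) / (l + α)) • projAlong L (perp n k (reflect L))
    + projAlong (perp n k (L ⊔ reflect L)) (L ⊔ reflect L)
    + ((l + α) / (l - α)) • projAlong (reflect L) (perp n k L)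

/-- `L̃(x) = E_α(x)⁻¹ L`. -/
def dressedLine {n : ℕ} (E : Pt n → ℂ → Matrix (Idx n) (Idx n) ℂ) (α : ℂ)
    (L : Submodule ℂ (Idx n → ℂ)) (x : Pt n) : Submodule ℂ (Idx n → ℂ) :=
  L.map (Matrix.toLin' (E x α)⁻¹)

/-- `Ẽ(x, l) = E(x, l) p_{α, L̃(x)}(l)⁻¹`. -/
def dressedFrame (n k : ℕ) (E : Pt n → ℂ → Matrix (Idx n) (Idx n) ℂ) (α : ℂ)
    (L : Submodule ℂ (Idx n → ℂ)) (x : Pt n) (l : ℂ) : Matrix (Idx n) (Idx n) ℂ :=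
  E x l * (simpleElt n k α (dressedLine E α L x) l)⁻¹

/-- `M` is spanned by `(Q, Z)` with `(Q, Q) = 2 = -(Z, Z)_k`, `Q` real, and `Z` real or imaginary
according to the type of `α`. -/
structure IsNormalizedSpan (n k : ℕ) (α : ℂ) (M : Submodule ℂ (Idx n → ℂ))
    (Q : Fin (n + 1) → ℝ) (Z : Fin n → ℂ) : Prop where
  span : M = Submodule.span ℂ {Sum.elim (fun i => (Q i : ℂ)) Z}
  normQ : Q ⬝ᵥ Q = 2
  normZ : Z ⬝ᵥ (cx (J n k) *ᵥ Z) = -2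
  typeZ : (α.im = 0 ∧ ∀ j, (Z j).im = 0) ∨ (α.re = 0 ∧ ∀ j, (Z j).re = 0)

/-! ### Hypersurfaces in `ℝ^{n+1}` -/

/-- `N` is a smooth unit normal field of `f` on `U`. -/
structure IsUnitNormal {n : ℕ} (f N : Pt n → Pt (n + 1)) (U : Set (Pt n)) : Prop where
  smooth : ContDiffOn ℝ ∞ N U
  unit : ∀ x ∈ U, ‖N x‖ = 1
  normal : ∀ x ∈ U, ∀ w, inner ℝ (fderiv ℝ f x w) (N x) = 0

/-- `e` is a unit principal direction of `f` at `x`: `e = df(w)`, and `w` is an eigenvector of the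
shape operator `S`, which is given by `df(S w) = -dN(w)`. -/
def IsPrincipalDirection {n : ℕ} (f N : Pt n → Pt (n + 1)) (x : Pt n) (e : Pt (n + 1)) : Prop :=
  ‖e‖ = 1 ∧ ∃ (w : Pt n) (κ : ℝ), fderiv ℝ f x w = e ∧ fderiv ℝ N x w = -(κ • e)

/-- On the open set `U` the map `f` is a smooth immersed hypersurface, the coordinates are line of
curvature coordinates, and the induced metric `∑ g_ii dx_i²` satisfies
`∑_{i ≤ n-k} g_ii = ∑_{i > n-k} g_ii`. -/
structure IsIsothermic (n k : ℕ) (f : Pt n → Pt (n + 1)) (U : Set (Pt n)) : Prop where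
  isOpen : IsOpen U
  smooth : ContDiffOn ℝ ∞ f U
  immersion : ∀ x ∈ U, Function.Injective (fderiv ℝ f x)
  orthogonal : ∀ x ∈ U, ∀ i j : Fin n, i ≠ j → inner ℝ (pd i f x) (pd j f x) = 0
  curvatureLines : ∃ N : Pt n → Pt (n + 1), IsUnitNormal f N U ∧
    ∀ x ∈ U, ∀ i : Fin n, ∃ κ : ℝ, pd i N x = -(κ • pd i f x)
  guichard : ∀ x ∈ U,
    ∑ i ∈ Finset.univ.filter (fun i : Fin n => (i : ℕ) < n - k), ‖pd i f x‖ ^ 2 =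
      ∑ i ∈ Finset.univ.filter (fun i : Fin n => n - k ≤ (i : ℕ)), ‖pd i f x‖ ^ 2

/-- The correspondence `f(x) ↦ f'(x)` of immersed hypersurfaces parametrized by the open set `U` is
a Ribaucour transform: at each point there is a (nondegenerate) sphere tangent to both
hypersurfaces at corresponding points, and there are smooth orthonormal tangent frames `e`, `e'` of
principal directions, with `e'_i` parallel to the image of `e_i`, such that the lines in the
directions `e_i` and `e'_i` meet at equal distance from the corresponding points. -/
def IsRibaucour {n : ℕ} (f f' : Pt n → Pt (n + 1)) (U : Set (Pt n)) : Prop :=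
  IsOpen U ∧ ContDiffOn ℝ ∞ f U ∧ ContDiffOn ℝ ∞ f' U ∧
  (∀ x ∈ U, Function.Injective (fderiv ℝ f x) ∧ Function.Injective (fderiv ℝ f' x)) ∧
  (∀ x ∈ U, ∃ (C : Pt (n + 1)) (r : ℝ), 0 < r ∧
    f x ∈ Metric.sphere C r ∧ f' x ∈ Metric.sphere C r ∧
    ∀ w, inner ℝ (fderiv ℝ f x w) (f x - C) = 0 ∧ inner ℝ (fderiv ℝ f' x w) (f' x - C) = 0) ∧
  ∃ (N N' : Pt n → Pt (n + 1)) (e e' : Fin n → Pt n → Pt (n + 1)) (h : Fin n → Pt n → ℝ),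
    IsUnitNormal f N U ∧ IsUnitNormal f' N' U ∧
    (∀ i, ContDiffOn ℝ ∞ (e i) U ∧ ContDiffOn ℝ ∞ (e' i) U) ∧
    ∀ x ∈ U, Orthonormal ℝ (fun i => e i x) ∧ Orthonormal ℝ (fun i => e' i x) ∧
      ∀ i, IsPrincipalDirection f N x (e i x) ∧ IsPrincipalDirection f' N' x (e' i x) ∧
        (∃ (w : Pt n) (s : ℝ), fderiv ℝ f x w = e i x ∧ fderiv ℝ f' x w = s • e' i x) ∧
        f' x + h i x • e' i x = f x + h i x • e i x

end Guichard

end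

/-!
The proof works with the frame near `l = 0` and with the single vector `E_α⁻¹ v`, where `v` spans
the isotropic line `L`; it needs no other values of `l`.

*The hypersurface.* Write `E₀ = diag(g₁, g₂)` and `[aᵢ, v] = diag(Aᵢ, Cᵢ)` with `Aᵢ` skew. The
quotients `W_l = E_l E₀⁻¹` satisfy `dW_l = l W_l B` with `B = E₀ (∑ aᵢ dxᵢ) E₀⁻¹`, and
`(W_l - 1) / l` has derivative `W_l B → B`; so `E` is differentiable in `l` at `0` and the
logarithmic derivative is a primitive of `B` (`exists_hasDerivAt_parameter`,
`IsNormalizedFrame.differentiableAt_and_hasPdMat_logDeriv`). Reading off blocks gives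
`∂ᵢ f = -uᵢ eᵢ`, while `∂ᵢ e_{n+1}` is a multiple of `eᵢ`, and `u = g₂ᵀ J c` is isotropic like `c`.
An orthonormal frame with these three properties is called adapted (`AdaptedFrame`), and everything
that is claimed about `f` alone, and about `f̃` alone, follows from having one.

*The dressed frame.* The value and the derivative at `0` of the simple element spanned by a
normalized vector `(Q, θ b)` are explicit (`dressing`), where `α = θ a` with `a` real and `θ = 1` or
`θ = i`. They give `ẽᵢ = eᵢ - Qᵢ ∑ Qⱼ eⱼ`, `ũ = u + θ² (b, u) J b` and
`f̃ = f - ((b, u) / a) ∑ Qⱼ eⱼ` (`dressing_geometric`).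

*The transform is adapted.* The vector `E_α⁻¹ v = (q, θ b)` solves a linear system, and
normalized spanning vectors are real multiples of it, so that all formulas above depend smoothly on
the point through `q`, `b`, although `Q` is only defined up to sign. Differentiating them directly
yields `∂ᵢ f̃ = -ũᵢ ẽᵢ` and `∂ᵢ ẽ_{n+1} ∥ ẽᵢ` (`DressingData.adaptedFrame_dressed`).

*Ribaucour property.* The formulas for `f̃` and `ẽᵢ` show that the lines through `f` and `f̃` in
directions `eᵢ` and `ẽᵢ` meet at equal distance, for `i = n + 1` in the centre of the common tangent
sphere (`AdaptedFrame.isRibaucour`).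
-/

noncomputable section

namespace Guichard

open Filter Topology

section

/-! ### Linear equations `dW = l W B` depending on a parameter -/

section Parameter

variable {V 𝔸 : Type*} [NormedAddCommGroup V] [NormedSpace ℝ V] [FiniteDimensional ℝ V]
  [NormedRing 𝔸] [NormedAlgebra ℂ 𝔸]

/-- On a small ball, solutions of `dW_l = l W_l B` converge uniformly to `1` as `l → 0` as soon as
they converge at one point of the ball. The supremum of `‖W_l‖` over the closed ball is attained,
and the mean value inequality bounds it by `‖W_l y‖` plus half of itself, for small `l`. -/
theorem tendstoUniformlyOn_one_of_small {B : V → V →L[ℝ] 𝔸} {W : ℂ → V → 𝔸} {x : V} {r M : ℝ}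
    (hW : ∀ l, ∀ z ∈ Metric.closedBall x r, HasFDerivAt (W l)
      (l • (ContinuousLinearMap.mul ℝ 𝔸 (W l z)).comp (B z)) z)
    (hB : ∀ z ∈ Metric.closedBall x r, ‖B z‖ ≤ M) {y : V} (hy : y ∈ Metric.closedBall x r)
    (hWy : Tendsto (fun l => W l y) (𝓝[≠] 0) (𝓝 1)) :
    TendstoUniformlyOn W (fun _ => 1) (𝓝[≠] 0) (Metric.closedBall x r) := by
  have hM : 0 ≤ M := (norm_nonneg _).trans (hB y hy)
  have hbound : ∀ l : ℂ, ∀ S : ℝ, (∀ z ∈ Metric.closedBall x r, ‖W l z‖ ≤ S) →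
      ∀ z ∈ Metric.closedBall x r, ‖W l z - W l y‖ ≤ ‖l‖ * (S * M) * (2 * r) := by
    intro l S hS z hz
    have h1 := (convex_closedBall x r).norm_image_sub_le_of_norm_hasFDerivWithin_le
      (f := W l) (C := ‖l‖ * (S * M)) (fun z hz => (hW l z hz).hasFDerivWithinAt)
      (fun z hz => ?_) hy hz
    · refine h1.trans (mul_le_mul_of_nonneg_left ?_ ?_)
      · rw [← dist_eq_norm]
        have h2 := dist_triangle_right z y x
        rw [Metric.mem_closedBall] at hz hy
        linarith
      · have : 0 ≤ S := (norm_nonneg _).trans (hS y hy)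
        positivity
    · rw [norm_smul]
      refine mul_le_mul_of_nonneg_left ?_ (norm_nonneg _)
      refine (ContinuousLinearMap.opNorm_comp_le _ _).trans ?_
      exact mul_le_mul ((ContinuousLinearMap.opNorm_mul_apply_le ℝ 𝔸 _).trans (hS z hz))
        (hB z hz) (norm_nonneg _) ((norm_nonneg _).trans (hS z hz))
  have hl0 : Tendsto (fun l : ℂ => ‖l‖) (𝓝[≠] 0) (𝓝 0) := by
    have := (continuous_norm (E := ℂ)).tendsto 0
    rw [norm_zero] at this
    exact this.mono_left nhdsWithin_le_nhds
  have hsmall : ∀ᶠ l : ℂ in 𝓝[≠] 0, ‖l‖ * M * (2 * r) < 1 / 2 := by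
    have : Tendsto (fun l : ℂ => ‖l‖ * M * (2 * r)) (𝓝[≠] 0) (𝓝 (0 * M * (2 * r))) :=
      (hl0.mul_const _).mul_const _
    rw [zero_mul, zero_mul] at this
    exact this.eventually (gt_mem_nhds (by norm_num))
  have hWyb : ∀ᶠ l : ℂ in 𝓝[≠] 0, ‖W l y‖ < ‖(1 : 𝔸)‖ + 1 :=
    hWy.norm.eventually (gt_mem_nhds (lt_add_one _))
  set K : ℝ := ‖(1 : 𝔸)‖ + 1 with hK
  have hsup : ∀ᶠ l : ℂ in 𝓝[≠] 0, ∀ z ∈ Metric.closedBall x r, ‖W l z‖ ≤ 2 * K := by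
    filter_upwards [hsmall, hWyb] with l hl hly
    have hcont : ContinuousOn (fun z => ‖W l z‖) (Metric.closedBall x r) := fun z hz =>
      (hW l z hz).continuousAt.norm.continuousWithinAt
    obtain ⟨z₀, hz₀, hmax⟩ := (isCompact_closedBall x r).exists_isMaxOn
      ⟨y, hy⟩ hcont
    have h1 := hbound l ‖W l z₀‖ (fun z hz => hmax hz) z₀ hz₀
    have h2 : ‖W l z₀‖ ≤ ‖W l z₀ - W l y‖ + ‖W l y‖ := by
      simpa using norm_add_le (W l z₀ - W l y) (W l y)
    have h3 : ‖l‖ * (‖W l z₀‖ * M) * (2 * r) = (‖l‖ * M * (2 * r)) * ‖W l z₀‖ := by ring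
    have h4 : (‖l‖ * M * (2 * r)) * ‖W l z₀‖ ≤ 1 / 2 * ‖W l z₀‖ :=
      mul_le_mul_of_nonneg_right hl.le (norm_nonneg _)
    intro z hz
    have h5 : ‖W l z‖ ≤ ‖W l z₀‖ := hmax hz
    linarith
  rw [Metric.tendstoUniformlyOn_iff]
  intro ε hε
  have hfin : ∀ᶠ l : ℂ in 𝓝[≠] 0, ‖W l y - 1‖ + ‖l‖ * (2 * K * M) * (2 * r) < ε := by
    have h1 : Tendsto (fun l : ℂ => ‖W l y - 1‖ + ‖l‖ * (2 * K * M) * (2 * r)) (𝓝[≠] 0)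
        (𝓝 (‖(1 : 𝔸) - 1‖ + 0 * (2 * K * M) * (2 * r))) :=
      ((hWy.sub_const 1).norm).add ((hl0.mul_const _).mul_const _)
    rw [sub_self, norm_zero, zero_mul, zero_mul, zero_add] at h1
    exact h1.eventually (gt_mem_nhds hε)
  filter_upwards [hsup, hfin] with l h1 h2 z hz
  rw [dist_comm, dist_eq_norm]
  have h3 := hbound l (2 * K) h1 z hz
  have h4 : ‖W l z - 1‖ ≤ ‖W l z - W l y‖ + ‖W l y - 1‖ := by
    simpa using norm_add_le (W l z - W l y) (W l y - 1)
  linarith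

/-- Solutions of `dW_l = l W_l B` with `W_0 = 1` and `W_l(x₀) = 1` are differentiable in `l` at
`l = 0`, and the derivative is a primitive of `B`: the difference quotients `(W_l - 1) / l` have
derivative `W_l B`, which converges locally uniformly to `B`. -/
theorem exists_hasDerivAt_parameter [CompleteSpace 𝔸] {Ω : Set V} (hΩ : IsOpen Ω)
    (hc : IsPreconnected Ω) {x₀ : V} (hx₀ : x₀ ∈ Ω) {B : V → V →L[ℝ] 𝔸} (hB : ContinuousOn B Ω)
    {W : ℂ → V → 𝔸}
    (hW : ∀ l, ∀ x ∈ Ω, HasFDerivAt (W l)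
      (l • (ContinuousLinearMap.mul ℝ 𝔸 (W l x)).comp (B x)) x)
    (h0 : ∀ x ∈ Ω, W 0 x = 1) (h1 : ∀ l, W l x₀ = 1) :
    ∃ Y : V → 𝔸, ∀ x ∈ Ω, HasDerivAt (fun l => W l x) (Y x) 0 ∧ HasFDerivAt Y (B x) x := by
  -- `R` are the difference quotients, `R'` their differentials in `x`
  let R : ℂ → V → 𝔸 := fun l x => l⁻¹ • (W l x - 1)
  let R' : ℂ → V → V →L[ℝ] 𝔸 := fun l x =>
    l⁻¹ • l • (ContinuousLinearMap.mul ℝ 𝔸 (W l x)).comp (B x)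
  let Conv : V → Prop := fun x => ∃ y, HasDerivAt (fun l => W l x) y 0
  have hR : ∀ l, ∀ x ∈ Ω, HasFDerivAt (R l) (R' l x) x := fun l x hx =>
    ((hW l x hx).sub_const 1).const_smul l⁻¹
  have hslope : ∀ x ∈ Ω, ∀ y, HasDerivAt (fun l => W l x) y 0 ↔
      Tendsto (fun l => R l x) (𝓝[≠] 0) (𝓝 y) := by
    intro x hx y
    rw [hasDerivAt_iff_tendsto_slope]
    refine tendsto_congr fun l => ?_
    simp [R, slope_def_module, h0 x hx]
  have hloc : ∀ x ∈ Ω, ∃ r > 0, Metric.ball x r ⊆ Ω ∧ ∀ y ∈ Metric.ball x r, Conv y →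
      TendstoUniformlyOn R' B (𝓝[≠] 0) (Metric.ball x r) ∧ ∀ z ∈ Metric.ball x r, Conv z := by
    intro x hx
    have hBx : ∀ᶠ z in 𝓝 x, ‖B z‖ < ‖B x‖ + 1 :=
      ((hB.continuousAt (hΩ.mem_nhds hx)).norm).eventually (gt_mem_nhds (lt_add_one _))
    obtain ⟨r, hr, hsub⟩ := Metric.nhds_basis_closedBall.mem_iff.1
      (Filter.inter_mem (hΩ.mem_nhds hx) hBx)
    have hsubΩ : Metric.ball x r ⊆ Ω := fun z hz => (hsub (Metric.ball_subset_closedBall hz)).1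
    refine ⟨r, hr, hsubΩ, fun y hy hCy => ?_⟩
    have hWy : Tendsto (fun l => W l y) (𝓝[≠] 0) (𝓝 1) := by
      obtain ⟨d, hd⟩ := hCy
      have := hd.continuousAt.tendsto
      rw [h0 y (hsubΩ hy)] at this
      exact this.mono_left nhdsWithin_le_nhds
    have hunif := tendstoUniformlyOn_one_of_small
      (fun l z hz => hW l z (hsub hz).1) (fun z hz => (hsub hz).2.le)
      (Metric.ball_subset_closedBall hy) hWy
    have hR' : TendstoUniformlyOn R' B (𝓝[≠] 0) (Metric.ball x r) := by
      rw [Metric.tendstoUniformlyOn_iff] at hunif ⊢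
      intro ε hε
      have hpos : 0 < ‖B x‖ + 1 := by positivity
      filter_upwards [hunif (ε / (‖B x‖ + 1)) (div_pos hε hpos), self_mem_nhdsWithin]
        with l hl hl0 z hz
      have hz' := Metric.ball_subset_closedBall hz
      have e1 : B z - R' l z = (ContinuousLinearMap.mul ℝ 𝔸 (1 - W l z)).comp (B z) := by
        simp only [R', smul_smul, inv_mul_cancel₀ (show l ≠ 0 from hl0), one_smul]
        ext v
        simp
      rw [dist_eq_norm, e1]
      have h2 := hl z hz'
      rw [dist_eq_norm, lt_div_iff₀ hpos] at h2
      refine lt_of_le_of_lt ?_ h2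
      refine (ContinuousLinearMap.opNorm_comp_le _ _).trans ?_
      exact mul_le_mul (ContinuousLinearMap.opNorm_mul_apply_le ℝ 𝔸 _)
        (hsub hz').2.le (norm_nonneg _) (norm_nonneg _)
    refine ⟨hR', fun z hz => ?_⟩
    obtain ⟨d, hd⟩ := hCy
    have hcauchy := cauchy_map_of_uniformCauchySeqOn_fderiv Metric.isOpen_ball
      (convex_ball x r).isPreconnected hR'.uniformCauchySeqOn (fun l z hz => hR l z (hsubΩ hz))
      hy hz (((hslope y (hsubΩ hy) d).1 hd).cauchy_map)
    obtain ⟨d', hd'⟩ := CompleteSpace.complete hcauchy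
    exact ⟨d', (hslope z (hsubΩ hz) d').2 hd'⟩
  have hall : ∀ x ∈ Ω, Conv x := by
    have hsub : Ω ⊆ {x | x ∈ Ω ∧ Conv x} := by
      refine hc.subset_of_closure_inter_subset ?_ ⟨x₀, hx₀, hx₀, 0, ?_⟩ ?_
      · rw [isOpen_iff_mem_nhds]
        rintro x ⟨hx, hCx⟩
        obtain ⟨r, hr, hrΩ, h⟩ := hloc x hx
        filter_upwards [Metric.ball_mem_nhds x hr] with z hz
        exact ⟨hrΩ hz, (h x (Metric.mem_ball_self hr) hCx).2 z hz⟩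
      · simp only [h1]
        exact hasDerivAt_const _ _
      · rintro x ⟨hxc, hx⟩
        obtain ⟨r, hr, hrΩ, h⟩ := hloc x hx
        obtain ⟨y, hy, hyb⟩ := Metric.mem_closure_iff.1 hxc r hr
        rw [dist_comm] at hyb
        exact ⟨hx, (h y hyb hy.2).2 x (Metric.mem_ball_self hr)⟩
    exact fun x hx => (hsub hx).2
  refine ⟨fun x => deriv (fun l => W l x) 0, fun x hx => ?_⟩
  have hY : ∀ z ∈ Ω, HasDerivAt (fun l => W l z) (deriv (fun l => W l z) 0) 0 := fun z hz => by
    obtain ⟨d, hd⟩ := hall z hz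
    exact hd.differentiableAt.hasDerivAt
  refine ⟨hY x hx, ?_⟩
  obtain ⟨r, hr, hrΩ, h⟩ := hloc x hx
  exact hasFDerivAt_of_tendstoUniformlyOn Metric.isOpen_ball
    (h x (Metric.mem_ball_self hr) (hall x hx)).1 (fun l z hz => hR l z (hrΩ hz))
    (fun z hz => (hslope z (hrΩ hz) _).1 (hY z (hrΩ hz))) (Metric.mem_ball_self hr)

end Parameter

/-! ### Partial derivatives -/

/-- `g` is differentiable at `x`, with `i`-th partial derivative `d`. -/
structure HasPd {n : ℕ} {W : Type*} [NormedAddCommGroup W] [NormedSpace ℝ W]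
    (i : Fin n) (g : Pt n → W) (d : W) (x : Pt n) : Prop where
  diff : DifferentiableAt ℝ g x
  eq : pd i g x = d

namespace HasPd

variable {n : ℕ} {W : Type*} [NormedAddCommGroup W] [NormedSpace ℝ W] {i : Fin n} {x : Pt n}

theorem of_hasFDerivAt {g : Pt n → W} {g' : Pt n →L[ℝ] W} (h : HasFDerivAt g g' x) :
    HasPd i g (g' (EuclideanSpace.single i 1)) x :=
  ⟨h.differentiableAt, by rw [pd, h.fderiv]⟩

theorem congr_deriv {g : Pt n → W} {d d' : W} (h : HasPd i g d x) (e : d = d') :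
    HasPd i g d' x := e ▸ h

theorem congr_of_eventuallyEq {g g₁ : Pt n → W} {d : W} (h : HasPd i g d x)
    (e : g₁ =ᶠ[𝓝 x] g) : HasPd i g₁ d x :=
  ⟨h.diff.congr_of_eventuallyEq e, by rw [pd, e.fderiv_eq]; exact h.eq⟩

theorem const (w : W) : HasPd i (fun _ => w) 0 x :=
  ⟨differentiableAt_const _, by simp [pd]⟩

theorem add {f g : Pt n → W} {a b : W} (hf : HasPd i f a x) (hg : HasPd i g b x) :
    HasPd i (fun y => f y + g y) (a + b) x :=
  ⟨hf.diff.add hg.diff, by rw [pd, fderiv_fun_add hf.diff hg.diff, ← hf.eq, ← hg.eq]; rfl⟩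

theorem sub {f g : Pt n → W} {a b : W} (hf : HasPd i f a x) (hg : HasPd i g b x) :
    HasPd i (fun y => f y - g y) (a - b) x :=
  ⟨hf.diff.sub hg.diff, by rw [pd, fderiv_fun_sub hf.diff hg.diff, ← hf.eq, ← hg.eq]; rfl⟩

theorem sum {ι : Type*} {s : Finset ι} {f : ι → Pt n → W} {a : ι → W}
    (h : ∀ j ∈ s, HasPd i (f j) (a j) x) :
    HasPd i (fun y => ∑ j ∈ s, f j y) (∑ j ∈ s, a j) x :=
  ⟨DifferentiableAt.fun_sum fun j hj => (h j hj).diff, by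
    rw [pd, fderiv_fun_sum fun j hj => (h j hj).diff, sum_apply]
    exact Finset.sum_congr rfl fun j hj => (h j hj).eq⟩

theorem smul {f : Pt n → ℝ} {g : Pt n → W} {a : ℝ} {b : W} (hf : HasPd i f a x)
    (hg : HasPd i g b x) : HasPd i (fun y => f y • g y) (a • g x + f x • b) x :=
  ⟨hf.diff.smul hg.diff, by
    rw [pd, fderiv_fun_smul hf.diff hg.diff, ← hf.eq, ← hg.eq]
    simp [pd, add_comm]⟩

theorem mul {𝔸 : Type*} [NormedRing 𝔸] [NormedAlgebra ℝ 𝔸] {f g : Pt n → 𝔸} {a b : 𝔸}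
    (hf : HasPd i f a x) (hg : HasPd i g b x) :
    HasPd i (fun y => f y * g y) (a * g x + f x * b) x :=
  ⟨hf.diff.mul hg.diff, by
    rw [pd, fderiv_fun_mul' hf.diff hg.diff, ← hf.eq, ← hg.eq]
    simp [pd, add_comm]⟩

theorem inv {f : Pt n → ℝ} {a : ℝ} (hf : HasPd i f a x) (h : f x ≠ 0) :
    HasPd i (fun y => (f y)⁻¹) (-a / f x ^ 2) x := by
  have := of_hasFDerivAt (i := i) ((hasDerivAt_inv h).comp_hasFDerivAt x hf.diff.hasFDerivAt)
  refine this.congr_deriv ?_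
  rw [← hf.eq]
  simp [pd]
  ring

theorem clm {W' : Type*} [NormedAddCommGroup W'] [NormedSpace ℝ W'] (A : W →L[ℝ] W')
    {f : Pt n → W} {a : W} (hf : HasPd i f a x) : HasPd i (fun y => A (f y)) (A a) x :=
  (of_hasFDerivAt (A.hasFDerivAt.comp x hf.diff.hasFDerivAt)).congr_deriv (by
    rw [← hf.eq]; rfl)

end HasPd

theorem fderiv_eq_sum_pd {n : ℕ} {W : Type*} [NormedAddCommGroup W] [NormedSpace ℝ W]
    (g : Pt n → W) (x w : Pt n) : fderiv ℝ g x w = ∑ i, w i • pd i g x := by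
  have hw : w = ∑ i, w i • EuclideanSpace.single i (1 : ℝ) := by
    simpa using ((EuclideanSpace.basisFun (Fin n) ℝ).sum_repr w).symm
  conv_lhs => rw [hw]
  simp [pd]

/-- A differentiable map with smooth partial derivatives on an open set is smooth there. -/
theorem contDiffOn_of_pd {n : ℕ} {W : Type*} [NormedAddCommGroup W] [NormedSpace ℝ W]
    {U : Set (Pt n)} (hU : IsOpen U) {g : Pt n → W} {d : Fin n → Pt n → W}
    (hdiff : DifferentiableOn ℝ g U) (hg : ∀ x ∈ U, ∀ i, pd i g x = d i x)
    (hd : ∀ i, ContDiffOn ℝ ∞ (d i) U) : ContDiffOn ℝ ∞ g U := by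
  rw [contDiffOn_infty_iff_fderiv_of_isOpen hU]
  refine ⟨hdiff, ?_⟩
  have h : ContDiffOn ℝ ∞ (fun x => ∑ i, (EuclideanSpace.proj (𝕜 := ℝ) i).smulRight (d i x)) U := by
    refine ContDiffOn.sum fun i _ => ?_
    exact contDiffOn_const.smulRight (hd i)
  refine h.congr fun x hx => ?_
  ext w
  rw [fderiv_eq_sum_pd]
  simp [hg x hx _]

end

section

/-! ### Hypersurfaces with an adapted orthonormal frame -/

/-- An orthonormal frame `e` of `ℝⁿ⁺¹` along `f` with `∂ᵢ f = -uᵢ eᵢ` and `∂ᵢ e_{n+1}` parallel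
to `eᵢ`, where `u` is isotropic for `( , )_k`. The map `f` need not be immersive. -/
structure AdaptedFrame (n k : ℕ) (f : Pt n → Pt (n + 1)) (e : Fin (n + 1) → Pt n → Pt (n + 1))
    (u : Pt n → Fin n → ℝ) (O : Set (Pt n)) : Prop where
  isOpen : IsOpen O
  diff_f : DifferentiableOn ℝ f O
  smooth_e : ∀ j, ContDiffOn ℝ ∞ (e j) O
  smooth_u : ∀ i, ContDiffOn ℝ ∞ (fun x => u x i) O
  orthonormal : ∀ x ∈ O, Orthonormal ℝ fun j => e j x
  pd_f : ∀ x ∈ O, ∀ i, pd i f x = -(u x i • e i.castSucc x)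
  pd_last : ∀ x ∈ O, ∀ i, ∃ m : ℝ, pd i (e (Fin.last n)) x = m • e i.castSucc x
  isotropic : ∀ x ∈ O, ∑ i, eps n k i * u x i ^ 2 = 0

namespace AdaptedFrame

variable {n k : ℕ} {f : Pt n → Pt (n + 1)} {e : Fin (n + 1) → Pt n → Pt (n + 1)}
  {u : Pt n → Fin n → ℝ} {O : Set (Pt n)}

theorem smooth_f (h : AdaptedFrame n k f e u O) : ContDiffOn ℝ ∞ f O :=
  contDiffOn_of_pd h.isOpen h.diff_f h.pd_f fun i =>
    ((h.smooth_u i).smul (h.smooth_e i.castSucc)).neg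

theorem mono (h : AdaptedFrame n k f e u O) {V : Set (Pt n)} (hV : IsOpen V) (hVO : V ⊆ O) :
    AdaptedFrame n k f e u V where
  isOpen := hV
  diff_f := h.diff_f.mono hVO
  smooth_e j := (h.smooth_e j).mono hVO
  smooth_u i := (h.smooth_u i).mono hVO
  orthonormal x hx := h.orthonormal x (hVO hx)
  pd_f x hx := h.pd_f x (hVO hx)
  pd_last x hx := h.pd_last x (hVO hx)
  isotropic x hx := h.isotropic x (hVO hx)

theorem fderiv_apply (h : AdaptedFrame n k f e u O) {x : Pt n} (hx : x ∈ O) (w : Pt n) :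
    fderiv ℝ f x w = ∑ i, -(w i * u x i) • e i.castSucc x := by
  rw [fderiv_eq_sum_pd]
  refine Finset.sum_congr rfl fun i _ => ?_
  rw [h.pd_f x hx, smul_neg, smul_smul, neg_smul]

theorem fderiv_single (h : AdaptedFrame n k f e u O) {x : Pt n} (hx : x ∈ O) (i : Fin n) (s : ℝ) :
    fderiv ℝ f x (s • EuclideanSpace.single i 1) = -(s * u x i) • e i.castSucc x := by
  have := h.pd_f x hx i
  rw [pd] at this
  rw [map_smul, this, smul_neg, smul_smul, neg_smul]

theorem injective_fderiv_iff (h : AdaptedFrame n k f e u O) {x : Pt n} (hx : x ∈ O) :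
    Function.Injective (fderiv ℝ f x) ↔ ∀ i, u x i ≠ 0 := by
  constructor
  · intro hinj i hi
    have h1 := h.pd_f x hx i
    rw [hi, zero_smul, neg_zero, pd] at h1
    have h2 := (injective_iff_map_eq_zero _).1 hinj _ h1
    simp at h2
  · intro hu
    rw [injective_iff_map_eq_zero]
    intro w hw
    rw [h.fderiv_apply hx] at hw
    have hli := ((h.orthonormal x hx).linearIndependent.comp Fin.castSucc
      (Fin.castSucc_injective n))
    ext i
    have := Fintype.linearIndependent_iff.1 hli _ hw i
    simpa [hu i] using this

theorem inner_last (h : AdaptedFrame n k f e u O) {x : Pt n} (hx : x ∈ O) (w : Pt n) :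
    inner ℝ (fderiv ℝ f x w) (e (Fin.last n) x) = 0 := by
  rw [h.fderiv_apply hx, sum_inner]
  refine Finset.sum_eq_zero fun i _ => ?_
  rw [real_inner_smul_left, (h.orthonormal x hx).inner_eq_zero (Fin.castSucc_lt_last i).ne,
    mul_zero]

theorem isUnitNormal (h : AdaptedFrame n k f e u O) : IsUnitNormal f (e (Fin.last n)) O where
  smooth := h.smooth_e _
  unit x hx := (h.orthonormal x hx).norm_eq_one _
  normal _ hx := h.inner_last hx

theorem isPrincipalDirection (h : AdaptedFrame n k f e u O) {x : Pt n} (hx : x ∈ O) {i : Fin n}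
    (hu : u x i ≠ 0) : IsPrincipalDirection f (e (Fin.last n)) x (e i.castSucc x) := by
  obtain ⟨m, hm⟩ := h.pd_last x hx i
  refine ⟨(h.orthonormal x hx).norm_eq_one _, (-(u x i)⁻¹) • EuclideanSpace.single i 1,
    (u x i)⁻¹ * m, ?_, ?_⟩
  · rw [h.fderiv_single hx]
    simp [hu]
  · rw [pd] at hm
    rw [map_smul, hm, smul_smul, neg_mul, neg_smul]

theorem norm_pd_sq (h : AdaptedFrame n k f e u O) {x : Pt n} (hx : x ∈ O) (i : Fin n) :
    ‖pd i f x‖ ^ 2 = u x i ^ 2 := by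
  rw [h.pd_f x hx, norm_neg, norm_smul, (h.orthonormal x hx).norm_eq_one, mul_one, Real.norm_eq_abs,
    sq_abs]

theorem isOpen_ne_zero (h : AdaptedFrame n k f e u O) : IsOpen {x | x ∈ O ∧ ∀ i, u x i ≠ 0} := by
  have : {x | x ∈ O ∧ ∀ i, u x i ≠ 0} = O ∩ (fun x => u x) ⁻¹' {v | ∀ i, v i ≠ 0} := rfl
  rw [this]
  refine ContinuousOn.isOpen_inter_preimage
    (continuousOn_pi.2 fun i => (h.smooth_u i).continuousOn) h.isOpen ?_
  simp only [Set.ofPred_forall]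
  exact isOpen_iInter_of_finite fun i => isOpen_ne_fun (continuous_apply i) continuous_const

theorem isIsothermic (h : AdaptedFrame n k f e u O) :
    IsIsothermic n k f {x | x ∈ O ∧ ∀ i, u x i ≠ 0} where
  isOpen := h.isOpen_ne_zero
  smooth := h.smooth_f.mono fun _ hx => hx.1
  immersion x hx := (h.injective_fderiv_iff hx.1).2 hx.2
  orthogonal x hx i j hij := by
    rw [h.pd_f x hx.1, h.pd_f x hx.1, inner_neg_neg, real_inner_smul_left, real_inner_smul_right,
      (h.orthonormal x hx.1).inner_eq_zero ((Fin.castSucc_injective n).ne hij)]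
    simp
  curvatureLines := by
    refine ⟨e (Fin.last n), (h.mono h.isOpen_ne_zero fun _ hx => hx.1).isUnitNormal,
      fun x hx i => ?_⟩
    obtain ⟨m, hm⟩ := h.pd_last x hx.1 i
    refine ⟨m / u x i, ?_⟩
    rw [hm, h.pd_f x hx.1, smul_neg, neg_neg, smul_smul, div_mul_cancel₀ _ (hx.2 i)]
  guichard x hx := by
    simp only [h.norm_pd_sq hx.1]
    have h1 := h.isotropic x hx.1
    rw [← Finset.sum_filter_add_sum_filter_not _ (fun i : Fin n => (i : ℕ) < n - k)] at h1
    have h2 : ∑ i ∈ Finset.univ.filter (fun i : Fin n => (i : ℕ) < n - k), eps n k i * u x i ^ 2 =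
        ∑ i ∈ Finset.univ.filter (fun i : Fin n => (i : ℕ) < n - k), u x i ^ 2 :=
      Finset.sum_congr rfl fun i hi => by simp [eps, (Finset.mem_filter.1 hi).2]
    have h3 : ∑ i ∈ Finset.univ.filter (fun i : Fin n => ¬ (i : ℕ) < n - k), eps n k i * u x i ^ 2 =
        -∑ i ∈ Finset.univ.filter (fun i : Fin n => n - k ≤ (i : ℕ)), u x i ^ 2 := by
      rw [← Finset.sum_neg_distrib]
      refine Finset.sum_congr (by simp) fun i hi => ?_
      simp [eps, (Finset.mem_filter.1 hi).2]
    linarith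

/-- Two hypersurfaces with adapted frames are Ribaucour transforms of each other where all
corresponding frame lines, including the normals, meet at equal distance; the point where the
normals meet is the centre of the common tangent sphere. -/
theorem isRibaucour {f' : Pt n → Pt (n + 1)} {e' : Fin (n + 1) → Pt n → Pt (n + 1)}
    {u' : Pt n → Fin n → ℝ} {V : Set (Pt n)} (h : AdaptedFrame n k f e u V)
    (h' : AdaptedFrame n k f' e' u' V) (hu : ∀ x ∈ V, ∀ i, u x i ≠ 0)
    (hu' : ∀ x ∈ V, ∀ i, u' x i ≠ 0) (r : Fin (n + 1) → Pt n → ℝ)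
    (hr : ∀ x ∈ V, r (Fin.last n) x ≠ 0)
    (hmeet : ∀ x ∈ V, ∀ j, f' x + r j x • e' j x = f x + r j x • e j x) :
    IsRibaucour f f' V := by
  refine ⟨h.isOpen, h.smooth_f, h'.smooth_f, fun x hx =>
    ⟨(h.injective_fderiv_iff hx).2 (hu x hx), (h'.injective_fderiv_iff hx).2 (hu' x hx)⟩, ?_,
    e (Fin.last n), e' (Fin.last n), fun i => e i.castSucc, fun i => e' i.castSucc,
    fun i => r i.castSucc, h.isUnitNormal, h'.isUnitNormal,
    fun i => ⟨h.smooth_e _, h'.smooth_e _⟩, ?_⟩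
  · intro x hx
    have e1 : f x - (f x + r (Fin.last n) x • e (Fin.last n) x) =
      -(r (Fin.last n) x • e (Fin.last n) x) := by abel
    have e2 : f' x - (f x + r (Fin.last n) x • e (Fin.last n) x) =
      -(r (Fin.last n) x • e' (Fin.last n) x) := by rw [← hmeet x hx]; abel
    refine ⟨f x + r (Fin.last n) x • e (Fin.last n) x, |r (Fin.last n) x|, abs_pos.2 (hr x hx),
      ?_, ?_, fun w => ⟨?_, ?_⟩⟩
    · rw [mem_sphere_iff_norm, e1, norm_neg, norm_smul, (h.orthonormal x hx).norm_eq_one, mul_one,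
        Real.norm_eq_abs]
    · rw [mem_sphere_iff_norm, e2, norm_neg, norm_smul, (h'.orthonormal x hx).norm_eq_one, mul_one,
        Real.norm_eq_abs]
    · rw [e1, inner_neg_right, real_inner_smul_right, h.inner_last hx, mul_zero, neg_zero]
    · rw [e2, inner_neg_right, real_inner_smul_right, h'.inner_last hx, mul_zero, neg_zero]
  · intro x hx
    refine ⟨(h.orthonormal x hx).comp _ (Fin.castSucc_injective n),
      (h'.orthonormal x hx).comp _ (Fin.castSucc_injective n), fun i =>
      ⟨h.isPrincipalDirection hx (hu x hx i), h'.isPrincipalDirection hx (hu' x hx i), ?_,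
        hmeet x hx _⟩⟩
    refine ⟨(-(u x i)⁻¹) • EuclideanSpace.single i 1, (u x i)⁻¹ * u' x i, ?_, ?_⟩
    · rw [h.fderiv_single hx]
      simp [hu x hx i]
    · rw [h'.fderiv_single hx]
      simp

end AdaptedFrame

end

section

/-! ### Real blocks of loops in the twisted orthogonal group -/

section Complexification

variable {l m o : Type*}

theorem cx_mul [Fintype m] (A : Matrix l m ℝ) (B : Matrix m o ℝ) : cx (A * B) = cx A * cx B :=
  Matrix.map_mul (f := algebraMap ℝ ℂ)

theorem cx_zero : cx (0 : Matrix l m ℝ) = 0 := by ext; simp [cx]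

theorem cx_one [DecidableEq m] : cx (1 : Matrix m m ℝ) = 1 :=
  Matrix.map_one (algebraMap ℝ ℂ) (map_zero _) (map_one _)

theorem cx_neg (A : Matrix l m ℝ) : cx (-A) = -cx A := by ext; simp [cx]

theorem cx_sub (A B : Matrix l m ℝ) : cx (A - B) = cx A - cx B := by ext; simp [cx]

theorem cx_transpose (A : Matrix l m ℝ) : cx Aᵀ = (cx A)ᵀ := rfl

theorem cx_injective : Function.Injective (cx : Matrix l m ℝ → Matrix l m ℂ) := fun A B h => by
  ext i j
  exact Complex.ofReal_injective (congrFun (congrFun h i) j)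

theorem cx_fromBlocks {p : Type*} (A : Matrix l m ℝ) (B : Matrix l p ℝ) (C : Matrix o m ℝ)
    (D : Matrix o p ℝ) :
    cx (Matrix.fromBlocks A B C D) = Matrix.fromBlocks (cx A) (cx B) (cx C) (cx D) :=
  Matrix.fromBlocks_map A B C D _

theorem map_re_cx (A : Matrix l m ℝ) : (cx A).map Complex.re = A := by ext; simp [cx]

theorem cx_map_re {M : Matrix l m ℂ} (h : M.map star = M) : cx (M.map Complex.re) = M := by
  ext i j
  exact Complex.conj_eq_iff_re.1 (congrFun (congrFun h i) j)

end Complexification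

variable {n k : ℕ}

theorem eps_mul_self (i : Fin n) : eps n k i * eps n k i = 1 := by
  unfold eps; split_ifs <;> norm_num

theorem J_mul_J : J n k * J n k = 1 := by
  rw [J, Matrix.diagonal_mul_diagonal]
  simp [eps_mul_self]

theorem J_transpose : (J n k)ᵀ = J n k := Matrix.diagonal_transpose _

theorem J_mulVec (v : Fin n → ℝ) (i : Fin n) : (J n k *ᵥ v) i = eps n k i * v i :=
  Matrix.mulVec_diagonal _ _ _

theorem cx_J_mul : cx (J n k) * cx (J n k) = 1 := by rw [← cx_mul, J_mul_J, cx_one]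

theorem cx_gram_eq : cx (gram n k) = Matrix.fromBlocks 1 0 0 (cx (J n k)) := by
  rw [gram, cx_fromBlocks, cx_one, cx_zero, cx_zero]

theorem cx_gram_mul : cx (gram n k) * cx (gram n k) = 1 := by
  simp [cx_gram_eq, Matrix.fromBlocks_multiply, cx_J_mul]

theorem cx_gram_transpose : (cx (gram n k))ᵀ = cx (gram n k) := by
  rw [← cx_transpose, gram, Matrix.fromBlocks_transpose, J_transpose]
  simp

theorem cx_rho_eq : cx (rho n) = Matrix.fromBlocks 1 0 0 (-1) := by
  rw [rho, cx_fromBlocks, cx_one, cx_zero, cx_zero, cx_neg, cx_one]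

theorem cx_rho_mul : cx (rho n) * cx (rho n) = 1 := by
  simp [cx_rho_eq, Matrix.fromBlocks_multiply]

theorem cx_rho_inv : (cx (rho n))⁻¹ = cx (rho n) := Matrix.inv_eq_right_inv cx_rho_mul

theorem rho_conj_fromBlocks (A : Matrix (Fin (n + 1)) (Fin (n + 1)) ℂ)
    (B : Matrix (Fin (n + 1)) (Fin n) ℂ) (C : Matrix (Fin n) (Fin (n + 1)) ℂ)
    (D : Matrix (Fin n) (Fin n) ℂ) :
    cx (rho n) * Matrix.fromBlocks A B C D * (cx (rho n))⁻¹ = Matrix.fromBlocks A (-B) (-C) D := by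
  rw [cx_rho_inv, cx_rho_eq]
  simp [Matrix.fromBlocks_multiply]

/-- Conjugation by `ρ` entry by entry. -/
theorem rho_conj_apply (M : Matrix (Idx n) (Idx n) ℂ) :
    (∀ i j, (cx (rho n) * M * (cx (rho n))⁻¹) (Sum.inl i) (Sum.inl j) = M (Sum.inl i) (Sum.inl j)) ∧
    (∀ i j, (cx (rho n) * M * (cx (rho n))⁻¹) (Sum.inl i) (Sum.inr j) =
      -M (Sum.inl i) (Sum.inr j)) ∧
    (∀ i j, (cx (rho n) * M * (cx (rho n))⁻¹) (Sum.inr i) (Sum.inl j) =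
      -M (Sum.inr i) (Sum.inl j)) ∧
    ∀ i j, (cx (rho n) * M * (cx (rho n))⁻¹) (Sum.inr i) (Sum.inr j) =
      M (Sum.inr i) (Sum.inr j) := by
  obtain ⟨A, B, C, D, rfl⟩ : ∃ A B C D, M = Matrix.fromBlocks A B C D :=
    ⟨_, _, _, _, (Matrix.fromBlocks_toBlocks M).symm⟩
  rw [rho_conj_fromBlocks]
  simp

theorem hasBlocks_of_eq {M : ℂ → Matrix (Idx n) (Idx n) ℂ}
    {g₁ : Matrix (Fin (n + 1)) (Fin (n + 1)) ℝ} {g₂ : Matrix (Fin n) (Fin n) ℝ}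
    (h : M 0 = Matrix.fromBlocks (cx g₁) 0 0 (cx g₂)) (h₁ : g₁ᵀ * g₁ = 1)
    (h₂ : g₂ᵀ * J n k * g₂ = J n k) :
    HasBlocks n k M ∧ topBlock M = g₁ ∧ botBlock M = g₂ := by
  have t : topBlock M = g₁ := by rw [topBlock, h, Matrix.toBlocks_fromBlocks₁₁, map_re_cx]
  have b : botBlock M = g₂ := by rw [botBlock, h, Matrix.toBlocks_fromBlocks₂₂, map_re_cx]
  refine ⟨⟨?_, ?_, ?_⟩, t, b⟩
  · rw [t, b, h]
  · rw [t, Matrix.mem_orthogonalGroup_iff', h₁]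
  · rw [b, h₂]

theorem hasPotential_of_eq {M : ℂ → Matrix (Idx n) (Idx n) ℂ} {Y : Matrix (Fin (n + 1)) (Fin n) ℝ}
    (hd : ∀ a b, DifferentiableAt ℂ (fun l => M l a b) 0)
    (h : logDeriv M = Matrix.fromBlocks 0 (cx Y) (-cx (J n k * Yᵀ)) 0) :
    HasPotential n k M ∧ potential M = Y := by
  have p : potential M = Y := by rw [potential, h, Matrix.toBlocks_fromBlocks₁₂, map_re_cx]
  exact ⟨⟨hd, by rw [p, h]⟩, p⟩

/-- A matrix that is real, commutes with `ρ` and preserves the form is block diagonal. -/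
theorem hasBlocks_of_symm {M : ℂ → Matrix (Idx n) (Idx n) ℂ} (hr : (M 0).map star = M 0)
    (ht : cx (rho n) * M 0 * (cx (rho n))⁻¹ = M 0)
    (hg : (M 0)ᵀ * cx (gram n k) * M 0 = cx (gram n k)) : HasBlocks n k M := by
  obtain ⟨A, B, C, D, hM⟩ : ∃ A B C D, M 0 = Matrix.fromBlocks A B C D :=
    ⟨_, _, _, _, (Matrix.fromBlocks_toBlocks _).symm⟩
  rw [hM] at hr ht hg
  rw [rho_conj_fromBlocks, Matrix.fromBlocks_inj] at ht
  rw [Matrix.fromBlocks_map, Matrix.fromBlocks_inj] at hr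
  have hB : B = 0 := by simpa [neg_eq_iff_add_eq_zero, ← two_smul ℂ] using ht.2.1
  have hC : C = 0 := by simpa [neg_eq_iff_add_eq_zero, ← two_smul ℂ] using ht.2.2.1
  subst hB hC
  rw [← cx_map_re hr.1, ← cx_map_re hr.2.2.2, cx_gram_eq, Matrix.fromBlocks_transpose,
    Matrix.fromBlocks_multiply, Matrix.fromBlocks_multiply, Matrix.fromBlocks_inj] at hg
  simp only [Matrix.transpose_zero, Matrix.mul_one, Matrix.mul_zero, Matrix.zero_mul, add_zero,
    zero_add, ← cx_transpose, ← cx_mul] at hg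
  refine (hasBlocks_of_eq (g₁ := A.map Complex.re) (g₂ := D.map Complex.re) ?_
    (cx_injective ?_) (cx_injective hg.2.2.2)).1
  · rw [hM, cx_map_re hr.1, cx_map_re hr.2.2.2]
  · rw [hg.1, cx_one]

theorem hasDerivAt_matrix_mul {ι : Type*} [Fintype ι] {A B : ℂ → Matrix ι ι ℂ}
    {A' B' : Matrix ι ι ℂ} {l : ℂ} (hA : ∀ a b, HasDerivAt (fun l => A l a b) (A' a b) l)
    (hB : ∀ a b, HasDerivAt (fun l => B l a b) (B' a b) l) (a b : ι) :
    HasDerivAt (fun l => (A l * B l) a b) ((A' * B l + A l * B') a b) l := by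
  simp only [Matrix.mul_apply, Matrix.add_apply, ← Finset.sum_add_distrib]
  exact HasDerivAt.fun_sum fun c _ => (hA a c).mul (hB c b)

/-- The derivative at `0` of a loop in the group, twisted by `ρ` and satisfying the reality
condition, lies in the `-1`-eigenspace of the involution and is real. -/
theorem hasPotential_of_symm {M : ℂ → Matrix (Idx n) (Idx n) ℂ}
    (hd : ∀ a b, DifferentiableAt ℂ (fun l => M l a b) 0)
    (hg : ∀ l, (M l)ᵀ * cx (gram n k) * M l = cx (gram n k))
    (hr : ∀ l, (M (star l)).map star = M l)
    (ht : ∀ l, cx (rho n) * M (-l) * (cx (rho n))⁻¹ = M l) : HasPotential n k M := by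
  set M' : Matrix (Idx n) (Idx n) ℂ := Matrix.of fun a b => deriv (fun l => M l a b) 0 with hM'
  have hM : ∀ a b, HasDerivAt (fun l => M l a b) (M' a b) 0 := fun a b => (hd a b).hasDerivAt
  have hreal : M'.map star = M' := by
    ext a b
    have h1 : HasDerivAt (star ∘ (fun l => M l a b) ∘ (starRingEnd ℂ)) (star (M' a b))
        (starRingEnd ℂ 0) := (hM a b).star_conj
    have h2 : (star ∘ (fun l => M l a b) ∘ (starRingEnd ℂ)) = fun l => M l a b := by
      funext l
      exact congrFun (congrFun (hr l) a) b
    rw [h2, map_zero] at h1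
    exact h1.unique (hM a b)
  have hneg : ∀ a b, HasDerivAt (fun l => M (-l) a b) (-M' a b) 0 := fun a b => by
    have h1 := (hM a b)
    rw [← neg_zero] at h1
    have h2 := h1.scomp (0 : ℂ) (hasDerivAt_neg 0)
    rw [neg_one_smul] at h2
    exact h2
  have hz : ∀ z : ℂ, -z = z → z = 0 := fun z hz => by
    linear_combination (-1 / 2 : ℂ) * hz
  have h11 : M'.toBlocks₁₁ = 0 := by
    ext i j
    have h1 : (fun l => M (-l) (Sum.inl i) (Sum.inl j)) = fun l => M l (Sum.inl i) (Sum.inl j) := by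
      funext l
      rw [← ht l, (rho_conj_apply _).1]
    have h2 := hneg (Sum.inl i) (Sum.inl j)
    rw [h1] at h2
    exact hz _ (h2.unique (hM _ _))
  have h22 : M'.toBlocks₂₂ = 0 := by
    ext i j
    have h1 : (fun l => M (-l) (Sum.inr i) (Sum.inr j)) = fun l => M l (Sum.inr i) (Sum.inr j) := by
      funext l
      rw [← ht l, (rho_conj_apply _).2.2.2]
    have h2 := hneg (Sum.inr i) (Sum.inr j)
    rw [h1] at h2
    exact hz _ (h2.unique (hM _ _))
  have hG : ∀ l, M l * (cx (gram n k) * (M l)ᵀ * cx (gram n k)) = 1 := fun l => by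
    refine mul_eq_one_comm.1 ?_
    rw [mul_assoc, mul_assoc, ← mul_assoc (M l)ᵀ, hg, cx_gram_mul]
  have hinv : (M 0)⁻¹ = cx (gram n k) * (M 0)ᵀ * cx (gram n k) := Matrix.inv_eq_right_inv (hG 0)
  have hX : logDeriv M = M' * (cx (gram n k) * (M 0)ᵀ * cx (gram n k)) := by
    rw [logDeriv, hinv]
  -- differentiate `M G Mᵀ = G`
  have hskew : M' * (cx (gram n k) * (M 0)ᵀ * cx (gram n k)) +
      M 0 * (cx (gram n k) * M'ᵀ * cx (gram n k)) = 0 := by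
    have hB : ∀ a b, HasDerivAt (fun l => (cx (gram n k) * (M l)ᵀ * cx (gram n k)) a b)
        ((cx (gram n k) * M'ᵀ * cx (gram n k)) a b) 0 := by
      have hT : ∀ a b, HasDerivAt (fun l => (M l)ᵀ a b) (M'ᵀ a b) 0 := fun a b => hM b a
      have hc : ∀ a b, HasDerivAt (fun _ : ℂ => cx (gram n k) a b)
          ((0 : Matrix (Idx n) (Idx n) ℂ) a b) 0 := fun a b => hasDerivAt_const _ _
      have := hasDerivAt_matrix_mul (hasDerivAt_matrix_mul hc hT) hc
      simpa using this
    ext a b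
    have h1 := hasDerivAt_matrix_mul hM hB a b
    simp only [hG] at h1
    exact h1.unique (hasDerivAt_const _ _)
  obtain ⟨A, D, hM0⟩ : ∃ (A : Matrix (Fin (n + 1)) (Fin (n + 1)) ℝ) (D : Matrix (Fin n) (Fin n) ℝ),
      M 0 = Matrix.fromBlocks (cx A) 0 0 (cx D) := by
    have := (hasBlocks_of_symm (k := k) (M := M) (by simpa using hr 0) (by simpa using ht 0)
      (hg 0)).1
    exact ⟨_, _, this⟩
  obtain ⟨P, Q, hM1⟩ : ∃ (P : Matrix (Fin (n + 1)) (Fin n) ℝ) (Q : Matrix (Fin n) (Fin (n + 1)) ℝ),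
      M' = Matrix.fromBlocks 0 (cx P) (cx Q) 0 := by
    refine ⟨M'.toBlocks₁₂.map Complex.re, M'.toBlocks₂₁.map Complex.re, ?_⟩
    rw [cx_map_re, cx_map_re]
    · conv_lhs => rw [← Matrix.fromBlocks_toBlocks M']
      rw [h11, h22]
    · ext i j; exact congrFun (congrFun hreal _) _
    · ext i j; exact congrFun (congrFun hreal _) _
  refine (hasPotential_of_eq (Y := P * (J n k * Dᵀ * J n k)) hd ?_).1
  rw [hX]
  rw [hM1, hM0, cx_gram_eq] at hskew ⊢
  simp only [Matrix.fromBlocks_transpose, Matrix.fromBlocks_multiply, Matrix.transpose_zero,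
    Matrix.mul_one, Matrix.one_mul, Matrix.mul_zero, Matrix.zero_mul, add_zero, zero_add,
    ← cx_transpose, ← cx_mul, Matrix.fromBlocks_add] at hskew ⊢
  rw [← Matrix.fromBlocks_zero, Matrix.fromBlocks_inj] at hskew
  have h21 : cx (Q * Aᵀ) = -cx (D * (J n k * Pᵀ)) := eq_neg_of_add_eq_zero_left hskew.2.2.1
  rw [h21]
  simp only [Matrix.transpose_mul, J_transpose, Matrix.transpose_transpose, Matrix.mul_assoc]
  rw [← Matrix.mul_assoc (J n k) (J n k), J_mul_J, Matrix.one_mul]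

end

section

/-! ### Simple elements -/

variable {n k : ℕ}

/-- A matrix is the projection onto `A` along `B` if it has values in `A`, fixes `A`, vanishes on
`B`, and its complement has values in `B`. -/
theorem projAlong_eq {A B : Submodule ℂ (Idx n → ℂ)} {P : Matrix (Idx n) (Idx n) ℂ}
    (hA : ∀ v, P *ᵥ v ∈ A) (hA' : ∀ v ∈ A, P *ᵥ v = v) (hB : ∀ v ∈ B, P *ᵥ v = 0)
    (hB' : ∀ v, v - P *ᵥ v ∈ B) : projAlong A B = P := by
  have hc : IsCompl A B := by
    constructor
    · rw [Submodule.disjoint_def]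
      intro v hv hv'
      rw [← hA' v hv, hB v hv']
    · rw [codisjoint_iff, Submodule.eq_top_iff']
      intro v
      exact Submodule.mem_sup.2 ⟨_, hA v, _, hB' v, by simp⟩
  rw [projAlong, dif_pos hc, ← LinearMap.toMatrix'_toLin' P]
  congr 1
  refine LinearMap.ext fun v => ?_
  have h1 : v = P *ᵥ v + (v - P *ᵥ v) := by simp
  rw [Matrix.toLin'_apply]
  conv_lhs => rw [h1]
  rw [map_add, Submodule.projection_apply_of_mem_left hc (hA v),
    (Submodule.projection_apply_eq_zero_iff hc).2 (hB' v), add_zero]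

theorem mem_perp_iff {L : Submodule ℂ (Idx n → ℂ)} {v : Idx n → ℂ} :
    v ∈ perp n k L ↔ ∀ w ∈ L, (cx (gram n k) *ᵥ w) ⬝ᵥ v = 0 := by
  rw [perp, LinearMap.BilinForm.mem_orthogonal_iff]
  refine forall₂_congr fun w _ => ?_
  rw [Matrix.toBilin'_apply', Matrix.dotProduct_mulVec, ← Matrix.mulVec_transpose,
    cx_gram_transpose]

theorem mem_perp_span_iff {w v : Idx n → ℂ} :
    v ∈ perp n k (Submodule.span ℂ {w}) ↔ (cx (gram n k) *ᵥ w) ⬝ᵥ v = 0 := by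
  rw [mem_perp_iff]
  refine ⟨fun h => h w (Submodule.mem_span_singleton_self w), fun h w' hw' => ?_⟩
  obtain ⟨s, rfl⟩ := Submodule.mem_span_singleton.1 hw'
  rw [Matrix.mulVec_smul, smul_dotProduct, h, smul_zero]

theorem reflect_span (w : Idx n → ℂ) :
    reflect (Submodule.span ℂ {w}) = Submodule.span ℂ {cx (rho n) *ᵥ w} := by
  rw [reflect, Submodule.map_span, Set.image_singleton, Matrix.toLin'_apply]

theorem rho_mulVec_elim (q : Fin (n + 1) → ℂ) (z : Fin n → ℂ) :
    cx (rho n) *ᵥ Sum.elim q z = Sum.elim q (-z) := by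
  rw [cx_rho_eq, Matrix.fromBlocks_mulVec]
  simp [Matrix.neg_mulVec]

theorem gram_mulVec_elim (q : Fin (n + 1) → ℂ) (z : Fin n → ℂ) :
    cx (gram n k) *ᵥ Sum.elim q z = Sum.elim q (cx (J n k) *ᵥ z) := by
  rw [cx_gram_eq, Matrix.fromBlocks_mulVec]
  simp

/-- The projection onto the span of `w` along the orthogonal complement of `w'`, for isotropic `w`,
`w'` with `(w, w') = 4`. -/
def rankOne (n k : ℕ) (w w' : Idx n → ℂ) : Matrix (Idx n) (Idx n) ℂ :=
  (4⁻¹ : ℂ) • Matrix.vecMulVec w (cx (gram n k) *ᵥ w')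

theorem rankOne_mulVec (w w' v : Idx n → ℂ) :
    rankOne n k w w' *ᵥ v = (4⁻¹ * ((cx (gram n k) *ᵥ w') ⬝ᵥ v)) • w := by
  rw [rankOne, Matrix.smul_mulVec, Matrix.vecMulVec_mulVec]
  rw [op_smul_eq_smul, smul_smul]

theorem rankOne_mul_rankOne (w₁ w₁' w₂ w₂' : Idx n → ℂ) :
    rankOne n k w₁ w₁' * rankOne n k w₂ w₂' =
      (4⁻¹ * ((cx (gram n k) *ᵥ w₁') ⬝ᵥ w₂)) • rankOne n k w₁ w₂' := by
  rw [rankOne, rankOne, rankOne, Matrix.smul_mul, Matrix.mul_smul, Matrix.vecMulVec_mul_vecMulVec,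
    Matrix.vecMulVec_smul]
  module

/-- The simple element in terms of a spanning vector `w` of the isotropic line and its reflection
`w'`, scaled such that `(w, w') = 4`. -/
theorem simpleElt_eq {w w' : Idx n → ℂ} (hw' : cx (rho n) *ᵥ w = w')
    (h1 : (cx (gram n k) *ᵥ w) ⬝ᵥ w = 0) (h2 : (cx (gram n k) *ᵥ w') ⬝ᵥ w' = 0)
    (h3 : (cx (gram n k) *ᵥ w) ⬝ᵥ w' = 4) (h4 : (cx (gram n k) *ᵥ w') ⬝ᵥ w = 4) (α l : ℂ) :
    simpleElt n k α (Submodule.span ℂ {w}) l =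
      1 + ((l - α) / (l + α) - 1) • rankOne n k w w'
        + (((l - α) / (l + α))⁻¹ - 1) • rankOne n k w' w := by
  have hrefl : reflect (Submodule.span ℂ {w}) = Submodule.span ℂ {w'} := by
    rw [reflect_span, hw']
  have key : ∀ {w w' : Idx n → ℂ}, (cx (gram n k) *ᵥ w') ⬝ᵥ w' = 0 →
      (cx (gram n k) *ᵥ w') ⬝ᵥ w = 4 →
      projAlong (Submodule.span ℂ {w}) (perp n k (Submodule.span ℂ {w'})) = rankOne n k w w' := by
    intro w w' h2 h4
    refine projAlong_eq (fun v => ?_) (fun v hv => ?_) (fun v hv => ?_) (fun v => ?_)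
    · rw [rankOne_mulVec]
      exact Submodule.smul_mem _ _ (Submodule.mem_span_singleton_self w)
    · obtain ⟨s, rfl⟩ := Submodule.mem_span_singleton.1 hv
      rw [rankOne_mulVec, dotProduct_smul, h4, smul_eq_mul]
      congr 1
      ring
    · rw [mem_perp_span_iff] at hv
      rw [rankOne_mulVec, hv, mul_zero, zero_smul]
    · rw [mem_perp_span_iff, rankOne_mulVec, dotProduct_sub, dotProduct_smul, h4, smul_eq_mul]
      ring
  have hmid : projAlong (perp n k (Submodule.span ℂ {w} ⊔ Submodule.span ℂ {w'}))
      (Submodule.span ℂ {w} ⊔ Submodule.span ℂ {w'}) =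
        1 - rankOne n k w w' - rankOne n k w' w := by
    have happ : ∀ v, (1 - rankOne n k w w' - rankOne n k w' w) *ᵥ v =
        v - (4⁻¹ * ((cx (gram n k) *ᵥ w') ⬝ᵥ v)) • w -
          (4⁻¹ * ((cx (gram n k) *ᵥ w) ⬝ᵥ v)) • w' := by
      intro v
      rw [Matrix.sub_mulVec, Matrix.sub_mulVec, Matrix.one_mulVec, rankOne_mulVec, rankOne_mulVec]
    have hmem : ∀ s t : ℂ, s • w + t • w' ∈ Submodule.span ℂ {w} ⊔ Submodule.span ℂ {w'} :=
      fun s t => Submodule.add_mem_sup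
        (Submodule.smul_mem _ _ (Submodule.mem_span_singleton_self _))
        (Submodule.smul_mem _ _ (Submodule.mem_span_singleton_self _))
    have hmemiff : ∀ v, v ∈ Submodule.span ℂ {w} ⊔ Submodule.span ℂ {w'} →
        ∃ s t : ℂ, v = s • w + t • w' := by
      intro v hv
      obtain ⟨a, ha, b, hb, rfl⟩ := Submodule.mem_sup.1 hv
      obtain ⟨s, rfl⟩ := Submodule.mem_span_singleton.1 ha
      obtain ⟨t, rfl⟩ := Submodule.mem_span_singleton.1 hb
      exact ⟨s, t, rfl⟩
    have hperp : ∀ v, v ∈ perp n k (Submodule.span ℂ {w} ⊔ Submodule.span ℂ {w'}) ↔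
        (cx (gram n k) *ᵥ w) ⬝ᵥ v = 0 ∧ (cx (gram n k) *ᵥ w') ⬝ᵥ v = 0 := by
      intro v
      rw [mem_perp_iff]
      refine ⟨fun h => ⟨h w (by simpa using hmem 1 0), h w' (by simpa using hmem 0 1)⟩,
        fun h u hu => ?_⟩
      obtain ⟨s, t, rfl⟩ := hmemiff u hu
      rw [Matrix.mulVec_add, Matrix.mulVec_smul, Matrix.mulVec_smul, add_dotProduct,
        smul_dotProduct, smul_dotProduct, h.1, h.2]
      simp
    refine projAlong_eq (fun v => ?_) (fun v hv => ?_) (fun v hv => ?_) (fun v => ?_)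
    · rw [hperp, happ]
      simp only [dotProduct_sub, dotProduct_smul, h1, h2, h3, h4, smul_eq_mul]
      constructor <;> ring
    · rw [hperp] at hv
      rw [happ, hv.1, hv.2]
      simp
    · obtain ⟨s, t, rfl⟩ := hmemiff v hv
      rw [happ]
      simp only [dotProduct_add, dotProduct_smul, h1, h2, h3, h4, smul_eq_mul]
      module
    · rw [happ, sub_sub, sub_sub_cancel]
      exact hmem _ _
  rw [simpleElt, hrefl, key h2 h4, key h1 h3, hmid, inv_div]
  module

/-- The inverse of a simple element replaces the factor by its inverse. -/
theorem inv_one_add_smul {P P' : Matrix (Idx n) (Idx n) ℂ} (h1 : P * P = P) (h2 : P' * P' = P')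
    (h3 : P * P' = 0) (h4 : P' * P = 0) {s : ℂ} (hs : s ≠ 0) :
    (1 + (s - 1) • P + (s⁻¹ - 1) • P')⁻¹ = 1 + (s⁻¹ - 1) • P + (s - 1) • P' := by
  refine Matrix.inv_eq_right_inv ?_
  have e1 : (s - 1) + (s⁻¹ - 1) + (s - 1) * (s⁻¹ - 1) = 0 := by field_simp; ring
  simp only [add_mul, mul_add, one_mul, mul_one, Matrix.smul_mul, Matrix.mul_smul, h1, h2, h3, h4,
    smul_zero, add_zero]
  linear_combination (norm := module) e1 • P + e1 • P'

end

section

/-! ### Dressing at one point -/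

variable {n k : ℕ}

theorem cx_J_mulVec (z : Fin n → ℂ) (j : Fin n) : (cx (J n k) *ᵥ z) j = eps n k j * z j := by
  have : cx (J n k) = Matrix.diagonal fun j => (eps n k j : ℂ) := by
    ext i j
    by_cases h : i = j <;> simp [cx, J, h]
  rw [this, Matrix.mulVec_diagonal]

/-- The vector `(Q, θ b)` with real `Q`, `b`; the scalar is `θ = 1` for real `α` and `θ = i` for
imaginary `α`. -/
def typedVec (θ : ℂ) (Q : Fin (n + 1) → ℝ) (b : Fin n → ℝ) : Idx n → ℂ :=
  Sum.elim (fun i => (Q i : ℂ)) fun j => θ * b j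

theorem rho_typedVec (θ : ℂ) (Q : Fin (n + 1) → ℝ) (b : Fin n → ℝ) :
    cx (rho n) *ᵥ typedVec θ Q b = typedVec (-θ) Q b := by
  rw [typedVec, rho_mulVec_elim, typedVec]
  congr 1
  funext j
  simp

theorem gram_typedVec (θ : ℂ) (Q : Fin (n + 1) → ℝ) (b : Fin n → ℝ) :
    cx (gram n k) *ᵥ typedVec θ Q b = typedVec θ Q (J n k *ᵥ b) := by
  rw [typedVec, gram_mulVec_elim, typedVec]
  congr 1
  funext j
  rw [cx_J_mulVec, J_mulVec]
  push_cast
  ring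

theorem typedVec_dotProduct (θ θ' : ℂ) (Q Q' : Fin (n + 1) → ℝ) (b b' : Fin n → ℝ) :
    typedVec θ Q b ⬝ᵥ typedVec θ' Q' b' = ((Q ⬝ᵥ Q' : ℝ) : ℂ) + θ * θ' * ((b ⬝ᵥ b' : ℝ) : ℂ) := by
  simp only [dotProduct, Fintype.sum_sum_type, typedVec, Sum.elim_inl, Sum.elim_inr]
  push_cast
  rw [Finset.mul_sum]
  congr 1
  exact Finset.sum_congr rfl fun j _ => by ring

theorem rankOne_typedVec (θ θ' : ℂ) (Q : Fin (n + 1) → ℝ) (b : Fin n → ℝ) :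
    rankOne n k (typedVec θ Q b) (typedVec θ' Q b) = (4⁻¹ : ℂ) • Matrix.fromBlocks
      (cx (Matrix.vecMulVec Q Q)) (θ' • cx (Matrix.vecMulVec Q (J n k *ᵥ b)))
      (θ • cx (Matrix.vecMulVec b Q)) ((θ * θ') • cx (Matrix.vecMulVec b (J n k *ᵥ b))) := by
  rw [rankOne, gram_typedVec]
  congr 1
  ext (i | i) (j | j) <;> simp [Matrix.vecMulVec_apply, typedVec, cx] <;> ring

/-- The real matrix `2 (π_L + π_{ρL})`, for `L` spanned by a normalized vector `(Q, θ b)` with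
`θ² = η`; the simple element at `0` is `1` minus this matrix. -/
def dressR (n k : ℕ) (η : ℝ) (Q : Fin (n + 1) → ℝ) (b : Fin n → ℝ) : Matrix (Idx n) (Idx n) ℝ :=
  Matrix.fromBlocks (Matrix.vecMulVec Q Q) 0 0 (-(η • Matrix.vecMulVec b (J n k *ᵥ b)))

/-- The real matrix `(2 / θ) (π_L - π_{ρL})`, for `L` spanned by a normalized vector `(Q, θ b)`; a
multiple of it is the derivative at `0` of the inverse of the simple element. -/
def dressN (n k : ℕ) (Q : Fin (n + 1) → ℝ) (b : Fin n → ℝ) : Matrix (Idx n) (Idx n) ℝ :=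
  Matrix.fromBlocks 0 (-Matrix.vecMulVec Q (J n k *ᵥ b)) (Matrix.vecMulVec b Q) 0

section Normalized

variable {θ : ℂ} {η : ℝ} {Q : Fin (n + 1) → ℝ} {b : Fin n → ℝ}

theorem rankOne_add (hθ : θ * θ = η) :
    rankOne n k (typedVec θ Q b) (typedVec (-θ) Q b) +
      rankOne n k (typedVec (-θ) Q b) (typedVec θ Q b) = (2⁻¹ : ℂ) • cx (dressR n k η Q b) := by
  rw [rankOne_typedVec, rankOne_typedVec, dressR, cx_fromBlocks, cx_neg, mul_neg, neg_mul, hθ]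
  ext (i | i) (j | j) <;> simp [cx] <;> ring

theorem rankOne_sub :
    rankOne n k (typedVec θ Q b) (typedVec (-θ) Q b) -
      rankOne n k (typedVec (-θ) Q b) (typedVec θ Q b) = (2⁻¹ * θ) • cx (dressN n k Q b) := by
  rw [rankOne_typedVec, rankOne_typedVec, dressN, cx_fromBlocks, cx_neg, mul_neg, neg_mul]
  ext (i | i) (j | j) <;> simp [cx] <;> ring

theorem dressR_mul_self (hQ : Q ⬝ᵥ Q = 2) (hb : η * (b ⬝ᵥ (J n k *ᵥ b)) = -2) :
    dressR n k η Q b * dressR n k η Q b = (2 : ℝ) • dressR n k η Q b := by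
  have h : (J n k *ᵥ b) ⬝ᵥ b = b ⬝ᵥ (J n k *ᵥ b) := dotProduct_comm _ _
  rw [dressR, Matrix.fromBlocks_multiply, Matrix.fromBlocks_smul]
  simp only [Matrix.mul_zero, Matrix.zero_mul, add_zero, zero_add, Matrix.neg_mul,
    Matrix.mul_neg, neg_zero,
    Matrix.smul_mul,
    Matrix.mul_smul, Matrix.vecMulVec_mul_vecMulVec, hQ, h, Matrix.vecMulVec_smul, smul_zero]
  refine Matrix.fromBlocks_inj.2 ⟨rfl, rfl, rfl, ?_⟩
  linear_combination (norm := module) hb • (η • Matrix.vecMulVec b (J n k *ᵥ b))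

theorem dressN_mul_dressR (hQ : Q ⬝ᵥ Q = 2) (hb : η * (b ⬝ᵥ (J n k *ᵥ b)) = -2) :
    dressN n k Q b * dressR n k η Q b = (2 : ℝ) • dressN n k Q b := by
  have h : (J n k *ᵥ b) ⬝ᵥ b = b ⬝ᵥ (J n k *ᵥ b) := dotProduct_comm _ _
  rw [dressR, dressN, Matrix.fromBlocks_multiply, Matrix.fromBlocks_smul]
  simp only [Matrix.mul_zero, Matrix.zero_mul, add_zero, zero_add, Matrix.neg_mul,
    Matrix.mul_neg, neg_zero,
    Matrix.mul_smul, Matrix.vecMulVec_mul_vecMulVec, hQ, h, Matrix.vecMulVec_smul, smul_zero]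
  refine Matrix.fromBlocks_inj.2 ⟨rfl, ?_, rfl, rfl⟩
  linear_combination (norm := module) hb • (Matrix.vecMulVec Q (J n k *ᵥ b))

end Normalized

/-- The data at `0` of the loop `M p_{α,L}⁻¹`, for `L` spanned by a normalized vector `(Q, θ b)`. -/
theorem dressing {M Mt : ℂ → Matrix (Idx n) (Idx n) ℂ} (hM : HasBlocks n k M)
    (hP : HasPotential n k M) {α θ : ℂ} {a η : ℝ} (hθ : θ * θ = η) (hα : α = θ * a) (hα0 : α ≠ 0)
    {Q : Fin (n + 1) → ℝ} {b : Fin n → ℝ} (hQ : Q ⬝ᵥ Q = 2)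
    (hb : η * (b ⬝ᵥ (J n k *ᵥ b)) = -2)
    (hMt : ∀ l, Mt l = M l * (simpleElt n k α (Submodule.span ℂ {typedVec θ Q b}) l)⁻¹) :
    HasBlocks n k Mt ∧ HasPotential n k Mt ∧
      topBlock Mt = topBlock M * (1 - Matrix.vecMulVec Q Q) ∧
      botBlock Mt = botBlock M * (1 + η • Matrix.vecMulVec b (J n k *ᵥ b)) ∧
      potential Mt = potential M -
        a⁻¹ • Matrix.vecMulVec (topBlock M *ᵥ Q) (J n k *ᵥ (botBlock M *ᵥ b)) := by
  obtain ⟨hθ0, ha0⟩ : θ ≠ 0 ∧ (a : ℂ) ≠ 0 := by rw [hα] at hα0; exact mul_ne_zero_iff.1 hα0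
  have hb' : ((η : ℂ) * ((b ⬝ᵥ (J n k *ᵥ b) : ℝ) : ℂ)) = -2 := by exact_mod_cast hb
  have hbs : (J n k *ᵥ b) ⬝ᵥ b = b ⬝ᵥ (J n k *ᵥ b) := dotProduct_comm _ _
  set w := typedVec θ Q b with hw
  set w' := typedVec (-θ) Q b with hw'
  have p11 : (cx (gram n k) *ᵥ w) ⬝ᵥ w = 0 := by
    rw [hw, gram_typedVec, typedVec_dotProduct, hQ, hbs, hθ, hb']; norm_num
  have p22 : (cx (gram n k) *ᵥ w') ⬝ᵥ w' = 0 := by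
    rw [hw', gram_typedVec, typedVec_dotProduct, hQ, hbs, neg_mul_neg, hθ, hb']; norm_num
  have p12 : (cx (gram n k) *ᵥ w) ⬝ᵥ w' = 4 := by
    rw [hw, hw', gram_typedVec, typedVec_dotProduct, hQ, hbs, mul_neg, hθ, neg_mul, hb']; norm_num
  have p21 : (cx (gram n k) *ᵥ w') ⬝ᵥ w = 4 := by
    rw [hw, hw', gram_typedVec, typedVec_dotProduct, hQ, hbs, neg_mul, hθ, neg_mul, hb']; norm_num
  set P := rankOne n k w w' with hPdef
  set P' := rankOne n k w' w with hP'def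
  have q1 : P * P = P := by rw [hPdef, rankOne_mul_rankOne, p21]; norm_num
  have q2 : P' * P' = P' := by rw [hP'def, rankOne_mul_rankOne, p12]; norm_num
  have q3 : P * P' = 0 := by rw [hPdef, hP'def, rankOne_mul_rankOne, p22]; simp
  have q4 : P' * P = 0 := by rw [hPdef, hP'def, rankOne_mul_rankOne, p11]; simp
  set R := dressR n k η Q b with hR
  set N := dressN n k Q b with hN
  have hadd : P + P' = (2⁻¹ : ℂ) • cx R := rankOne_add hθ
  have hsub : P - P' = (2⁻¹ * θ) • cx N := rankOne_sub
  -- `K` is the inverse of the simple element, away from its poles `±α`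
  let s : ℂ → ℂ := fun l => (l - α) / (l + α)
  let K : ℂ → Matrix (Idx n) (Idx n) ℂ := fun l => 1 + ((s l)⁻¹ - 1) • P + (s l - 1) • P'
  have hMK : ∀ l, l ≠ α → l ≠ -α → Mt l = M l * K l := by
    intro l h1 h2
    have hs : s l ≠ 0 := div_ne_zero (sub_ne_zero.2 h1) (by
      rwa [Ne, ← eq_neg_iff_add_eq_zero])
    rw [hMt, simpleElt_eq (rho_typedVec θ Q b) p11 p22 p12 p21, inv_one_add_smul q1 q2 q3 q4 hs]
  have hs0 : s 0 = -1 := by simp [s, hα0]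
  have hK0 : K 0 = cx (1 - R) := by
    have : K 0 = 1 - (2 : ℂ) • (P + P') := by
      simp only [K, hs0]
      norm_num
      module
    rw [this, hadd, smul_smul, cx_sub, cx_one]
    norm_num
  have hds : HasDerivAt s (2 / α) 0 := by
    have h := ((hasDerivAt_id (0 : ℂ)).sub_const α).div ((hasDerivAt_id (0 : ℂ)).add_const α)
      (by simpa using hα0)
    convert! h using 1
    simp
    field_simp
    ring
  have hdsi : HasDerivAt (fun l => (s l)⁻¹) (-(2 / α)) 0 := by
    have h := hds.inv (by rw [hs0]; norm_num)
    convert! h using 1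
    rw [hs0]
    norm_num
  have hK' : ∀ i j, HasDerivAt (fun l => K l i j) ((-(a : ℂ)⁻¹ • cx N) i j) 0 := by
    have e1 : -(a : ℂ)⁻¹ • cx N = -(2 / α) • P + (2 / α) • P' := by
      have : -(2 / α) • P + (2 / α) • P' = -(2 / α) • (P - P') := by module
      rw [this, hsub, smul_smul, hα]
      congr 1
      field_simp
    intro i j
    rw [e1]
    have h := (((hdsi.sub_const 1).mul_const (P i j)).const_add
      ((1 : Matrix (Idx n) (Idx n) ℂ) i j)).add ((hds.sub_const 1).mul_const (P' i j))
    convert! h using 1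
  set M' : Matrix (Idx n) (Idx n) ℂ := Matrix.of fun a b => deriv (fun l => M l a b) 0 with hM'
  have hMd : ∀ i j, HasDerivAt (fun l => M l i j) (M' i j) 0 := fun i j =>
    (hP.1 i j).hasDerivAt
  have hnear : ∀ᶠ l in 𝓝 (0 : ℂ), Mt l = M l * K l := by
    have h1 : ∀ᶠ l in 𝓝 (0 : ℂ), l ≠ α := isOpen_ne.mem_nhds hα0.symm
    have h2 : ∀ᶠ l in 𝓝 (0 : ℂ), l ≠ -α := isOpen_ne.mem_nhds (neg_ne_zero.2 hα0).symm
    filter_upwards [h1, h2] with l h1 h2 using hMK l h1 h2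
  have hMt0 : Mt 0 = M 0 * cx (1 - R) := by rw [hnear.self_of_nhds, hK0]
  have hMtd : ∀ i j, HasDerivAt (fun l => Mt l i j)
      ((M' * cx (1 - R) + M 0 * (-(a : ℂ)⁻¹ • cx N) : Matrix (Idx n) (Idx n) ℂ) i j) 0 := by
    intro i j
    have h := hasDerivAt_matrix_mul hMd hK' i j
    rw [hK0] at h
    exact h.congr_of_eventuallyEq (hnear.mono fun l hl => by simp only [hl])
  -- the blocks of the loop at `0`
  obtain ⟨hM0, ho1, ho2⟩ := hM
  set g₁ := topBlock M with hg₁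
  set g₂ := botBlock M with hg₂
  rw [Matrix.mem_orthogonalGroup_iff'] at ho1
  have ho1' : g₁ * g₁ᵀ = 1 := mul_eq_one_comm.1 ho1
  have hsq1 : (1 - R) * (1 - R) = 1 := by
    have := dressR_mul_self (n := n) (k := k) hQ hb
    rw [← hR] at this
    simp only [mul_sub, sub_mul, mul_one, one_mul, this, two_smul]
    abel
  have hRblocks : 1 - R = Matrix.fromBlocks (1 - Matrix.vecMulVec Q Q) 0 0
      (1 + η • Matrix.vecMulVec b (J n k *ᵥ b)) := by
    rw [hR, dressR, ← Matrix.fromBlocks_one, sub_eq_add_neg, Matrix.fromBlocks_neg,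
      Matrix.fromBlocks_add]
    simp [sub_eq_add_neg]
  set S₁ := 1 - Matrix.vecMulVec Q Q with hS₁
  set S₂ := 1 + η • Matrix.vecMulVec b (J n k *ᵥ b) with hS₂
  have hsq := hsq1
  rw [hRblocks, Matrix.fromBlocks_multiply, ← Matrix.fromBlocks_one, Matrix.fromBlocks_inj] at hsq
  simp only [Matrix.mul_zero, Matrix.zero_mul, add_zero, zero_add] at hsq
  have hS₁t : S₁ᵀ = S₁ := by rw [hS₁, Matrix.transpose_sub, Matrix.transpose_vecMulVec]; simp
  have hS₂t : S₂ᵀ * J n k = J n k * S₂ := by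
    have e : b ᵥ* J n k = J n k *ᵥ b := by rw [← Matrix.mulVec_transpose, J_transpose]
    rw [hS₂, Matrix.transpose_add, Matrix.transpose_smul, Matrix.transpose_vecMulVec,
      Matrix.add_mul, Matrix.mul_add, Matrix.smul_mul, Matrix.mul_smul, Matrix.vecMulVec_mul,
      Matrix.mul_vecMulVec, e]
    simp
  have hMt0b : Mt 0 = Matrix.fromBlocks (cx (g₁ * S₁)) 0 0 (cx (g₂ * S₂)) := by
    rw [hMt0, hRblocks, hM0, ← cx_zero, ← cx_zero, ← cx_fromBlocks, ← cx_fromBlocks, ← cx_mul,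
      Matrix.fromBlocks_multiply]
    simp
  have hb1 := hasBlocks_of_eq (k := k) hMt0b
    (by rw [Matrix.transpose_mul, hS₁t, Matrix.mul_assoc, ← Matrix.mul_assoc g₁ᵀ, ho1,
          Matrix.one_mul, hsq.1])
    (by rw [Matrix.transpose_mul, Matrix.mul_assoc, Matrix.mul_assoc, ← Matrix.mul_assoc (J n k),
          ← Matrix.mul_assoc g₂ᵀ, ← Matrix.mul_assoc g₂ᵀ, ho2, ← Matrix.mul_assoc, hS₂t,
          Matrix.mul_assoc, hsq.2.2.2, Matrix.mul_one])
  -- the logarithmic derivative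
  have hg₂inv : g₂ * (J n k * g₂ᵀ * J n k) = 1 := by
    refine mul_eq_one_comm.1 ?_
    rw [Matrix.mul_assoc, Matrix.mul_assoc, ← Matrix.mul_assoc g₂ᵀ, ho2, J_mul_J]
  set V : Matrix (Idx n) (Idx n) ℝ := Matrix.fromBlocks g₁ᵀ 0 0 (J n k * g₂ᵀ * J n k) with hV
  have hM0r : M 0 = cx (Matrix.fromBlocks g₁ 0 0 g₂) := by
    rw [hM0, cx_fromBlocks, cx_zero, cx_zero]
  have hMV : M 0 * cx V = 1 := by
    rw [hM0r, hV, ← cx_mul, Matrix.fromBlocks_multiply]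
    simp [ho1', hg₂inv, cx_one]
  have hinv0 : (M 0)⁻¹ = cx V := Matrix.inv_eq_right_inv hMV
  have hcsq : cx (1 - R) * cx (1 - R) = 1 := by rw [← cx_mul, hsq1, cx_one]
  have hinv1 : (Mt 0)⁻¹ = cx (1 - R) * cx V := by
    refine Matrix.inv_eq_right_inv ?_
    rw [hMt0, mul_assoc, ← mul_assoc (cx (1 - R)), hcsq, one_mul, hMV]
  have hNR : N * (1 - R) = -N := by
    have := dressN_mul_dressR (n := n) (k := k) hQ hb
    rw [← hR, ← hN] at this
    rw [mul_sub, this, mul_one, two_smul]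
    abel
  have hconj : Matrix.fromBlocks g₁ 0 0 g₂ * N * V = Matrix.fromBlocks 0
      (-Matrix.vecMulVec (g₁ *ᵥ Q) (J n k *ᵥ (g₂ *ᵥ b)))
      (Matrix.vecMulVec (g₂ *ᵥ b) (g₁ *ᵥ Q)) 0 := by
    have e : (J n k *ᵥ b) ᵥ* (J n k * g₂ᵀ * J n k) = J n k *ᵥ (g₂ *ᵥ b) := by
      rw [← Matrix.mulVec_transpose, Matrix.transpose_mul, Matrix.transpose_mul,
        Matrix.transpose_transpose, J_transpose, Matrix.mulVec_mulVec, Matrix.mul_assoc,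
        Matrix.mul_assoc, J_mul_J, Matrix.mul_one, Matrix.mulVec_mulVec]
    have e' : Q ᵥ* g₁ᵀ = g₁ *ᵥ Q := Matrix.vecMul_transpose _ _
    rw [hN, dressN, hV, Matrix.fromBlocks_multiply, Matrix.fromBlocks_multiply]
    simp only [Matrix.mul_zero, Matrix.zero_mul, add_zero, zero_add, Matrix.mul_neg, Matrix.neg_mul,
      Matrix.mul_vecMulVec, Matrix.vecMulVec_mul, e, e', Matrix.zero_mulVec, Matrix.zero_vecMulVec,
      neg_zero]
  have hlog : logDeriv Mt = logDeriv M + (a : ℂ)⁻¹ • cx (Matrix.fromBlocks g₁ 0 0 g₂ * N * V) := by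
    have hd : (Matrix.of fun i j => deriv (fun l => Mt l i j) 0) =
        M' * cx (1 - R) + M 0 * (-(a : ℂ)⁻¹ • cx N) := by
      ext i j
      exact (hMtd i j).deriv
    have hNc : cx N * (cx (1 - R) * cx V) = -(cx N * cx V) := by
      rw [← mul_assoc, ← cx_mul, hNR, cx_neg, neg_mul]
    rw [logDeriv, hd, hinv1, logDeriv, hinv0, add_mul, mul_assoc M', ← mul_assoc (cx (1 - R)), hcsq,
      one_mul, mul_assoc (M 0), smul_mul_assoc, hNc, cx_mul, cx_mul, ← hM0r]
    simp [mul_assoc, hM']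
  have hpot := hasPotential_of_eq (k := k) (M := Mt) (Y := potential M -
        a⁻¹ • Matrix.vecMulVec (g₁ *ᵥ Q) (J n k *ᵥ (g₂ *ᵥ b)))
      (fun i j => (hMtd i j).differentiableAt) (by
    have e : (J n k *ᵥ (J n k *ᵥ (g₂ *ᵥ b))) = g₂ *ᵥ b := by
      rw [Matrix.mulVec_mulVec, J_mul_J, Matrix.one_mulVec]
    have e2 : J n k * (potential M -
        a⁻¹ • Matrix.vecMulVec (g₁ *ᵥ Q) (J n k *ᵥ (g₂ *ᵥ b)))ᵀ = J n k * (potential M)ᵀ -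
          a⁻¹ • Matrix.vecMulVec (g₂ *ᵥ b) (g₁ *ᵥ Q) := by
      rw [Matrix.transpose_sub, Matrix.transpose_smul, Matrix.transpose_vecMulVec,
        Matrix.mul_sub, Matrix.mul_smul, Matrix.mul_vecMulVec, e]
    rw [hlog, hP.2, hconj, e2, cx_fromBlocks]
    ext (i | i) (j | j) <;> simp [cx] <;> ring)
  exact ⟨hb1.1, hpot.1, hb1.2.1, hb1.2.2, hpot.2⟩

end

section

/-! ### The Lax pair and the potential of the extended frame -/

variable {n k : ℕ}

/-- Entrywise partial derivatives of a matrix-valued map. -/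
def HasPdMat {l m W : Type*} [NormedAddCommGroup W] [NormedSpace ℝ W] (i : Fin n)
    (M : Pt n → Matrix l m W) (M' : Matrix l m W) (x : Pt n) : Prop :=
  ∀ a b, HasPd i (fun y => M y a b) (M' a b) x

theorem HasPdMat.mul {l m o 𝔸 : Type*} [Fintype m] [NormedRing 𝔸] [NormedAlgebra ℝ 𝔸] {i : Fin n}
    {A : Pt n → Matrix l m 𝔸} {B : Pt n → Matrix m o 𝔸} {A' : Matrix l m 𝔸} {B' : Matrix m o 𝔸}
    {x : Pt n} (hA : HasPdMat i A A' x) (hB : HasPdMat i B B' x) :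
    HasPdMat i (fun y => A y * B y) (A' * B x + A x * B') x := by
  intro a b
  simp only [Matrix.mul_apply, Matrix.add_apply, ← Finset.sum_add_distrib]
  exact HasPd.sum fun c _ => (hA a c).mul (hB c b)

theorem HasPdMat.const {l m W : Type*} [NormedAddCommGroup W] [NormedSpace ℝ W] {i : Fin n}
    {x : Pt n} (M : Matrix l m W) : HasPdMat i (fun _ => M) 0 x := fun a b => HasPd.const (M a b)

theorem HasPdMat.transpose {l m W : Type*} [NormedAddCommGroup W] [NormedSpace ℝ W] {i : Fin n}
    {x : Pt n} {M : Pt n → Matrix l m W} {M' : Matrix l m W} (h : HasPdMat i M M' x) :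
    HasPdMat i (fun y => (M y)ᵀ) M'ᵀ x := fun a b => h b a

theorem HasPdMat.const_mul {l m o 𝔸 : Type*} [Fintype m] [NormedRing 𝔸] [NormedAlgebra ℝ 𝔸]
    {i : Fin n} (A : Matrix l m 𝔸) {B : Pt n → Matrix m o 𝔸} {B' : Matrix m o 𝔸}
    {x : Pt n} (hB : HasPdMat i B B' x) : HasPdMat i (fun y => A * B y) (A * B') x := by
  simpa using (HasPdMat.const A).mul hB

theorem HasPdMat.mul_const {l m o 𝔸 : Type*} [Fintype m] [NormedRing 𝔸] [NormedAlgebra ℝ 𝔸]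
    {i : Fin n} {A : Pt n → Matrix l m 𝔸} {A' : Matrix l m 𝔸} {x : Pt n} (hA : HasPdMat i A A' x)
    (B : Matrix m o 𝔸) : HasPdMat i (fun y => A y * B) (A' * B) x := by
  simpa using hA.mul (HasPdMat.const B)

section Bracket

/-- The off-diagonal block of `aᵢ`. -/
def aXi (n : ℕ) (i : Fin n) : Matrix (Fin n) (Fin (n + 1)) ℝ := Matrix.single i i.castSucc 1

/-- The upper left block of `[aᵢ, v]`. -/
def conn₁ (k : ℕ) (i : Fin n) (ξ : Matrix (Fin n) (Fin (n + 1)) ℝ) :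
    Matrix (Fin (n + 1)) (Fin (n + 1)) ℝ := ξᵀ * J n k * aXi n i - (aXi n i)ᵀ * J n k * ξ

/-- The lower right block of `[aᵢ, v]`. -/
def conn₂ (k : ℕ) (i : Fin n) (ξ : Matrix (Fin n) (Fin (n + 1)) ℝ) : Matrix (Fin n) (Fin n) ℝ :=
  ξ * (aXi n i)ᵀ * J n k - aXi n i * ξᵀ * J n k

theorem lie_pElt (i : Fin n) (ξ : Matrix (Fin n) (Fin (n + 1)) ℝ) :
    ⁅aElt n k i, pElt n k ξ⁆ = Matrix.fromBlocks (conn₁ k i ξ) 0 0 (conn₂ k i ξ) := by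
  rw [Ring.lie_def, aElt, pElt, pElt, ← aXi, Matrix.fromBlocks_multiply,
    Matrix.fromBlocks_multiply, sub_eq_add_neg, Matrix.fromBlocks_neg, Matrix.fromBlocks_add,
    conn₁, conn₂]
  refine Matrix.fromBlocks_inj.2 ⟨?_, ?_, ?_, ?_⟩ <;>
    simp only [Matrix.mul_zero, Matrix.zero_mul, Matrix.mul_neg, Matrix.neg_mul,
      Matrix.mul_assoc] <;>
    abel

theorem conn₁_transpose (i : Fin n) (ξ : Matrix (Fin n) (Fin (n + 1)) ℝ) :
    (conn₁ k i ξ)ᵀ = -conn₁ k i ξ := by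
  simp [conn₁, Matrix.transpose_mul, J_transpose, Matrix.mul_assoc]

theorem conn₂_skew (i : Fin n) (ξ : Matrix (Fin n) (Fin (n + 1)) ℝ) :
    J n k * (conn₂ k i ξ)ᵀ * J n k = -conn₂ k i ξ := by
  have h : ∀ M : Matrix (Fin n) (Fin n) ℝ, J n k * (J n k * M) = M := fun M => by
    rw [← Matrix.mul_assoc, J_mul_J, Matrix.one_mul]
  simp only [conn₂, Matrix.transpose_sub, Matrix.transpose_mul, J_transpose, Matrix.mul_assoc,
    Matrix.transpose_transpose, Matrix.mul_sub, Matrix.sub_mul, h, neg_sub]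

theorem conn₁_last (i : Fin n) (ξ : Matrix (Fin n) (Fin (n + 1)) ℝ) (a : Fin (n + 1)) :
    conn₁ k i ξ a (Fin.last n) = if a = i.castSucc then -(eps n k i * ξ i (Fin.last n)) else 0 := by
  have h1 : (ξᵀ * J n k * aXi n i) a (Fin.last n) = 0 := by
    rw [aXi, Matrix.mul_single_apply_of_ne _ _ _ _ _ (Fin.castSucc_lt_last i).ne']
  have h2 : ((aXi n i)ᵀ * J n k * ξ) a (Fin.last n) =
      if a = i.castSucc then eps n k i * ξ i (Fin.last n) else 0 := by
    rw [Matrix.mul_assoc, aXi, Matrix.transpose_single]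
    split_ifs with h
    · subst h
      simp [J, Matrix.diagonal_mul]
    · rw [Matrix.single_mul_apply_of_ne _ _ _ _ _ h]
  rw [conn₁, Matrix.sub_apply, h1, h2]
  split_ifs <;> simp

end Bracket

theorem lax_eq (F : Pt n → Matrix (Fin n) (Fin n) ℝ) (γ : Pt n → Fin n → ℝ) (i : Fin n) (x : Pt n)
    (l : ℂ) : lax n k F γ i x l = Matrix.fromBlocks (cx (conn₁ k i (xiMat (F x) (γ x))))
      (-(l • cx ((aXi n i)ᵀ * J n k))) (l • cx (aXi n i)) (cx (conn₂ k i (xiMat (F x) (γ x)))) := by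
  rw [lax, vMap, lie_pElt, aElt, ← aXi, pElt, cx_fromBlocks, cx_fromBlocks, Matrix.fromBlocks_smul,
    Matrix.fromBlocks_add, cx_zero, cx_zero, cx_zero, cx_zero, cx_neg]
  simp

/-- The Lax matrices lie in the Lie algebra of the form. -/
theorem gram_lax_gram (F : Pt n → Matrix (Fin n) (Fin n) ℝ) (γ : Pt n → Fin n → ℝ) (i : Fin n)
    (x : Pt n) (l : ℂ) :
    cx (gram n k) * (lax n k F γ i x l)ᵀ * cx (gram n k) = -lax n k F γ i x l := by
  have hJ : ∀ {o : Type} [Fintype o] (M : Matrix (Fin n) o ℂ),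
      cx (J n k) * (cx (J n k) * M) = M := fun M => by
    rw [← Matrix.mul_assoc, cx_J_mul, Matrix.one_mul]
  rw [lax_eq, cx_gram_eq, Matrix.fromBlocks_transpose, Matrix.fromBlocks_multiply,
    Matrix.fromBlocks_multiply, Matrix.fromBlocks_neg]
  refine Matrix.fromBlocks_inj.2 ⟨?_, ?_, ?_, ?_⟩
  · simp [← cx_transpose, conn₁_transpose, cx_neg]
  · simp [← cx_transpose, cx_mul]
  · simp [← cx_transpose, Matrix.transpose_mul, J_transpose, cx_mul, hJ]
  · simp [← cx_transpose, ← cx_mul, ← cx_neg, conn₂_skew]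

section MatrixNorm

open scoped Matrix.Norms.Operator

variable {ι : Type*} [Fintype ι] [DecidableEq ι]

/-- An entry of a complex matrix, as a real-linear continuous map. -/
def entryCLM (a b : ι) : Matrix ι ι ℂ →L[ℝ] ℂ :=
  LinearMap.toContinuousLinearMap
    { toFun := fun M => M a b
      map_add' := fun _ _ => rfl
      map_smul' := fun _ _ => rfl }

/-- An entry of a complex matrix, as a complex-linear continuous map. -/
def entryCLMC (a b : ι) : Matrix ι ι ℂ →L[ℂ] ℂ :=
  LinearMap.toContinuousLinearMap
    { toFun := fun M => M a b
      map_add' := fun _ _ => rfl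
      map_smul' := fun _ _ => rfl }

theorem hasFDerivAt_of_hasPdMat {g : Pt n → Matrix ι ι ℂ} {D : Fin n → Matrix ι ι ℂ} {x : Pt n}
    (hdiff : ∀ a b, DifferentiableAt ℝ (fun y => g y a b) x)
    (hD : ∀ i, HasPdMat i g (D i) x) :
    HasFDerivAt g (∑ i, (EuclideanSpace.proj (𝕜 := ℝ) i).smulRight (D i)) x := by
  have hg : g = fun y => ∑ a, ∑ b, (g y a b) • Matrix.single a b (1 : ℂ) := by
    funext y
    conv_lhs => rw [Matrix.matrix_eq_sum_single (g y)]
    simp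
  have hd : DifferentiableAt ℝ g x := by
    rw [hg]
    exact DifferentiableAt.fun_sum fun a _ => DifferentiableAt.fun_sum fun b _ =>
      (hdiff a b).smul_const _
  have h := hd.hasFDerivAt
  refine h.congr_fderiv ?_
  refine ContinuousLinearMap.ext fun w => ?_
  refine (fderiv_eq_sum_pd g x w).trans ?_
  simp only [sum_apply, ContinuousLinearMap.smulRight_apply]
  refine Finset.sum_congr rfl fun i _ => ?_
  have : pd i g x = D i := by
    ext a b
    have h1 := HasPd.clm (entryCLM a b) (⟨hd, rfl⟩ : HasPd i g (pd i g x) x)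
    exact h1.eq.symm.trans (hD i a b).eq
  rw [this]
  rfl

theorem continuousOn_matrix {U : Set (Pt n)} {g : Pt n → Matrix ι ι ℂ}
    (h : ∀ a b, ContinuousOn (fun y => g y a b) U) : ContinuousOn g U := by
  have hg : g = fun y => ∑ a, ∑ b, (g y a b) • Matrix.single a b (1 : ℂ) := by
    funext y
    conv_lhs => rw [Matrix.matrix_eq_sum_single (g y)]
    simp
  rw [hg]
  exact continuousOn_finsetSum _ fun a _ => continuousOn_finsetSum _ fun b _ =>
    (h a b).smul continuousOn_const

end MatrixNorm

end

section

variable {n k : ℕ} {Ω : Set (Pt n)} {F : Pt n → Matrix (Fin n) (Fin n) ℝ} {γ : Pt n → Fin n → ℝ}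
  {E : Pt n → ℂ → Matrix (Idx n) (Idx n) ℂ}

namespace IsExtendedFrame

theorem mul_inverse (h : IsExtendedFrame n k Ω F γ E) {x : Pt n} (hx : x ∈ Ω) (l : ℂ) :
    E x l * (cx (gram n k) * (E x l)ᵀ * cx (gram n k)) = 1 := by
  refine mul_eq_one_comm.1 ?_
  rw [mul_assoc, mul_assoc, ← mul_assoc (E x l)ᵀ, h.group x hx, cx_gram_mul]

theorem inverse_mul (h : IsExtendedFrame n k Ω F γ E) {x : Pt n} (hx : x ∈ Ω) (l : ℂ) :
    cx (gram n k) * (E x l)ᵀ * cx (gram n k) * E x l = 1 :=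
  mul_eq_one_comm.1 (h.mul_inverse hx l)

theorem inv_eq (h : IsExtendedFrame n k Ω F γ E) {x : Pt n} (hx : x ∈ Ω) (l : ℂ) :
    (E x l)⁻¹ = cx (gram n k) * (E x l)ᵀ * cx (gram n k) :=
  Matrix.inv_eq_right_inv (h.mul_inverse hx l)

theorem differentiableAt (h : IsExtendedFrame n k Ω F γ E) (hΩ : IsOpen Ω) {x : Pt n}
    (hx : x ∈ Ω) (l : ℂ) (a b : Idx n) :
    DifferentiableAt ℝ (fun y => E y l a b) x :=
  ((h.smooth l a b).contDiffAt (hΩ.mem_nhds hx)).differentiableAt (by simp)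

theorem hasPdMat (h : IsExtendedFrame n k Ω F γ E) (hΩ : IsOpen Ω) {x : Pt n}
    (hx : x ∈ Ω) (l : ℂ) (i : Fin n) :
    HasPdMat i (fun y => E y l) (E x l * lax n k F γ i x l) x := fun a b =>
  ⟨h.differentiableAt hΩ hx l a b, congrFun (congrFun (h.parallel x hx l i) a) b⟩

/-- The inverse frame satisfies `∂ᵢ E⁻¹ = -(aᵢ l + [aᵢ, v]) E⁻¹`. -/
theorem hasPdMat_inverse (h : IsExtendedFrame n k Ω F γ E) (hΩ : IsOpen Ω) {x : Pt n}
    (hx : x ∈ Ω) (l : ℂ) (i : Fin n) :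
    HasPdMat i (fun y => cx (gram n k) * (E y l)ᵀ * cx (gram n k))
      (-(lax n k F γ i x l * (cx (gram n k) * (E x l)ᵀ * cx (gram n k)))) x := by
  have h1 := ((h.hasPdMat hΩ hx l i).transpose.const_mul (cx (gram n k))).mul_const
    (cx (gram n k))
  have e : cx (gram n k) * (E x l * lax n k F γ i x l)ᵀ * cx (gram n k) =
      -(lax n k F γ i x l * (cx (gram n k) * (E x l)ᵀ * cx (gram n k))) := by
    have e1 := gram_lax_gram (n := n) (k := k) F γ i x l
    rw [← neg_mul, ← e1, Matrix.transpose_mul]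
    simp only [mul_assoc]
    rw [← mul_assoc (cx (gram n k)) (cx (gram n k)), cx_gram_mul, one_mul]
  rw [e] at h1
  exact h1

end IsExtendedFrame

section MatrixNorm

open scoped Matrix.Norms.Operator

/-- The extended frame is differentiable in the spectral parameter at `0`, and its logarithmic
derivative there is a primitive of the closed form `E₀ (∑ aᵢ dxᵢ) E₀⁻¹`. This uses that
`W_l = E_l E₀⁻¹` satisfies `∂ᵢ W_l = l W_l (E₀ aᵢ E₀⁻¹)`. -/
theorem IsNormalizedFrame.differentiableAt_and_hasPdMat_logDeriv
    (h : IsNormalizedFrame n k Ω F γ E) (hΩ : IsOpen Ω) (hc : IsPreconnected Ω)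
    (h0 : (0 : Pt n) ∈ Ω) {x : Pt n} (hx : x ∈ Ω) :
    (∀ a b, DifferentiableAt ℂ (fun l => E x l a b) 0) ∧ ∀ i,
      HasPdMat i (fun y => logDeriv (E y)) (E x 0 * cx (aElt n k i) * (E x 0)⁻¹) x := by
  have hE := h.toIsExtendedFrame
  let I : Pt n → Matrix (Idx n) (Idx n) ℂ := fun x => cx (gram n k) * (E x 0)ᵀ * cx (gram n k)
  have hEI : ∀ x ∈ Ω, E x 0 * I x = 1 := fun x hx => hE.mul_inverse hx 0
  have hIE : ∀ x ∈ Ω, I x * E x 0 = 1 := fun x hx => hE.inverse_mul hx 0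
  let Bi : Fin n → Pt n → Matrix (Idx n) (Idx n) ℂ := fun i x => E x 0 * cx (aElt n k i) * I x
  let B : Pt n → Pt n →L[ℝ] Matrix (Idx n) (Idx n) ℂ := fun x =>
    ∑ i, (EuclideanSpace.proj (𝕜 := ℝ) i).smulRight (Bi i x)
  let W : ℂ → Pt n → Matrix (Idx n) (Idx n) ℂ := fun l x => E x l * I x
  have hEd : ∀ l a b, DifferentiableOn ℝ (fun y => E y l a b) Ω := fun l a b =>
    (h.smooth l a b).differentiableOn (by simp)
  have hIsmooth : ∀ a b, ContDiffOn ℝ ∞ (fun y => I y a b) Ω := by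
    intro a b
    simp only [I, Matrix.mul_apply]
    exact ContDiffOn.sum fun j _ => (ContDiffOn.sum fun m _ =>
      contDiffOn_const.mul (h.smooth 0 j m)).mul contDiffOn_const
  have hWpd : ∀ l, ∀ x ∈ Ω, ∀ i, HasPdMat i (W l) (l • (W l x * Bi i x)) x := by
    intro l x hx i
    have h1 := (hE.hasPdMat hΩ hx l i).mul (hE.hasPdMat_inverse hΩ hx 0 i)
    have e : E x l * lax n k F γ i x l * (cx (gram n k) * (E x 0)ᵀ * cx (gram n k)) +
        E x l * -(lax n k F γ i x 0 * (cx (gram n k) * (E x 0)ᵀ * cx (gram n k))) =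
          l • (W l x * Bi i x) := by
      have e1 : lax n k F γ i x l = l • cx (aElt n k i) + lax n k F γ i x 0 := by simp [lax]
      have e2 : W l x * Bi i x = E x l * (cx (aElt n k i) * I x) := by
        simp only [W, Bi]
        rw [mul_assoc, mul_assoc (E x 0), ← mul_assoc (I x), hIE x hx, one_mul]
      rw [e1, e2]
      simp only [I, mul_add, add_mul, mul_neg, mul_assoc, smul_mul_assoc, mul_smul_comm]
      abel
    rw [e] at h1
    exact h1
  have hWdiff : ∀ l, ∀ x ∈ Ω, ∀ a b, DifferentiableAt ℝ (fun y => W l y a b) x := by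
    intro l x hx a b
    simp only [W, Matrix.mul_apply]
    exact DifferentiableAt.fun_sum fun j _ => (hE.differentiableAt hΩ hx l a j).mul
      (((hIsmooth j b).contDiffAt (hΩ.mem_nhds hx)).differentiableAt (by simp))
  have hW : ∀ l, ∀ x ∈ Ω, HasFDerivAt (W l)
      (l • (ContinuousLinearMap.mul ℝ (Matrix (Idx n) (Idx n) ℂ) (W l x)).comp (B x)) x := by
    intro l x hx
    refine (hasFDerivAt_of_hasPdMat (hWdiff l x hx) (hWpd l x hx)).congr_fderiv ?_
    refine ContinuousLinearMap.ext fun w => ?_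
    have e : ∀ w, B x w = ∑ i, w i • Bi i x := fun w => by
      simp only [B, sum_apply, ContinuousLinearMap.smulRight_apply]
      rfl
    change _ = l • (W l x * B x w)
    rw [e, Finset.mul_sum, Finset.smul_sum]
    simp only [sum_apply, ContinuousLinearMap.smulRight_apply]
    refine Finset.sum_congr rfl fun i _ => ?_
    rw [mul_smul_comm, smul_comm]
    rfl
  have hB : ContinuousOn B Ω := by
    refine continuousOn_finsetSum _ fun i _ => ?_
    have hBi : ContinuousOn (Bi i) Ω := by
      refine continuousOn_matrix fun a b => ?_
      simp only [Bi, Matrix.mul_apply]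
      exact continuousOn_finsetSum _ fun j _ => (continuousOn_finsetSum _ fun m _ =>
        (hEd 0 a m).continuousOn.mul continuousOn_const).mul (hIsmooth j b).continuousOn
    exact ((ContinuousLinearMap.smulRightL ℝ (Pt n) (Matrix (Idx n) (Idx n) ℂ)
      (EuclideanSpace.proj i)).continuous).comp_continuousOn hBi
  obtain ⟨Y, hY⟩ := exists_hasDerivAt_parameter hΩ hc h0 hB hW hEI (fun l => by
    simp [W, I, h.normalized, cx_gram_mul])
  have hEW : ∀ x ∈ Ω, ∀ l, E x l = W l x * E x 0 := fun x hx l => by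
    simp only [W]
    rw [mul_assoc, hIE x hx, mul_one]
  have hEder : ∀ x ∈ Ω, ∀ a b, HasDerivAt (fun l => E x l a b) ((Y x * E x 0) a b) 0 := by
    intro x hx a b
    have h1 : ∀ a b, HasDerivAt (fun l => W l x a b) (Y x a b) 0 := fun a b =>
      (entryCLMC a b).hasFDerivAt.comp_hasDerivAt 0 (hY x hx).1
    have h2 := hasDerivAt_matrix_mul h1 (B := fun _ => E x 0) (B' := 0)
      (fun a b => hasDerivAt_const _ _) a b
    simp only [mul_zero, add_zero, ← hEW x hx] at h2
    exact h2
  have hlog : ∀ x ∈ Ω, logDeriv (E x) = Y x := by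
    intro x hx
    have h1 : (Matrix.of fun a b => deriv (fun l => E x l a b) 0) = Y x * E x 0 := by
      ext a b
      exact (hEder x hx a b).deriv
    rw [logDeriv, h1, hE.inv_eq hx, mul_assoc]
    exact (congrArg (Y x * ·) (hEI x hx)).trans (mul_one _)
  refine ⟨fun a b => (hEder x hx a b).differentiableAt, fun i a b => ?_⟩
  have h1 := HasPd.clm (entryCLM a b) (HasPd.of_hasFDerivAt (i := i) (hY x hx).2)
  have h2 : B x (EuclideanSpace.single i 1) = Bi i x := by
    simp only [B, sum_apply, ContinuousLinearMap.smulRight_apply]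
    rw [Finset.sum_eq_single i]
    · simp
    · intro j _ hj
      simp [hj]
    · simp
  rw [hE.inv_eq hx]
  refine HasPd.congr_of_eventuallyEq (h1.congr_deriv (congrArg (entryCLM a b) h2)) ?_
  filter_upwards [hΩ.mem_nhds hx] with y hy
  rw [hlog y hy]
  rfl

end MatrixNorm

theorem IsNormalizedFrame.hasBlocks (h : IsNormalizedFrame n k Ω F γ E) {x : Pt n} (hx : x ∈ Ω) :
    HasBlocks n k (E x) :=
  hasBlocks_of_symm (by simpa using h.real x hx 0) (by simpa using h.twisted x hx 0)
    (h.group x hx 0)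

theorem IsNormalizedFrame.hasPotential (h : IsNormalizedFrame n k Ω F γ E) (hΩ : IsOpen Ω)
    (hc : IsPreconnected Ω) (h0 : (0 : Pt n) ∈ Ω) {x : Pt n} (hx : x ∈ Ω) :
    HasPotential n k (E x) :=
  hasPotential_of_symm (h.differentiableAt_and_hasPdMat_logDeriv hΩ hc h0 hx).1 (h.group x hx)
    (h.real x hx) (h.twisted x hx)

end

section

/-! ### The real data of the extended frame at `l = 0` -/

theorem HasPd.toLp {n m : ℕ} {i : Fin n} {x : Pt n} {g : Pt n → Fin m → ℝ} {g' : Fin m → ℝ}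
    (h : ∀ a, HasPd i (fun y => g y a) (g' a) x) :
    HasPd i (fun y => (WithLp.toLp 2 (g y) : Pt m)) (WithLp.toLp 2 g') x := by
  have hd : DifferentiableAt ℝ (fun y => (WithLp.toLp 2 (g y) : Pt m)) x :=
    differentiableAt_euclidean.2 fun a => (h a).diff
  refine ⟨hd, ?_⟩
  ext a
  exact (HasPd.clm (EuclideanSpace.proj (𝕜 := ℝ) a) ⟨hd, rfl⟩).eq.symm.trans (h a).eq

theorem metricField_eq {n k : ℕ} {G : ℂ → Matrix (Idx n) (Idx n) ℂ}
    (h : (botBlock G)ᵀ * J n k * botBlock G = J n k) (c : Fin n → ℝ) :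
    metricField n k G c = (botBlock G)ᵀ *ᵥ (J n k *ᵥ c) := by
  have h1 : (botBlock G)⁻¹ = J n k * (botBlock G)ᵀ * J n k := by
    refine Matrix.inv_eq_left_inv ?_
    rw [Matrix.mul_assoc, Matrix.mul_assoc, ← Matrix.mul_assoc (botBlock G)ᵀ, h, J_mul_J]
  rw [metricField, h1, Matrix.mulVec_mulVec, ← Matrix.mul_assoc, ← Matrix.mul_assoc, J_mul_J,
    Matrix.one_mul, Matrix.mulVec_mulVec]

theorem metricField_isotropic {n k : ℕ} {G : ℂ → Matrix (Idx n) (Idx n) ℂ}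
    (h : (botBlock G)ᵀ * J n k * botBlock G = J n k) {c : Fin n → ℝ}
    (hc : c ⬝ᵥ (J n k *ᵥ c) = 0) : ∑ i, eps n k i * metricField n k G c i ^ 2 = 0 := by
  have h0 : J n k * (botBlock G)ᵀ * J n k * botBlock G = 1 := by
    rw [Matrix.mul_assoc, Matrix.mul_assoc, ← Matrix.mul_assoc (botBlock G)ᵀ, h, J_mul_J]
  have h1 : botBlock G * (J n k * (botBlock G)ᵀ * J n k) = 1 := mul_eq_one_comm.1 h0
  have h2 : botBlock G * J n k * (botBlock G)ᵀ = J n k := by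
    calc botBlock G * J n k * (botBlock G)ᵀ
        = botBlock G * (J n k * (botBlock G)ᵀ * J n k) * J n k := by
          simp only [Matrix.mul_assoc, J_mul_J, Matrix.mul_one]
      _ = J n k := by rw [h1, Matrix.one_mul]
  have h3 : ∑ i, eps n k i * metricField n k G c i ^ 2 =
      metricField n k G c ⬝ᵥ (J n k *ᵥ metricField n k G c) := by
    simp only [dotProduct, J_mulVec]
    exact Finset.sum_congr rfl fun i _ => by ring
  have h4 : (J n k *ᵥ c) ᵥ* botBlock G = (botBlock G)ᵀ *ᵥ (J n k *ᵥ c) :=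
    (Matrix.mulVec_transpose _ _).symm
  rw [h3, metricField_eq h, ← h4, ← Matrix.dotProduct_mulVec, Matrix.mulVec_mulVec, h4,
    Matrix.mulVec_mulVec, h2, Matrix.mulVec_mulVec, J_mul_J, Matrix.one_mulVec,
    dotProduct_comm, hc]

theorem frameVec_orthonormal {n : ℕ} {G : ℂ → Matrix (Idx n) (Idx n) ℂ}
    (h : topBlock G ∈ Matrix.orthogonalGroup (Fin (n + 1)) ℝ) :
    Orthonormal ℝ fun j => frameVec G j := by
  rw [Matrix.mem_orthogonalGroup_iff'] at h
  rw [orthonormal_iff_ite]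
  intro i j
  have h1 := congrFun (congrFun h i) j
  rw [Matrix.mul_apply, Matrix.one_apply] at h1
  rw [← h1, PiLp.inner_apply]
  exact Finset.sum_congr rfl fun a _ => by simp [frameVec, mul_comm]

variable {n k : ℕ} {Ω : Set (Pt n)} {F : Pt n → Matrix (Fin n) (Fin n) ℝ} {γ : Pt n → Fin n → ℝ}
  {E : Pt n → ℂ → Matrix (Idx n) (Idx n) ℂ}

namespace IsNormalizedFrame

theorem hasPdMat_zero (h : IsNormalizedFrame n k Ω F γ E) (hΩ : IsOpen Ω) {x : Pt n} (hx : x ∈ Ω)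
    (i : Fin n) : HasPdMat i (fun y => E y 0) (Matrix.fromBlocks
      (cx (topBlock (E x) * conn₁ k i (xiMat (F x) (γ x)))) 0 0
      (cx (botBlock (E x) * conn₂ k i (xiMat (F x) (γ x))))) x := by
  have h1 := h.toIsExtendedFrame.hasPdMat hΩ hx 0 i
  rw [lax_eq, (h.hasBlocks hx).1, Matrix.fromBlocks_multiply] at h1
  simpa [cx_mul] using h1

theorem hasPdMat_topBlock (h : IsNormalizedFrame n k Ω F γ E) (hΩ : IsOpen Ω) {x : Pt n}
    (hx : x ∈ Ω) (i : Fin n) : HasPdMat i (fun y => topBlock (E y))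
      (topBlock (E x) * conn₁ k i (xiMat (F x) (γ x))) x := fun a b =>
  HasPd.clm Complex.reCLM (h.hasPdMat_zero hΩ hx i (Sum.inl a) (Sum.inl b))

theorem hasPdMat_botBlock (h : IsNormalizedFrame n k Ω F γ E) (hΩ : IsOpen Ω) {x : Pt n}
    (hx : x ∈ Ω) (i : Fin n) : HasPdMat i (fun y => botBlock (E y))
      (botBlock (E x) * conn₂ k i (xiMat (F x) (γ x))) x := fun a b =>
  HasPd.clm Complex.reCLM (h.hasPdMat_zero hΩ hx i (Sum.inr a) (Sum.inr b))

theorem hasPdMat_potential (h : IsNormalizedFrame n k Ω F γ E) (hΩ : IsOpen Ω)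
    (hc : IsPreconnected Ω) (h0 : (0 : Pt n) ∈ Ω) {x : Pt n} (hx : x ∈ Ω) (i : Fin n) :
    HasPdMat i (fun y => potential (E y))
      (-(topBlock (E x) * (aXi n i)ᵀ * (botBlock (E x))ᵀ * J n k)) x := by
  have h1 := (h.differentiableAt_and_hasPdMat_logDeriv hΩ hc h0 hx).2 i
  have e : E x 0 * cx (aElt n k i) * (E x 0)⁻¹ = Matrix.fromBlocks 0
      (cx (-(topBlock (E x) * (aXi n i)ᵀ * (botBlock (E x))ᵀ * J n k)))
      (cx (botBlock (E x) * aXi n i * (topBlock (E x))ᵀ)) 0 := by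
    have hJ : ∀ M : Matrix (Fin n) (Fin n) ℝ, J n k * (J n k * M) = M := fun M => by
      rw [← Matrix.mul_assoc, J_mul_J, Matrix.one_mul]
    rw [h.toIsExtendedFrame.inv_eq hx, (h.hasBlocks hx).1, aElt, ← aXi, pElt, gram,
      cx_fromBlocks, cx_fromBlocks, Matrix.fromBlocks_transpose]
    simp only [Matrix.fromBlocks_multiply, ← cx_transpose, ← cx_mul, cx_zero, cx_one,
      Matrix.transpose_zero, Matrix.mul_zero, Matrix.zero_mul, add_zero, zero_add, Matrix.one_mul,
      Matrix.mul_one]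
    simp only [Matrix.mul_neg, Matrix.neg_mul, Matrix.mul_assoc, hJ]
  rw [e] at h1
  exact fun a b => HasPd.clm Complex.reCLM (h1 (Sum.inl a) (Sum.inr b))

theorem hasPd_frameVec (h : IsNormalizedFrame n k Ω F γ E) (hΩ : IsOpen Ω) {x : Pt n}
    (hx : x ∈ Ω) (i : Fin n) (j : Fin (n + 1)) : HasPd i (fun y => frameVec (E y) j)
      (∑ m, conn₁ k i (xiMat (F x) (γ x)) m j • frameVec (E x) m) x := by
  refine (HasPd.toLp fun a => h.hasPdMat_topBlock hΩ hx i a j).congr_deriv ?_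
  ext a
  simp [Matrix.mul_apply, frameVec, mul_comm]

theorem hasPd_surfacePt (h : IsNormalizedFrame n k Ω F γ E) (hΩ : IsOpen Ω)
    (hc : IsPreconnected Ω) (h0 : (0 : Pt n) ∈ Ω) {x : Pt n} (hx : x ∈ Ω) (c : Fin n → ℝ)
    (i : Fin n) : HasPd i (fun y => surfacePt (E y) c)
      (-(metricField n k (E x) c i • frameVec (E x) i.castSucc)) x := by
  have h1 : ∀ a, HasPd i (fun y => (potential (E y) *ᵥ c) a)
      (((-(topBlock (E x) * (aXi n i)ᵀ * (botBlock (E x))ᵀ * J n k)) *ᵥ c) a) x := fun a => by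
    have h2 := HasPd.sum (s := Finset.univ) fun (j : Fin n) _ =>
      (h.hasPdMat_potential hΩ hc h0 hx i a j).mul (HasPd.const (c j))
    simpa [Matrix.mulVec, dotProduct] using h2
  refine (HasPd.toLp h1).congr_deriv ?_
  ext a
  rw [metricField_eq (h.hasBlocks hx).2.2]
  have e : (aXi n i)ᵀ *ᵥ ((botBlock (E x))ᵀ *ᵥ (J n k *ᵥ c)) =
      Pi.single i.castSucc (((botBlock (E x))ᵀ *ᵥ (J n k *ᵥ c)) i) := by
    rw [aXi, Matrix.transpose_single, Matrix.single_mulVec, one_mul]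
    rfl
  simp only [Matrix.neg_mulVec, ← Matrix.mulVec_mulVec, e]
  simp [frameVec, mul_comm]

theorem hasPd_metricField (h : IsNormalizedFrame n k Ω F γ E) (hΩ : IsOpen Ω) {x : Pt n}
    (hx : x ∈ Ω) (c : Fin n → ℝ) (i j : Fin n) : HasPd i (fun y => metricField n k (E y) c j)
      (((conn₂ k i (xiMat (F x) (γ x)))ᵀ *ᵥ metricField n k (E x) c) j) x := by
  have h1 : HasPd i (fun y => ((botBlock (E y))ᵀ *ᵥ (J n k *ᵥ c)) j)
      (((botBlock (E x) * conn₂ k i (xiMat (F x) (γ x)))ᵀ *ᵥ (J n k *ᵥ c)) j) x := by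
    have h2 := HasPd.sum (s := Finset.univ) fun (m : Fin n) _ =>
      (h.hasPdMat_botBlock hΩ hx i m j).mul (HasPd.const ((J n k *ᵥ c) m))
    simpa [Matrix.mulVec, dotProduct] using h2
  rw [metricField_eq (h.hasBlocks hx).2.2, Matrix.mulVec_mulVec, ← Matrix.transpose_mul]
  refine h1.congr_of_eventuallyEq ?_
  filter_upwards [hΩ.mem_nhds hx] with y hy
  rw [metricField_eq (h.hasBlocks hy).2.2]

theorem contDiffOn_topBlock (h : IsNormalizedFrame n k Ω F γ E) (a b : Fin (n + 1)) :
    ContDiffOn ℝ ∞ (fun x => topBlock (E x) a b) Ω :=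
  Complex.reCLM.contDiff.comp_contDiffOn (h.smooth 0 (Sum.inl a) (Sum.inl b))

theorem contDiffOn_frameVec (h : IsNormalizedFrame n k Ω F γ E) (j : Fin (n + 1)) :
    ContDiffOn ℝ ∞ (fun x => frameVec (E x) j) Ω :=
  contDiffOn_euclidean.2 fun a => h.contDiffOn_topBlock a j

theorem contDiffOn_metricField (h : IsNormalizedFrame n k Ω F γ E) (c : Fin n → ℝ) (j : Fin n) :
    ContDiffOn ℝ ∞ (fun x => metricField n k (E x) c j) Ω := by
  have h1 : ContDiffOn ℝ ∞ (fun x => ((botBlock (E x))ᵀ *ᵥ (J n k *ᵥ c)) j) Ω := by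
    simp only [Matrix.mulVec, dotProduct]
    exact ContDiffOn.sum fun m _ => (Complex.reCLM.contDiff.comp_contDiffOn
      (h.smooth 0 (Sum.inr m) (Sum.inr j))).mul contDiffOn_const
  exact h1.congr fun x hx => by rw [metricField_eq (h.hasBlocks hx).2.2]

end IsNormalizedFrame

end

section

variable {n k : ℕ} {Ω : Set (Pt n)} {F : Pt n → Matrix (Fin n) (Fin n) ℝ} {γ : Pt n → Fin n → ℝ}
  {E : Pt n → ℂ → Matrix (Idx n) (Idx n) ℂ}

theorem IsNormalizedFrame.adaptedFrame (h : IsNormalizedFrame n k Ω F γ E) (hΩ : IsOpen Ω)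
    (hΩc : IsPreconnected Ω) (h0 : (0 : Pt n) ∈ Ω) (hn : 0 < n) {c : Fin n → ℝ}
    (hc : c ⬝ᵥ (J n k *ᵥ c) = 0) :
    AdaptedFrame n k (fun x => surfacePt (E x) c) (fun j x => frameVec (E x) j)
      (fun x => metricField n k (E x) c) Ω where
  isOpen := hΩ
  diff_f x hx := (h.hasPd_surfacePt hΩ hΩc h0 hx c ⟨0, hn⟩).diff.differentiableWithinAt
  smooth_e := h.contDiffOn_frameVec
  smooth_u := h.contDiffOn_metricField c
  orthonormal x hx := frameVec_orthonormal (h.hasBlocks hx).2.1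
  pd_f x hx i := (h.hasPd_surfacePt hΩ hΩc h0 hx c i).eq
  pd_last x hx i := by
    refine ⟨-(eps n k i * xiMat (F x) (γ x) i (Fin.last n)), ?_⟩
    rw [(h.hasPd_frameVec hΩ hx i (Fin.last n)).eq]
    simp [conn₁_last]
  isotropic x hx := metricField_isotropic (h.hasBlocks hx).2.2 hc

/-! ### Darboux transforms in real terms -/

/-- The data from which the transform of an adapted frame is built: the frame satisfies
`∂ᵢ e = e Aᵢ`, `∂ᵢ u = Cᵢᵀ u` with skew `Aᵢ`, and `(q, b)` solves a linear system. For
`(q, θ b) = E_α⁻¹ v` with `α = θ a` and `η = θ² = ±1`, this is the system satisfied by `E_α⁻¹`. -/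
structure DressingData (n k : ℕ) (f : Pt n → Pt (n + 1)) (e : Fin (n + 1) → Pt n → Pt (n + 1))
    (u : Pt n → Fin n → ℝ) (a η : ℝ) (A : Fin n → Pt n → Matrix (Fin (n + 1)) (Fin (n + 1)) ℝ)
    (C : Fin n → Pt n → Matrix (Fin n) (Fin n) ℝ) (q : Pt n → Fin (n + 1) → ℝ)
    (b : Pt n → Fin n → ℝ) (O : Set (Pt n)) : Prop where
  adapted : AdaptedFrame n k f e u O
  ne_zero : a ≠ 0
  skew : ∀ x ∈ O, ∀ i, (A i x)ᵀ = -A i x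
  last : ∀ x ∈ O, ∀ i, ∃ m, ∀ j, A i x j (Fin.last n) = if j = i.castSucc then m else 0
  pd_e : ∀ x ∈ O, ∀ i j, HasPd i (e j) (∑ m, A i x m j • e m x) x
  pd_u : ∀ x ∈ O, ∀ i j, HasPd i (fun y => u y j) (((C i x)ᵀ *ᵥ u x) j) x
  pd_q : ∀ x ∈ O, ∀ i m, HasPd i (fun y => q y m)
    (-(A i x *ᵥ q x) m + if m = i.castSucc then η * a * eps n k i * b x i else 0) x
  pd_b : ∀ x ∈ O, ∀ i j, HasPd i (fun y => b y j)
    (-(C i x *ᵥ b x) j - if j = i then a * q x i.castSucc else 0) x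
  smooth_q : ∀ m, ContDiffOn ℝ ∞ (fun x => q x m) O
  smooth_b : ∀ j, ContDiffOn ℝ ∞ (fun x => b x j) O

namespace DressingData

variable {f : Pt n → Pt (n + 1)} {e : Fin (n + 1) → Pt n → Pt (n + 1)} {u : Pt n → Fin n → ℝ}
  {a η : ℝ} {A : Fin n → Pt n → Matrix (Fin (n + 1)) (Fin (n + 1)) ℝ}
  {C : Fin n → Pt n → Matrix (Fin n) (Fin n) ℝ} {q : Pt n → Fin (n + 1) → ℝ}
  {b : Pt n → Fin n → ℝ} {O : Set (Pt n)}

theorem hasPd_norm (h : DressingData n k f e u a η A C q b O) {x : Pt n} (hx : x ∈ O) (i : Fin n) :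
    HasPd i (fun y => q y ⬝ᵥ q y) (2 * (η * a * eps n k i * b x i * q x i.castSucc)) x := by
  have h1 := HasPd.sum (s := Finset.univ) fun (m : Fin (n + 1)) _ =>
    (h.pd_q x hx i m).mul (h.pd_q x hx i m)
  refine HasPd.congr_deriv h1 ?_
  have hz : q x ⬝ᵥ (A i x *ᵥ q x) = 0 := by
    have e1 : q x ⬝ᵥ (A i x *ᵥ q x) = -(q x ⬝ᵥ (A i x *ᵥ q x)) := by
      conv_lhs => rw [dotProduct_comm, ← Matrix.vecMul_transpose, h.skew x hx i,
        ← Matrix.dotProduct_mulVec, Matrix.neg_mulVec, dotProduct_neg]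
    linarith
  have e2 : ∀ m, (-(A i x *ᵥ q x) m + if m = i.castSucc then η * a * eps n k i * b x i else 0) *
      q x m + q x m * (-(A i x *ᵥ q x) m +
        if m = i.castSucc then η * a * eps n k i * b x i else 0) =
      -2 * (q x m * (A i x *ᵥ q x) m) +
        2 * (if m = i.castSucc then η * a * eps n k i * b x i * q x m else 0) := fun m => by
    split_ifs <;> ring
  rw [Finset.sum_congr rfl fun m _ => e2 m, Finset.sum_add_distrib, ← Finset.mul_sum,
    ← Finset.mul_sum]
  rw [dotProduct] at hz
  rw [hz]
  simp

theorem hasPd_sum (h : DressingData n k f e u a η A C q b O) {x : Pt n} (hx : x ∈ O) (i : Fin n) :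
    HasPd i (fun y => ∑ j, q y j • e j y) ((η * a * eps n k i * b x i) • e i.castSucc x) x := by
  have h1 := HasPd.sum (s := Finset.univ) fun (j : Fin (n + 1)) _ =>
    (h.pd_q x hx i j).smul (h.pd_e x hx i j)
  refine HasPd.congr_deriv h1 ?_
  have e1 : ∑ j, q x j • ∑ m, A i x m j • e m x = ∑ m, (A i x *ᵥ q x) m • e m x := by
    simp only [Finset.smul_sum, smul_smul, Matrix.mulVec, dotProduct, Finset.sum_smul]
    rw [Finset.sum_comm]
    exact Finset.sum_congr rfl fun m _ => Finset.sum_congr rfl fun j _ => by rw [mul_comm]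
  rw [Finset.sum_add_distrib, e1, ← Finset.sum_add_distrib]
  simp only [add_smul, neg_smul, ite_smul, zero_smul]
  simp

theorem hasPd_dot (h : DressingData n k f e u a η A C q b O) {x : Pt n} (hx : x ∈ O) (i : Fin n) :
    HasPd i (fun y => b y ⬝ᵥ u y) (-(a * q x i.castSucc * u x i)) x := by
  have h1 := HasPd.sum (s := Finset.univ) fun (j : Fin n) _ =>
    (h.pd_b x hx i j).mul (h.pd_u x hx i j)
  refine HasPd.congr_deriv h1 ?_
  have e1 : b x ⬝ᵥ ((C i x)ᵀ *ᵥ u x) = (C i x *ᵥ b x) ⬝ᵥ u x := by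
    rw [Matrix.dotProduct_mulVec, Matrix.vecMul_transpose]
  have e2 : ∀ j, (-(C i x *ᵥ b x) j - if j = i then a * q x i.castSucc else 0) * u x j +
      b x j * ((C i x)ᵀ *ᵥ u x) j = b x j * ((C i x)ᵀ *ᵥ u x) j - (C i x *ᵥ b x) j * u x j -
        if j = i then a * q x i.castSucc * u x j else 0 := fun j => by
    split_ifs <;> ring
  rw [Finset.sum_congr rfl fun m _ => e2 m, Finset.sum_sub_distrib, Finset.sum_sub_distrib]
  rw [dotProduct, dotProduct] at e1
  rw [e1]
  simp

/-- The transform of an adapted frame by the reflection in `∑ qⱼ eⱼ` is again adapted: with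
`s = ∑ qⱼ eⱼ`, `S = (q, q)` and `τ = (b, u)` one has `∂ᵢ s = η a εᵢ bᵢ eᵢ`,
`∂ᵢ S = 2 η a εᵢ bᵢ qᵢ` and `∂ᵢ τ = -a qᵢ uᵢ`. -/
theorem adaptedFrame_dressed (h : DressingData n k f e u a η A C q b O) {D : Set (Pt n)}
    (hn : 0 < n) (hD : IsOpen D) (hDO : D ⊆ O) (hS : ∀ x ∈ D, q x ⬝ᵥ q x ≠ 0)
    {ft : Pt n → Pt (n + 1)} {et : Fin (n + 1) → Pt n → Pt (n + 1)} {ut : Pt n → Fin n → ℝ}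
    (hft : ∀ x ∈ D, ft x = f x -
      (2 * (q x ⬝ᵥ q x)⁻¹ * ((b x ⬝ᵥ u x) * a⁻¹)) • ∑ j, q x j • e j x)
    (het : ∀ x ∈ D, ∀ m, et m x = e m x -
      (2 * (q x ⬝ᵥ q x)⁻¹ * q x m) • ∑ j, q x j • e j x)
    (hut : ∀ x ∈ D, ∀ i, ut x i = u x i +
      η * (2 * (q x ⬝ᵥ q x)⁻¹) * (b x ⬝ᵥ u x) * (eps n k i * b x i))
    (horth : ∀ x ∈ D, Orthonormal ℝ fun j => et j x)
    (hiso : ∀ x ∈ D, ∑ i, eps n k i * ut x i ^ 2 = 0) :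
    AdaptedFrame n k ft et ut D := by
  have ha := h.ne_zero
  have hSpd : ∀ x ∈ D, ∀ i, HasPd i (fun y => 2 * (q y ⬝ᵥ q y)⁻¹)
      (-(4 * (η * a * eps n k i * b x i * q x i.castSucc)) / (q x ⬝ᵥ q x) ^ 2) x := by
    intro x hx i
    refine ((HasPd.const (2 : ℝ)).mul ((h.hasPd_norm (hDO hx) i).inv (hS x hx))).congr_deriv ?_
    ring
  have hfpd : ∀ x ∈ O, ∀ i, HasPd i f (-(u x i • e i.castSucc x)) x := fun x hx i =>
    ⟨h.adapted.diff_f.differentiableAt (h.adapted.isOpen.mem_nhds hx), h.adapted.pd_f x hx i⟩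
  have hftpd : ∀ x ∈ D, ∀ i, HasPd i ft (-(ut x i • et i.castSucc x)) x := by
    intro x hx i
    have hxO := hDO hx
    have h1 := (hfpd x hxO i).sub (((hSpd x hx i).mul ((h.hasPd_dot hxO i).mul
      (HasPd.const a⁻¹))).smul (h.hasPd_sum hxO i))
    refine (h1.congr_of_eventuallyEq ?_).congr_deriv ?_
    · filter_upwards [hD.mem_nhds hx] with y hy using hft y hy
    · have hSx := hS x hx
      rw [hut x hx, het x hx]
      generalize ∑ j, q x j • e j x = s
      generalize q x ⬝ᵥ q x = S at hSx ⊢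
      generalize b x ⬝ᵥ u x = t
      match_scalars <;> field_simp <;> ring
  have hqs : ∀ m, ContDiffOn ℝ ∞ (fun x => q x m) D := fun m => (h.smooth_q m).mono hDO
  have hbs : ∀ j, ContDiffOn ℝ ∞ (fun x => b x j) D := fun j => (h.smooth_b j).mono hDO
  have hus : ∀ j, ContDiffOn ℝ ∞ (fun x => u x j) D := fun j => (h.adapted.smooth_u j).mono hDO
  have hes : ∀ j, ContDiffOn ℝ ∞ (e j) D := fun j => (h.adapted.smooth_e j).mono hDO
  have hSs : ContDiffOn ℝ ∞ (fun x => 2 * (q x ⬝ᵥ q x)⁻¹) D := by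
    refine contDiffOn_const.mul (ContDiffOn.inv ?_ hS)
    exact ContDiffOn.sum fun m _ => (hqs m).mul (hqs m)
  have hss : ContDiffOn ℝ ∞ (fun x => ∑ j, q x j • e j x) D :=
    ContDiffOn.sum fun j _ => (hqs j).smul (hes j)
  have hts : ContDiffOn ℝ ∞ (fun x => b x ⬝ᵥ u x) D :=
    ContDiffOn.sum fun j _ => (hbs j).mul (hus j)
  refine ⟨hD, fun x hx => (hftpd x hx ⟨0, hn⟩).diff.differentiableWithinAt, fun m => ?_,
    fun i => ?_, horth, fun x hx i => (hftpd x hx i).eq, fun x hx i => ?_, hiso⟩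
  · exact ((hes m).sub ((hSs.mul (hqs m)).smul hss)).congr fun x hx => het x hx m
  · exact ((hus i).add (((contDiffOn_const.mul hSs).mul hts).mul
      (contDiffOn_const.mul (hbs i)))).congr fun x hx => hut x hx i
  · have hxO := hDO hx
    obtain ⟨m, hm⟩ := h.last x hxO i
    have he : HasPd i (e (Fin.last n)) (m • e i.castSucc x) x := by
      refine (h.pd_e x hxO i (Fin.last n)).congr_deriv ?_
      simp only [hm, ite_smul, zero_smul]
      simp
    have hq : HasPd i (fun y => q y (Fin.last n)) (m * q x i.castSucc) x := by
      refine (h.pd_q x hxO i (Fin.last n)).congr_deriv ?_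
      rw [if_neg (Fin.castSucc_lt_last i).ne', add_zero, Matrix.mulVec, dotProduct]
      have hrow : ∀ j, A i x (Fin.last n) j = -if j = i.castSucc then m else 0 := fun j => by
        have h1 := congrFun (congrFun (h.skew x hxO i) j) (Fin.last n)
        rw [Matrix.transpose_apply, Matrix.neg_apply, hm] at h1
        exact h1
      simp [hrow]
    have h1 := he.sub (((hSpd x hx i).mul hq).smul (h.hasPd_sum hxO i))
    have h2 := h1.congr_of_eventuallyEq (g₁ := et (Fin.last n)) (by
      filter_upwards [hD.mem_nhds hx] with y hy using het y hy _)
    refine ⟨m - 2 * (q x ⬝ᵥ q x)⁻¹ * q x (Fin.last n) * (η * a * eps n k i * b x i), ?_⟩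
    rw [h2.eq, het x hx]
    have hSx := hS x hx
    generalize ∑ j, q x j • e j x = s
    generalize q x ⬝ᵥ q x = S at hSx ⊢
    match_scalars <;> field_simp
    ring

end DressingData

end

section

/-! ### The line `E_α⁻¹ L` -/

variable {n k : ℕ}

/-- `α = θ a` with `a` real and `θ = 1` (real type) or `θ = i` (imaginary type), and `η = θ²`. -/
structure IsType (α θ : ℂ) (a η : ℝ) : Prop where
  eq : α = θ * a
  ne_zero : a ≠ 0
  type : (θ = 1 ∧ η = 1) ∨ (θ = Complex.I ∧ η = -1)

namespace IsType

variable {α θ : ℂ} {a η : ℝ}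

theorem sq (h : IsType α θ a η) : θ * θ = η := by
  rcases h.type with ⟨rfl, rfl⟩ | ⟨rfl, rfl⟩ <;> simp

theorem θ_ne_zero (h : IsType α θ a η) : θ ≠ 0 := by
  rcases h.type with ⟨rfl, rfl⟩ | ⟨rfl, rfl⟩ <;> simp

theorem η_sq (h : IsType α θ a η) : η * η = 1 := by
  rcases h.type with ⟨rfl, rfl⟩ | ⟨rfl, rfl⟩ <;> norm_num

theorem α_ne_zero (h : IsType α θ a η) : α ≠ 0 := by
  rw [h.eq]
  exact mul_ne_zero h.θ_ne_zero (Complex.ofReal_ne_zero.2 h.ne_zero)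

end IsType

/-- The factor by which complex conjugation acts on the entries of vectors of the given type. -/
def conjSign (n : ℕ) (η : ℝ) : Idx n → ℝ := Sum.elim (fun _ => 1) fun _ => η

/-- Vectors in `ℝⁿ⁺¹ ⊕ θ ℝⁿ` are those on which conjugation acts by `conjSign`. -/
theorem eq_typedVec {α θ : ℂ} {a η : ℝ} (h : IsType α θ a η) {v : Idx n → ℂ}
    (hv : ∀ i, star (v i) = conjSign n η i * v i) :
    v = typedVec θ (fun i => (v (Sum.inl i)).re) fun j => (v (Sum.inr j) / θ).re := by
  funext i
  rcases i with i | j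
  · have h1 := hv (Sum.inl i)
    simp only [conjSign, Sum.elim_inl, Complex.ofReal_one, one_mul] at h1
    exact (Complex.conj_eq_iff_re.1 h1).symm
  · have h1 := hv (Sum.inr j)
    simp only [conjSign, Sum.elim_inr] at h1
    have h2 : star (v (Sum.inr j) / θ) = v (Sum.inr j) / θ := by
      rw [star_div₀, h1]
      rcases h.type with ⟨rfl, rfl⟩ | ⟨rfl, rfl⟩ <;> simp
    have h3 := Complex.conj_eq_iff_re.1 h2
    simp only [typedVec, Sum.elim_inr]
    rw [h3, mul_div_cancel₀ _ h.θ_ne_zero]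

theorem exists_typedVec {α : ℂ} {L : Submodule ℂ (Idx n → ℂ)} (hL : IsAdmissible n k α L) :
    ∃ (θ : ℂ) (a η : ℝ) (v : Idx n → ℂ), IsType α θ a η ∧ v ≠ 0 ∧ L = Submodule.span ℂ {v} ∧
      v ⬝ᵥ (cx (gram n k) *ᵥ v) = 0 ∧ ∀ i, star (v i) = conjSign n η i * v i := by
  obtain ⟨hα, v, hv, hLv, hiso, ⟨him, hr⟩ | ⟨hre, hr, hi⟩⟩ := hL
  · have e : α = α.re := Complex.ext (by simp) (by simp [him])
    refine ⟨1, α.re, 1, v, ⟨by rw [one_mul, ← e], fun h => hα (by rw [e, h]; simp),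
      Or.inl ⟨rfl, rfl⟩⟩, hv, hLv, hiso, ?_⟩
    rintro (i | i) <;>
    · simp only [conjSign, Sum.elim_inl, Sum.elim_inr, Complex.ofReal_one, one_mul]
      exact Complex.conj_eq_iff_im.2 (hr _)
  · have e : α = Complex.I * α.im := Complex.ext (by simp [hre]) (by simp)
    refine ⟨Complex.I, α.im, -1, v, ⟨e, fun h => hα (by rw [e, h]; simp),
      Or.inr ⟨rfl, rfl⟩⟩, hv, hLv, hiso, ?_⟩
    rintro (i | i)
    · simp only [conjSign, Sum.elim_inl, Complex.ofReal_one, one_mul]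
      exact Complex.conj_eq_iff_im.2 (hr _)
    · refine Complex.ext ?_ ?_ <;> simp [conjSign, hi]

/-- The diagonal entries of the Gram matrix. -/
def gramSign (n k : ℕ) : Idx n → ℝ := Sum.elim (fun _ => 1) (eps n k)

theorem cx_gram_eq_diagonal :
    cx (gram n k) = Matrix.diagonal fun i => (gramSign n k i : ℂ) := by
  have h : gram n k = Matrix.diagonal (gramSign n k) := by
    rw [gram, J, ← Matrix.diagonal_one, Matrix.fromBlocks_diagonal]
    rfl
  rw [h, cx, Matrix.diagonal_map Complex.ofReal_zero]

section Frame

variable {Ω : Set (Pt n)} {F : Pt n → Matrix (Fin n) (Fin n) ℝ} {γ : Pt n → Fin n → ℝ}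
  {E : Pt n → ℂ → Matrix (Idx n) (Idx n) ℂ} {α θ : ℂ} {a η : ℝ}

/-- For real `α` the matrix `E_α` is real, for imaginary `α` its conjugate is `ρ E_α ρ`. -/
theorem IsExtendedFrame.star_apply (h : IsExtendedFrame n k Ω F γ E) (hα : IsType α θ a η)
    {x : Pt n} (hx : x ∈ Ω) (i j : Idx n) :
    star (E x α i j) = conjSign n η i * conjSign n η j * E x α i j := by
  have h1 : star (E x α i j) = E x (star α) i j := by
    have := h.real x hx (star α)
    rw [star_star] at this
    exact congrFun (congrFun this i) j
  rw [h1]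
  rcases hα.type with ⟨hθ, rfl⟩ | ⟨hθ, rfl⟩
  · have e : star α = α := by rw [hα.eq, hθ]; simp
    rw [e]
    rcases i with i | i <;> rcases j with j | j <;> simp [conjSign]
  · have e : star α = -α := by rw [hα.eq, hθ]; simp
    have h2 := rho_conj_apply (E x (-α))
    rw [h.twisted x hx α] at h2
    rw [e]
    rcases i with i | i <;> rcases j with j | j
    · simp [conjSign, h2.1]
    · simp [conjSign, h2.2.1]
    · simp [conjSign, h2.2.2.1]
    · simp [conjSign, h2.2.2.2]

/-- The vector `E_α⁻¹ v`, with the inverse expressed through the form. -/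
def dressVec (n k : ℕ) (E : Pt n → ℂ → Matrix (Idx n) (Idx n) ℂ) (α : ℂ) (v : Idx n → ℂ)
    (x : Pt n) : Idx n → ℂ :=
  (cx (gram n k) * (E x α)ᵀ * cx (gram n k)) *ᵥ v

/-- The `ℝⁿ⁺¹`-component of `E_α⁻¹ v`. -/
def dressTop (n k : ℕ) (E : Pt n → ℂ → Matrix (Idx n) (Idx n) ℂ) (α : ℂ) (v : Idx n → ℂ)
    (x : Pt n) (i : Fin (n + 1)) : ℝ :=
  (dressVec n k E α v x (Sum.inl i)).re

/-- The `ℝⁿ`-component of `E_α⁻¹ v`, after division by `θ`. -/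
def dressBot (n k : ℕ) (E : Pt n → ℂ → Matrix (Idx n) (Idx n) ℂ) (α θ : ℂ) (v : Idx n → ℂ)
    (x : Pt n) (j : Fin n) : ℝ :=
  (dressVec n k E α v x (Sum.inr j) / θ).re

variable {v : Idx n → ℂ}

theorem dressVec_eq_typedVec (h : IsExtendedFrame n k Ω F γ E) (hα : IsType α θ a η)
    (hv : ∀ i, star (v i) = conjSign n η i * v i) {x : Pt n} (hx : x ∈ Ω) :
    dressVec n k E α v x = typedVec θ (dressTop n k E α v x) (dressBot n k E α θ v x) := by
  refine eq_typedVec hα fun i => ?_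
  have hs : ∀ j, (conjSign n η j : ℂ) * conjSign n η j = 1 := by
    rintro (j | j)
    · simp [conjSign]
    · simp only [conjSign, Sum.elim_inr]
      exact_mod_cast hα.η_sq
  rw [dressVec, cx_gram_eq_diagonal]
  simp only [Matrix.mulVec, dotProduct, Matrix.mul_diagonal, Matrix.diagonal_mul,
    Matrix.transpose_apply, star_sum, star_mul', Finset.mul_sum, h.star_apply hα hx, hv]
  refine Finset.sum_congr rfl fun j _ => ?_
  have hg : ∀ j : Idx n, star (gramSign n k j : ℂ) = gramSign n k j := fun j =>
    Complex.conj_ofReal _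
  rw [hg, hg]
  linear_combination ((gramSign n k i : ℂ) * conjSign n η i * E x α j i * gramSign n k j * v j) *
    hs j

theorem mulVec_dressVec (h : IsExtendedFrame n k Ω F γ E) {x : Pt n} (hx : x ∈ Ω) :
    E x α *ᵥ dressVec n k E α v x = v := by
  rw [dressVec, Matrix.mulVec_mulVec, h.mul_inverse hx, Matrix.one_mulVec]

theorem dressVec_ne_zero (h : IsExtendedFrame n k Ω F γ E) (hv : v ≠ 0) {x : Pt n} (hx : x ∈ Ω) :
    dressVec n k E α v x ≠ 0 := fun h0 => hv (by
  rw [← mulVec_dressVec (α := α) (v := v) h hx, h0, Matrix.mulVec_zero])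

theorem dressVec_isotropic (h : IsExtendedFrame n k Ω F γ E)
    (hv : v ⬝ᵥ (cx (gram n k) *ᵥ v) = 0) {x : Pt n} (hx : x ∈ Ω) :
    (cx (gram n k) *ᵥ dressVec n k E α v x) ⬝ᵥ dressVec n k E α v x = 0 := by
  set w := dressVec n k E α v x with hw
  rw [← mulVec_dressVec (α := α) (v := v) h hx, ← hw] at hv
  rw [Matrix.mulVec_mulVec, dotProduct_comm, ← Matrix.vecMul_transpose, ← Matrix.dotProduct_mulVec,
    Matrix.mulVec_mulVec, Matrix.transpose_mul, cx_gram_transpose, h.group x hx] at hv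
  rw [dotProduct_comm, hv]

theorem dressedLine_span (h : IsExtendedFrame n k Ω F γ E) {x : Pt n} (hx : x ∈ Ω) :
    dressedLine E α (Submodule.span ℂ {v}) x = Submodule.span ℂ {dressVec n k E α v x} := by
  rw [dressedLine, Submodule.map_span, Set.image_singleton, Matrix.toLin'_apply, h.inv_eq hx]
  rfl

theorem contDiffOn_dressVec (h : IsExtendedFrame n k Ω F γ E) (i : Idx n) :
    ContDiffOn ℝ ∞ (fun x => dressVec n k E α v x i) Ω := by
  simp only [dressVec, Matrix.mulVec, dotProduct, Matrix.mul_apply]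
  exact ContDiffOn.sum fun j _ => (ContDiffOn.sum fun m _ => (ContDiffOn.sum fun o _ =>
    contDiffOn_const.mul (h.smooth α m o)).mul contDiffOn_const).mul contDiffOn_const

theorem contDiffOn_dressTop (h : IsExtendedFrame n k Ω F γ E) (i : Fin (n + 1)) :
    ContDiffOn ℝ ∞ (fun x => dressTop n k E α v x i) Ω :=
  Complex.reCLM.contDiff.comp_contDiffOn (contDiffOn_dressVec h _)

theorem contDiffOn_dressBot (h : IsExtendedFrame n k Ω F γ E) (j : Fin n) :
    ContDiffOn ℝ ∞ (fun x => dressBot n k E α θ v x j) Ω :=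
  Complex.reCLM.contDiff.comp_contDiffOn ((contDiffOn_dressVec h _).div_const _)

theorem hasPd_dressVec (h : IsExtendedFrame n k Ω F γ E) (hΩ : IsOpen Ω) {x : Pt n} (hx : x ∈ Ω)
    (i : Fin n) (m : Idx n) : HasPd i (fun y => dressVec n k E α v y m)
      (-(lax n k F γ i x α *ᵥ dressVec n k E α v x) m) x := by
  have h1 := HasPd.sum (s := Finset.univ) fun (j : Idx n) _ =>
    (h.hasPdMat_inverse hΩ hx α i m j).mul (HasPd.const (v j))
  refine HasPd.congr_deriv h1 ?_
  rw [dressVec, Matrix.mulVec_mulVec]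
  simp [Matrix.mulVec, dotProduct]

theorem cx_mulVec_ofReal {l m : Type*} [Fintype m] (M : Matrix l m ℝ) (q : m → ℝ) (i : l) :
    (cx M *ᵥ fun j => (q j : ℂ)) i = (((M *ᵥ q) i : ℝ) : ℂ) := by
  simp [Matrix.mulVec, dotProduct, cx]

theorem cx_mulVec_mul_ofReal {l m : Type*} [Fintype m] (M : Matrix l m ℝ) (q : m → ℝ) (i : l) :
    (cx M *ᵥ fun j => θ * (q j : ℂ)) i = θ * (((M *ᵥ q) i : ℝ) : ℂ) := by
  simp [Matrix.mulVec, dotProduct, cx, Finset.mul_sum, mul_left_comm]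

theorem lax_mulVec_typedVec (hα : IsType α θ a η) (x : Pt n) (i : Fin n) (q : Fin (n + 1) → ℝ)
    (b : Fin n → ℝ) : lax n k F γ i x α *ᵥ typedVec θ q b = typedVec θ
      (fun m => (conn₁ k i (xiMat (F x) (γ x)) *ᵥ q) m -
        if m = i.castSucc then η * a * eps n k i * b i else 0)
      (fun j => (conn₂ k i (xiMat (F x) (γ x)) *ᵥ b) j +
        if j = i then a * q i.castSucc else 0) := by
  rw [lax_eq, typedVec, Matrix.fromBlocks_mulVec, typedVec, Sum.elim_comp_inl, Sum.elim_comp_inr]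
  have e1 : ∀ m, (((aXi n i)ᵀ * J n k) *ᵥ b) m = if m = i.castSucc then eps n k i * b i else 0 := by
    intro m
    rw [← Matrix.mulVec_mulVec, aXi, Matrix.transpose_single, Matrix.single_mulVec, one_mul,
      J_mulVec, Function.update_apply]
    rfl
  have e2 : ∀ j, (aXi n i *ᵥ q) j = if j = i then q i.castSucc else 0 := by
    intro j
    rw [aXi, Matrix.single_mulVec, one_mul, Function.update_apply]
    rfl
  funext m
  rcases m with m | j
  · simp only [Sum.elim_inl, Pi.add_apply, Matrix.neg_mulVec, Matrix.smul_mulVec, Pi.neg_apply,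
      Pi.smul_apply, cx_mulVec_ofReal, cx_mulVec_mul_ofReal, e1, smul_eq_mul]
    have hs := hα.sq
    split_ifs
    · push_cast
      rw [hα.eq, ← hs]
      ring
    · push_cast
      ring
  · simp only [Sum.elim_inr, Pi.add_apply, Matrix.smul_mulVec,
      Pi.smul_apply, cx_mulVec_ofReal, cx_mulVec_mul_ofReal, e2, smul_eq_mul]
    split_ifs
    · push_cast
      rw [hα.eq]
      ring
    · push_cast
      ring

/-- The vector `E_α⁻¹ v` provides dressing data for the hypersurface of `E`. -/
theorem IsNormalizedFrame.dressingData (h : IsNormalizedFrame n k Ω F γ E) (hΩ : IsOpen Ω)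
    (hΩc : IsPreconnected Ω) (h0 : (0 : Pt n) ∈ Ω) (hn : 0 < n) {c : Fin n → ℝ}
    (hc : c ⬝ᵥ (J n k *ᵥ c) = 0) (hα : IsType α θ a η)
    (hv : ∀ i, star (v i) = conjSign n η i * v i) :
    DressingData n k (fun x => surfacePt (E x) c) (fun j x => frameVec (E x) j)
      (fun x => metricField n k (E x) c) a η (fun i x => conn₁ k i (xiMat (F x) (γ x)))
      (fun i x => conn₂ k i (xiMat (F x) (γ x))) (dressTop n k E α v) (dressBot n k E α θ v) Ω where
  adapted := h.adaptedFrame hΩ hΩc h0 hn hc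
  ne_zero := hα.ne_zero
  skew x _ i := conn₁_transpose i _
  last x _ i := ⟨_, fun j => conn₁_last i _ j⟩
  pd_e x hx i j := h.hasPd_frameVec hΩ hx i j
  pd_u x hx i j := h.hasPd_metricField hΩ hx c i j
  pd_q x hx i m := by
    have h1 := HasPd.clm Complex.reCLM (hasPd_dressVec (α := α) (v := v) h.toIsExtendedFrame hΩ hx i
      (Sum.inl m))
    rw [dressVec_eq_typedVec h.toIsExtendedFrame hα hv hx, lax_mulVec_typedVec hα] at h1
    refine h1.congr_deriv ?_
    simp only [typedVec, Sum.elim_inl, Complex.reCLM_apply, Complex.neg_re, Complex.ofReal_re]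
    ring
  pd_b x hx i j := by
    have h1 := HasPd.clm Complex.reCLM ((hasPd_dressVec (α := α) (v := v) h.toIsExtendedFrame hΩ hx
      i (Sum.inr j)).mul (HasPd.const θ⁻¹))
    rw [dressVec_eq_typedVec h.toIsExtendedFrame hα hv hx, lax_mulVec_typedVec hα] at h1
    refine h1.congr_deriv ?_
    simp only [typedVec, Sum.elim_inr, mul_zero, add_zero]
    have e : ∀ r : ℝ, -(θ * (r : ℂ)) * θ⁻¹ = ((-r : ℝ) : ℂ) := fun r => by
      have := hα.θ_ne_zero
      push_cast
      field_simp
    rw [e, Complex.reCLM_apply, Complex.ofReal_re]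
    ring
  smooth_q m := contDiffOn_dressTop h.toIsExtendedFrame m
  smooth_b j := contDiffOn_dressBot h.toIsExtendedFrame j

end Frame

end

section

/-! ### Normalized spanning vectors -/

variable {n k : ℕ}

/-- The frame vectors, the field `u` and the point `Y c` of a dressed loop. -/
theorem dressing_geometric {M Mt : ℂ → Matrix (Idx n) (Idx n) ℂ} (hM : HasBlocks n k M)
    (hP : HasPotential n k M) {α θ : ℂ} {a η : ℝ} (hα : IsType α θ a η)
    {Q : Fin (n + 1) → ℝ} {b : Fin n → ℝ} (hQ : Q ⬝ᵥ Q = 2)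
    (hb : η * (b ⬝ᵥ (J n k *ᵥ b)) = -2)
    (hMt : ∀ l, Mt l = M l * (simpleElt n k α (Submodule.span ℂ {typedVec θ Q b}) l)⁻¹)
    (c : Fin n → ℝ) :
    HasBlocks n k Mt ∧ HasPotential n k Mt ∧
      (∀ i, frameVec Mt i = frameVec M i - Q i • ∑ j, Q j • frameVec M j) ∧
      (∀ i, metricField n k Mt c i = metricField n k M c i +
        η * (b ⬝ᵥ metricField n k M c) * (eps n k i * b i)) ∧
      surfacePt Mt c = surfacePt M c -
        ((b ⬝ᵥ metricField n k M c) * a⁻¹) • ∑ j, Q j • frameVec M j := by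
  obtain ⟨h1, h2, h3, h4, h5⟩ := dressing hM hP hα.sq hα.eq hα.α_ne_zero hQ hb hMt
  refine ⟨h1, h2, fun i => ?_, fun i => ?_, ?_⟩
  · ext r
    have e : (topBlock M * Matrix.vecMulVec Q Q) r i = (∑ j, topBlock M r j * Q j) * Q i := by
      rw [Matrix.mul_vecMulVec, Matrix.vecMulVec_apply]
      rfl
    simp only [frameVec, h3, mul_sub, mul_one, Matrix.sub_apply, e, PiLp.sub_apply, PiLp.smul_apply,
      WithLp.ofLp_sum, Finset.sum_apply, smul_eq_mul, WithLp.ofLp_smul, Pi.smul_apply]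
    rw [mul_comm (Q i)]
    simp only [mul_comm]
  · rw [metricField_eq h1.2.2, metricField_eq hM.2.2, h4, Matrix.transpose_mul,
      ← Matrix.mulVec_mulVec, Matrix.transpose_add, Matrix.transpose_smul,
      Matrix.transpose_vecMulVec, Matrix.transpose_one, Matrix.add_mulVec, Matrix.one_mulVec,
      Matrix.smul_mulVec, Matrix.vecMulVec_mulVec, Pi.add_apply, op_smul_eq_smul, Pi.smul_apply,
      Pi.smul_apply, J_mulVec, smul_eq_mul, smul_eq_mul, mul_assoc]
  · have e : (J n k *ᵥ (botBlock M *ᵥ b)) ⬝ᵥ c = b ⬝ᵥ metricField n k M c := by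
      rw [metricField_eq hM.2.2, ← Matrix.vecMul_transpose, J_transpose, ← Matrix.dotProduct_mulVec,
        ← Matrix.vecMul_transpose, ← Matrix.dotProduct_mulVec]
    ext r
    have e3 : potential Mt *ᵥ c = potential M *ᵥ c -
        ((b ⬝ᵥ metricField n k M c) * a⁻¹) • (topBlock M *ᵥ Q) := by
      rw [h5, Matrix.sub_mulVec, Matrix.smul_mulVec, Matrix.vecMulVec_mulVec, e, op_smul_eq_smul,
        smul_smul, mul_comm a⁻¹]
    simp only [surfacePt, e3, PiLp.sub_apply, PiLp.smul_apply, Pi.sub_apply, Pi.smul_apply,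
      WithLp.ofLp_sum, Finset.sum_apply, smul_eq_mul, WithLp.ofLp_smul, frameVec, Matrix.mulVec,
      dotProduct]
    have e2 : ∑ j, topBlock M r j * Q j = ∑ j, Q j * topBlock M r j :=
      Finset.sum_congr rfl fun j _ => mul_comm _ _
    rw [e2]

section Span

variable {α θ : ℂ} {a η : ℝ} {q : Fin (n + 1) → ℝ} {b : Fin n → ℝ}

theorem typedVec_smul (s : ℝ) : typedVec θ (s • q) (s • b) = (s : ℂ) • typedVec θ q b := by
  funext i
  rcases i with i | i <;> simp [typedVec, mul_left_comm]

theorem dotProduct_self_ne_zero {m : ℕ} {q : Fin m → ℝ} : q ⬝ᵥ q ≠ 0 ↔ q ≠ 0 :=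
  not_congr dotProduct_self_eq_zero

/-- An isotropic line of the given type is moved by `ρ` unless its `ℝⁿ⁺¹`-component vanishes. -/
theorem reflect_span_ne_iff (hα : IsType α θ a η) (hw : typedVec θ q b ≠ 0)
    (hiso : q ⬝ᵥ q + η * (b ⬝ᵥ (J n k *ᵥ b)) = 0) :
    reflect (Submodule.span ℂ {typedVec θ q b}) ≠ Submodule.span ℂ {typedVec θ q b} ↔ q ≠ 0 := by
  rw [reflect_span, rho_typedVec]
  refine not_congr ⟨fun h => ?_, ?_⟩
  · by_contra hq
    have hmem : typedVec (-θ) q b ∈ Submodule.span ℂ {typedVec θ q b} := by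
      rw [← h]; exact Submodule.mem_span_singleton_self _
    obtain ⟨s, hs⟩ := Submodule.mem_span_singleton.1 hmem
    obtain ⟨i, hi⟩ := Function.ne_iff.1 hq
    have hi' : (q i : ℂ) ≠ 0 := Complex.ofReal_ne_zero.2 hi
    have h1 : s * (q i : ℂ) = q i := congrFun hs (Sum.inl i)
    have hs1 : s = 1 := mul_right_cancel₀ hi' (by rw [h1, one_mul])
    have hb : b = 0 := by
      funext j
      have h2 : s * (θ * (b j : ℂ)) = -θ * b j := congrFun hs (Sum.inr j)
      rw [hs1, one_mul, neg_mul, self_eq_neg, mul_eq_zero] at h2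
      exact Complex.ofReal_eq_zero.1 (h2.resolve_left hα.θ_ne_zero)
    rw [hb, zero_dotProduct, mul_zero, add_zero, dotProduct_self_eq_zero] at hiso
    exact hq hiso
  · rintro rfl
    have e : typedVec (-θ) (0 : Fin (n + 1) → ℝ) b = -typedVec θ (0 : Fin (n + 1) → ℝ) b := by
      funext i
      rcases i with i | i <;> simp [typedVec]
    rw [e, ← Set.neg_singleton, Submodule.span_neg]

theorem smul_isotropic {s : ℝ} (hs : s * s * (q ⬝ᵥ q) = 2)
    (hiso : q ⬝ᵥ q + η * (b ⬝ᵥ (J n k *ᵥ b)) = 0) :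
    (s • q) ⬝ᵥ (s • q) = 2 ∧ η * ((s • b) ⬝ᵥ (J n k *ᵥ (s • b))) = -2 := by
  simp only [Matrix.mulVec_smul, smul_dotProduct, dotProduct_smul, smul_eq_mul]
  constructor
  · linarith
  · linear_combination s * s * hiso - hs

theorem isNormalizedSpan_smul (hα : IsType α θ a η) {s : ℝ} (hs : s * s * (q ⬝ᵥ q) = 2)
    (hiso : q ⬝ᵥ q + η * (b ⬝ᵥ (J n k *ᵥ b)) = 0) :
    IsNormalizedSpan n k α (Submodule.span ℂ {typedVec θ q b}) (s • q)
      fun j => θ * ((s • b) j : ℝ) where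
  span := by
    have hs0 : (s : ℂ) ≠ 0 := Complex.ofReal_ne_zero.2 fun h => by
      rw [h] at hs
      norm_num at hs
    have e : Sum.elim (fun i => ((s • q) i : ℂ)) (fun j => θ * ((s • b) j : ℝ)) =
        (s : ℂ) • typedVec θ q b := typedVec_smul s
    rw [e, Submodule.span_singleton_smul_eq (isUnit_iff_ne_zero.2 hs0)]
  normQ := (smul_isotropic hs hiso).1
  normZ := by
    have h1 := (smul_isotropic hs hiso).2
    have h2 : (fun j => θ * ((s • b) j : ℂ)) ⬝ᵥ (cx (J n k) *ᵥ fun j => θ * ((s • b) j : ℂ)) =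
        (θ * θ) * (((s • b) ⬝ᵥ (J n k *ᵥ (s • b)) : ℝ) : ℂ) := by
      simp only [dotProduct, cx_mulVec_mul_ofReal]
      push_cast
      rw [Finset.mul_sum]
      exact Finset.sum_congr rfl fun j _ => by ring
    rw [h2, hα.sq]
    exact_mod_cast h1
  typeZ := by
    rcases hα.type with ⟨hθ, -⟩ | ⟨hθ, -⟩
    · exact Or.inl ⟨by simp [hα.eq, hθ], fun j => by simp [hθ]⟩
    · exact Or.inr ⟨by simp [hα.eq, hθ], fun j => by simp [hθ]⟩

/-- A normalized spanning vector is a real multiple of a given one, hence unique up to sign. -/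
theorem IsNormalizedSpan.exists_smul {Q : Fin (n + 1) → ℝ} {Z : Fin n → ℂ} (hq : q ≠ 0)
    (h : IsNormalizedSpan n k α (Submodule.span ℂ {typedVec θ q b}) Q Z) :
    ∃ s : ℝ, s * s * (q ⬝ᵥ q) = 2 ∧ Q = s • q ∧ Z = fun j => θ * ((s • b) j : ℝ) := by
  have hmem : Sum.elim (fun i => (Q i : ℂ)) Z ∈ Submodule.span ℂ {typedVec θ q b} := by
    rw [h.span]; exact Submodule.mem_span_singleton_self _
  obtain ⟨t, ht⟩ := Submodule.mem_span_singleton.1 hmem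
  obtain ⟨i, hi⟩ := Function.ne_iff.1 hq
  have hi' : (q i : ℂ) ≠ 0 := Complex.ofReal_ne_zero.2 hi
  have h1 : ∀ i, t * (q i : ℂ) = Q i := fun i => congrFun ht (Sum.inl i)
  obtain ⟨s, rfl⟩ : ∃ s : ℝ, t = s :=
    ⟨Q i / q i, by push_cast; rw [eq_div_iff hi', h1]⟩
  have hQ : Q = s • q := funext fun i => by
    have := h1 i
    rw [← Complex.ofReal_mul] at this
    exact (Complex.ofReal_injective this).symm
  refine ⟨s, ?_, hQ, ?_⟩
  · have := h.normQ
    rw [hQ] at this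
    simpa [mul_assoc] using this
  · funext j
    have h2 : (s : ℂ) * (θ * (b j : ℂ)) = Z j := congrFun ht (Sum.inr j)
    rw [← h2]
    simp [mul_left_comm]

end Span

end

end Guichard

end

open Guichard in
theorem mainTheorem5 (n k : ℕ) (hk : 1 ≤ k) (hkn : k + 1 ≤ n)
    (Ω : Set (Guichard.Pt n)) (hΩ : IsOpen Ω) (hΩc : IsConnected Ω) (h0 : (0 : Guichard.Pt n) ∈ Ω)
    (F : Guichard.Pt n → Matrix (Fin n) (Fin n) ℝ) (γ : Guichard.Pt n → Fin n → ℝ)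
    (hsol : Guichard.IsSolution n k Ω F γ)
    (E : Guichard.Pt n → ℂ → Matrix (Guichard.Idx n) (Guichard.Idx n) ℂ)
    (hE : Guichard.IsNormalizedFrame n k Ω F γ E)
    (c : Fin n → ℝ) (hc : c ⬝ᵥ (Guichard.J n k *ᵥ c) = 0)
    (α : ℂ) (L : Submodule ℂ (Guichard.Idx n → ℂ)) (hL : Guichard.IsAdmissible n k α L)
    (hρ : Guichard.reflect L ≠ L)
    -- the line `E_α⁻¹ L`, the dressed frame, and the domain of the transform
    (Lt : Guichard.Pt n → Submodule ℂ (Guichard.Idx n → ℂ))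
    (hLt : ∀ x, Lt x = Guichard.dressedLine E α L x)
    (Et : Guichard.Pt n → ℂ → Matrix (Guichard.Idx n) (Guichard.Idx n) ℂ)
    (hEt : ∀ x l, Et x l = Guichard.dressedFrame n k E α L x l)
    (D : Set (Guichard.Pt n)) (hD : D = {x | x ∈ Ω ∧ Guichard.reflect (Lt x) ≠ Lt x})
    -- the hypersurface of `E`, and the frame vectors and metric fields of `E` and `Et`
    (f : Guichard.Pt n → Guichard.Pt (n + 1)) (hf : ∀ x, f x = Guichard.surfacePt (E x) c)
    (e et : Fin (n + 1) → Guichard.Pt n → Guichard.Pt (n + 1))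
    (he : ∀ i x, e i x = Guichard.frameVec (E x) i)
    (het : ∀ i x, et i x = Guichard.frameVec (Et x) i)
    (u ut : Guichard.Pt n → Fin n → ℝ)
    (hu : ∀ x, u x = Guichard.metricField n k (E x) c)
    (hut : ∀ x, ut x = Guichard.metricField n k (Et x) c)
    (U Ut : Set (Guichard.Pt n)) (hU : U = {x | x ∈ Ω ∧ ∀ i, u x i ≠ 0})
    (hUt : Ut = {x | x ∈ D ∧ ∀ i, ut x i ≠ 0}) :
    -- the domain of the transform, and existence of the normalized vectors `Q`, `Z`
    (IsOpen D ∧ 0 ∈ D ∧ ∀ x ∈ D, ∃ Q Z, Guichard.IsNormalizedSpan n k α (Lt x) Q Z) ∧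
    -- the block forms of both frames
    (∀ x ∈ Ω, Guichard.HasBlocks n k (E x) ∧ Guichard.HasPotential n k (E x)) ∧
    (∀ x ∈ D, Guichard.HasBlocks n k (Et x) ∧ Guichard.HasPotential n k (Et x)) ∧
    -- the original hypersurface
    (∀ x ∈ Ω, Function.Injective (fderiv ℝ f x) ↔ ∀ i, u x i ≠ 0) ∧
    Guichard.IsIsothermic n k f U ∧
    Guichard.IsUnitNormal f (e (Fin.last n)) U ∧
    (∀ x ∈ U, ∀ i : Fin n,
      Guichard.IsPrincipalDirection f (e (Fin.last n)) x (e i.castSucc x)) ∧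
    ∀ (Q : Guichard.Pt n → Fin (n + 1) → ℝ) (Z : Guichard.Pt n → Fin n → ℂ)
      (T : Guichard.Pt n → ℂ) (ft : Guichard.Pt n → Guichard.Pt (n + 1)),
      (∀ x ∈ D, Guichard.IsNormalizedSpan n k α (Lt x) (Q x) (Z x)) →
      (∀ x, T x = (Z x ⬝ᵥ fun j => (u x j : ℂ)) / α) →
      (∀ x, ft x = f x - (T x).re • ∑ j, Q x j • e j x) →
      -- the coefficient is real, and the new hypersurface is read off from the dressed frame
      (∀ x ∈ D, (T x).im = 0 ∧ Guichard.surfacePt (Et x) c = ft x) ∧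
      -- the new hypersurface is isothermic, with principal directions `et i`
      (∀ x ∈ D, Function.Injective (fderiv ℝ ft x) ↔ ∀ i, ut x i ≠ 0) ∧
      Guichard.IsIsothermic n k ft Ut ∧
      Guichard.IsUnitNormal ft (et (Fin.last n)) Ut ∧
      (∀ x ∈ Ut, ∀ i : Fin n,
        Guichard.IsPrincipalDirection ft (et (Fin.last n)) x (et i.castSucc x)) ∧
      (∀ x ∈ D, ∀ i, et i x = e i x - Q x i • ∑ j, Q x j • e j x) ∧
      -- the transform is Ribaucour, with explicit common centres
      Guichard.IsRibaucour f ft {x | x ∈ U ∧ x ∈ Ut ∧ (∀ i, Q x i ≠ 0) ∧ T x ≠ 0} ∧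
      (∀ x ∈ D, ∀ i, Q x i ≠ 0 →
        ft x - ((T x).re / Q x i) • et i x = f x - ((T x).re / Q x i) • e i x) := by
  obtain rfl : Lt = fun x => dressedLine E α L x := funext hLt
  obtain rfl : Et = fun x l => dressedFrame n k E α L x l := funext fun x => funext (hEt x)
  obtain rfl : f = fun x => surfacePt (E x) c := funext hf
  obtain rfl : e = fun i x => frameVec (E x) i := funext fun i => funext (he i)
  obtain rfl : et = fun i x => frameVec (fun l => dressedFrame n k E α L x l) i :=
    funext fun i => funext (het i)
  obtain rfl : u = fun x => metricField n k (E x) c := funext hu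
  obtain rfl : ut = fun x => metricField n k (fun l => dressedFrame n k E α L x l) c := funext hut
  clear hLt hEt hf he het hu hut
  have hn : 0 < n := by omega
  obtain ⟨θ, a, η, v, hα, hv0, hLv, hviso, hvs⟩ := exists_typedVec hL
  have hEx := hE.toIsExtendedFrame
  have hA := hE.adaptedFrame hΩ hΩc.isPreconnected h0 hn hc
  have hdd := hE.dressingData hΩ hΩc.isPreconnected h0 hn hc hα hvs
  set q := dressTop n k E α v with hq
  set b := dressBot n k E α θ v with hb
  have hline : ∀ x ∈ Ω, dressedLine E α L x = Submodule.span ℂ {typedVec θ (q x) (b x)} := by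
    intro x hx
    rw [hLv, dressedLine_span hEx hx, dressVec_eq_typedVec hEx hα hvs hx]
  have hne : ∀ x ∈ Ω, typedVec θ (q x) (b x) ≠ 0 := by
    intro x hx
    rw [← dressVec_eq_typedVec hEx hα hvs hx]
    exact dressVec_ne_zero hEx hv0 hx
  have hiso : ∀ x ∈ Ω, q x ⬝ᵥ q x + η * (b x ⬝ᵥ (J n k *ᵥ b x)) = 0 := by
    intro x hx
    have h1 := dressVec_isotropic (α := α) hEx hviso hx
    rw [dressVec_eq_typedVec hEx hα hvs hx, gram_typedVec, typedVec_dotProduct, hα.sq,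
      dotProduct_comm (J n k *ᵥ _)] at h1
    exact_mod_cast h1
  have hDq : ∀ x, x ∈ D ↔ x ∈ Ω ∧ q x ≠ 0 := by
    intro x
    rw [hD]
    refine and_congr_right fun hx => ?_
    simp only [hline x hx]
    exact reflect_span_ne_iff hα (hne x hx) (hiso x hx)
  have hDΩ : D ⊆ Ω := fun x hx => ((hDq x).1 hx).1
  have hDS : ∀ x ∈ D, q x ⬝ᵥ q x ≠ 0 := fun x hx => dotProduct_self_ne_zero.2 ((hDq x).1 hx).2
  have hqc : ContinuousOn q Ω := continuousOn_pi.2 fun i => (hdd.smooth_q i).continuousOn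
  have hDo : IsOpen D := by
    have : D = Ω ∩ q ⁻¹' {0}ᶜ := Set.ext hDq
    rw [this]
    exact hqc.isOpen_inter_preimage hΩ isOpen_compl_singleton
  have h0D : (0 : Pt n) ∈ D := by
    rw [hD]
    refine ⟨h0, ?_⟩
    have : dressedLine E α L 0 = L := by
      rw [dressedLine, hE.normalized, inv_one, Matrix.toLin'_one, Submodule.map_id]
    simp only [this]
    exact hρ
  have hscale : ∀ x ∈ D, ∃ s : ℝ, s * s * (q x ⬝ᵥ q x) = 2 := by
    intro x hx
    have hpos : 0 < q x ⬝ᵥ q x := lt_of_le_of_ne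
      (Finset.sum_nonneg fun i _ => mul_self_nonneg _) (hDS x hx).symm
    refine ⟨√(2 / (q x ⬝ᵥ q x)), ?_⟩
    rw [Real.mul_self_sqrt (by positivity), div_mul_cancel₀ _ hpos.ne']
  -- the dressed loop at a point, in terms of any normalized spanning vector
  have hdress : ∀ x ∈ D, ∀ s : ℝ, s * s * (q x ⬝ᵥ q x) = 2 → _ := fun x hx s hs =>
    dressing_geometric (Mt := fun l => dressedFrame n k E α L x l) (hE.hasBlocks (hDΩ hx))
      (hE.hasPotential hΩ hΩc.isPreconnected h0 (hDΩ hx)) hα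
      (smul_isotropic hs (hiso x (hDΩ hx))).1 (smul_isotropic hs (hiso x (hDΩ hx))).2
      (fun l => by
        have h1 : Submodule.span ℂ {typedVec θ (s • q x) (s • b x)} = dressedLine E α L x := by
          rw [hline x (hDΩ hx)]
          exact (isNormalizedSpan_smul hα hs (hiso x (hDΩ hx))).span.symm
        rw [h1, dressedFrame]) c
  have hsq : ∀ x ∈ D, ∀ s : ℝ, s * s * (q x ⬝ᵥ q x) = 2 → s * s = 2 * (q x ⬝ᵥ q x)⁻¹ :=
    fun x hx s hs => by rw [← div_eq_mul_inv, eq_div_iff (hDS x hx), hs]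
  have hsum : ∀ (x : Pt n) (s : ℝ), ∑ j, (s • q x) j • frameVec (E x) j =
      s • ∑ j, q x j • frameVec (E x) j := by
    intro x s
    rw [Finset.smul_sum]
    exact Finset.sum_congr rfl fun j _ => by rw [Pi.smul_apply, smul_smul, smul_eq_mul]
  have het : ∀ x ∈ D, ∀ m, frameVec (fun l => dressedFrame n k E α L x l) m = frameVec (E x) m -
      (2 * (q x ⬝ᵥ q x)⁻¹ * q x m) • ∑ j, q x j • frameVec (E x) j := by
    intro x hx m
    obtain ⟨s, hs⟩ := hscale x hx
    rw [(hdress x hx s hs).2.2.1 m, hsum, smul_smul, ← hsq x hx s hs, Pi.smul_apply, smul_eq_mul]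
    congr 2
    ring
  have hut : ∀ x ∈ D, ∀ i, metricField n k (fun l => dressedFrame n k E α L x l) c i =
      metricField n k (E x) c i + η * (2 * (q x ⬝ᵥ q x)⁻¹) *
        (b x ⬝ᵥ metricField n k (E x) c) * (eps n k i * b x i) := by
    intro x hx i
    obtain ⟨s, hs⟩ := hscale x hx
    rw [(hdress x hx s hs).2.2.2.1 i, ← hsq x hx s hs, smul_dotProduct, Pi.smul_apply, smul_eq_mul,
      smul_eq_mul]
    ring
  have hEtb : ∀ x ∈ D, HasBlocks n k (fun l => dressedFrame n k E α L x l) ∧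
      HasPotential n k (fun l => dressedFrame n k E α L x l) := by
    intro x hx
    obtain ⟨s, hs⟩ := hscale x hx
    exact ⟨(hdress x hx s hs).1, (hdress x hx s hs).2.1⟩
  refine ⟨⟨hDo, h0D, fun x hx => ?_⟩,
    fun x hx => ⟨hE.hasBlocks hx, hE.hasPotential hΩ hΩc.isPreconnected h0 hx⟩, hEtb,
    fun x hx => hA.injective_fderiv_iff hx, hU ▸ hA.isIsothermic,
    hU ▸ (hA.mono hA.isOpen_ne_zero fun _ hx => hx.1).isUnitNormal, fun x hx i => ?_, ?_⟩
  · obtain ⟨s, hs⟩ := hscale x hx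
    simp only [hline x (hDΩ hx)]
    exact ⟨_, _, isNormalizedSpan_smul hα hs (hiso x (hDΩ hx))⟩
  · rw [hU] at hx
    exact hA.isPrincipalDirection hx.1 (hx.2 i)
  intro Q Z T ft hspan hT hft
  have hQZ : ∀ x ∈ D, ∃ s : ℝ, s * s * (q x ⬝ᵥ q x) = 2 ∧ Q x = s • q x ∧
      T x = ((s * ((b x ⬝ᵥ metricField n k (E x) c) * a⁻¹) : ℝ) : ℂ) := by
    intro x hx
    have h1 := hspan x hx
    simp only [hline x (hDΩ hx)] at h1
    obtain ⟨s, hs, hQ, hZ⟩ := h1.exists_smul ((hDq x).1 hx).2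
    refine ⟨s, hs, hQ, ?_⟩
    have h2 : ((fun j => θ * (((s • b x) j : ℝ) : ℂ)) ⬝ᵥ
        fun j => (metricField n k (E x) c j : ℂ)) =
          θ * ((s * (b x ⬝ᵥ metricField n k (E x) c) : ℝ) : ℂ) := by
      simp only [dotProduct, Pi.smul_apply, smul_eq_mul]
      push_cast
      rw [Finset.mul_sum, Finset.mul_sum]
      exact Finset.sum_congr rfl fun j _ => by ring
    rw [hT, hZ, h2, hα.eq, mul_div_mul_left _ _ hα.θ_ne_zero]
    push_cast
    ring
  have hsurf : ∀ x ∈ D, surfacePt (fun l => dressedFrame n k E α L x l) c = ft x := by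
    intro x hx
    obtain ⟨s, hs, hQ, hTx⟩ := hQZ x hx
    rw [(hdress x hx s hs).2.2.2.2, hft, hTx, Complex.ofReal_re, hQ, smul_dotProduct, smul_eq_mul,
      mul_assoc]
  have hft' : ∀ x ∈ D, ft x = surfacePt (E x) c - (2 * (q x ⬝ᵥ q x)⁻¹ *
      ((b x ⬝ᵥ metricField n k (E x) c) * a⁻¹)) • ∑ j, q x j • frameVec (E x) j := by
    intro x hx
    obtain ⟨s, hs, hQ, hTx⟩ := hQZ x hx
    rw [hft, hTx, Complex.ofReal_re, hQ, hsum, smul_smul, ← hsq x hx s hs]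
    congr 2
    ring
  have hetQ : ∀ x ∈ D, ∀ i, frameVec (fun l => dressedFrame n k E α L x l) i =
      frameVec (E x) i - Q x i • ∑ j, Q x j • frameVec (E x) j := by
    intro x hx i
    obtain ⟨s, hs, hQ, -⟩ := hQZ x hx
    rw [(hdress x hx s hs).2.2.1 i, hQ]
  have hmeet : ∀ x ∈ D, ∀ i, Q x i ≠ 0 →
      ft x - ((T x).re / Q x i) • frameVec (fun l => dressedFrame n k E α L x l) i =
        surfacePt (E x) c - ((T x).re / Q x i) • frameVec (E x) i := by
    intro x hx i hi
    rw [hft, hetQ x hx, smul_sub, smul_smul, div_mul_cancel₀ _ hi]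
    abel
  have hB : AdaptedFrame n k ft (fun i x => frameVec (fun l => dressedFrame n k E α L x l) i)
      (fun x => metricField n k (fun l => dressedFrame n k E α L x l) c) D :=
    hdd.adaptedFrame_dressed hn hDo hDΩ hDS hft' het hut
      (fun x hx => frameVec_orthonormal (hEtb x hx).1.2.1)
      (fun x hx => metricField_isotropic (hEtb x hx).1.2.2 hc)
  refine ⟨fun x hx => ⟨?_, hsurf x hx⟩, fun x hx => hB.injective_fderiv_iff hx,
    hUt ▸ hB.isIsothermic, hUt ▸ (hB.mono hB.isOpen_ne_zero fun _ hx => hx.1).isUnitNormal,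
    fun x hx i => ?_, hetQ, ?_, hmeet⟩
  · obtain ⟨s, -, -, hTx⟩ := hQZ x hx
    rw [hTx, Complex.ofReal_im]
  · rw [hUt] at hx
    exact hB.isPrincipalDirection hx.1 (hx.2 i)
  -- the conditions `Qᵢ ≠ 0` and `T ≠ 0` do not depend on the sign of `(Q, Z)`
  have hVo : IsOpen {x | x ∈ U ∧ x ∈ Ut ∧ (∀ i, Q x i ≠ 0) ∧ T x ≠ 0} := by
    have hV : {x | x ∈ U ∧ x ∈ Ut ∧ (∀ i, Q x i ≠ 0) ∧ T x ≠ 0} = (U ∩ Ut) ∩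
        (D ∩ (fun x => (q x, b x ⬝ᵥ metricField n k (E x) c)) ⁻¹'
          ({w | ∀ i, w i ≠ 0} ×ˢ {0}ᶜ)) := by
      ext x
      have key : x ∈ D → (((∀ i, Q x i ≠ 0) ∧ T x ≠ 0) ↔
          ((∀ i, q x i ≠ 0) ∧ b x ⬝ᵥ metricField n k (E x) c ≠ 0)) := by
        intro hx
        obtain ⟨s, hs, hQ, hTx⟩ := hQZ x hx
        have hs0 : s ≠ 0 := fun h => by
          rw [h] at hs
          norm_num at hs
        rw [hTx, hQ, Complex.ofReal_ne_zero]
        simp [hs0, hα.ne_zero]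
      have hxD : x ∈ Ut → x ∈ D := fun hx => by
        rw [hUt] at hx
        exact hx.1
      simp only [Set.mem_ofPred_eq, Set.mem_inter_iff, Set.mem_preimage, Set.mem_prod,
        Set.mem_compl_iff, Set.mem_singleton_iff]
      tauto
    rw [hV]
    refine ((hU ▸ hA.isOpen_ne_zero).inter (hUt ▸ hB.isOpen_ne_zero)).inter ?_
    refine ContinuousOn.isOpen_inter_preimage ((hqc.mono hDΩ).prodMk ?_) hDo (IsOpen.prod ?_ ?_)
    · exact continuousOn_finsetSum _ fun j _ => (((hdd.smooth_b j).continuousOn).mul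
        ((hA.smooth_u j).continuousOn)).mono hDΩ
    · simp only [Set.ofPred_forall]
      exact isOpen_iInter_of_finite fun i => isOpen_ne_fun (continuous_apply i) continuous_const
    · exact isOpen_compl_singleton
  refine (hA.mono hVo fun x hx => ?_).isRibaucour (hB.mono hVo fun x hx => ?_) (fun x hx => ?_)
    (fun x hx => ?_) (fun j x => -((T x).re / Q x j)) (fun x hx => ?_) (fun x hx j => ?_)
  · have := hx.1
    rw [hU] at this
    exact this.1
  · have := hx.2.1
    rw [hUt] at this
    exact this.1
  · have := hx.1
    rw [hU] at this
    exact this.2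
  · have := hx.2.1
    rw [hUt] at this
    exact this.2
  · have hxD := hx.2.1
    rw [hUt] at hxD
    obtain ⟨s, -, -, hTx⟩ := hQZ x hxD.1
    have h1 := hx.2.2.2
    rw [hTx, Complex.ofReal_ne_zero] at h1
    rw [hTx, Complex.ofReal_re]
    exact neg_ne_zero.2 (div_ne_zero h1 (hx.2.2.1 _))
  · have hxD := hx.2.1
    rw [hUt] at hxD
    have h1 := hmeet x hxD.1 j (hx.2.2.1 j)
    simp only [neg_smul, ← sub_eq_add_neg]
    exact h1
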